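/- Let $N$ be a free abelian group of finite rank, $M=\mathrm{Hom}(N,\mathbb Z)$, $T=\mathrm{Hom}(M,\mathbb C^*)$ the torus, $\Delta$ a (nonempty, finite) fan of strongly convex rational polyhedral cones in $N_{\mathbb R}$, and $X=X_\Delta$ the associated normal toric variety, with its classical topology and its $T$-action. For a topological space $Z$ let $Sh(Z)$ be the category of sheaves of complex vector spaces on $Z$. For a $T$-invariant subspace $Z\subset X$ let $LC(Z)\subset Sh(Z)$ be the full (abelian) subcategory of the sheaves whose restriction to each $T$-orbit in $Z$ is locally constant, and let $D^b_{LC}(Sh(Z))\subset D^b(Sh(Z))$ be the full subcategory of the complexes whose cohomology sheaves all lie in $LC(Z)$. (a) The natural functor $E_X\colon D^b(LC(X))\to D^b_{LC}(Sh(X))$ induced by the inclusion $LC(X)\subset Sh(X)$ is an equivalence of categories. (b) Let $j\colon Y\hookrightarrow X$ be the inclusion of a locally closed $T$-invariant subspace, and let $\Gamma_Y\colon Sh(X)\to Sh(X)$ be the functor of sections with support in $Y$: $\Gamma_Y F(V)=\{s\in F(V\cap U) : s|_{(V\cap U)\setminus Y}=0\}$, where $U=X\setminus(\overline Y\setminus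 Y)$. Then the natural functor $E_Y\colon D^b(LC(Y))\to D^b_{LC}(Sh(Y))$ is an equivalence as well; the categories $LC(X)$ and $LC(Y)$ have enough injectives; $j_*$ maps $LC(Y)$ to $LC(X)$ and $\Gamma_Y$ maps $LC(X)$ to itself; the right derived functors of $j_*\colon LC(Y)\to LC(X)$ and of $\Gamma_Y\colon LC(X)\to LC(X)$ restrict to functors $\mathbf R_{LC}j_*\colon D^b(LC(Y))\to D^b(LC(X))$ and $\mathbf R_{LC}\Gamma_Y\colon D^b(LC(X))\to D^b(LC(X))$; and the usual derived functors, of $j_*\colon Sh(Y)\to Sh(X)$ and of $\Gamma_Y\colon Sh(X)\to Sh(X)$, restrict to functors $\mathbf Rj_*\colon D^b_{LC}(Sh(Y))\to D^b_{LC}(Sh(X))$ and $\mathbf R\Gamma_Y\colon D^b_{LC}(Sh(X))\to D^b_{LC}(Sh(X))$. Put $j^!_{LC}=j^*\mathbf R_{LC}\Gamma_Y$ and $j^!=j^*\mathbf R\Gamma_Y$. Then there are isomorphisms of functors $$E_X\circ \mathbf R_{LC}j_*\;\cong\;\mathbf Rj_*\circ E_Y,\qquad E_Y\circ j^!_{LC}\;\cong\;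 j^!\circ E_X .$$ -/

import Mathlib

open CategoryTheory CategoryTheory.Limits TopologicalSpace
open scoped TensorProduct Topology

universe u w

namespace Toric

noncomputable section

/-- The character lattice `M = Hom(N, ℤ)` of the torus with cocharacter lattice `N`. -/
abbrev CharLattice (N : Type u) [AddCommGroup N] : Type u := Module.Dual ℤ N

/-- The torus `T = Hom(M, ℂˣ)` with cocharacter lattice `N`. (An additive character of a group
with values in `ℂ` takes only invertible values.) -/
abbrev Torus (N : Type u) [AddCommGroup N] : Type u := AddChar (CharLattice N) ℂ

/-- The pairing of a character `m ∈ M` with the points of `N_ℝ = ℝ ⊗ N`. -/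
def pairing {N : Type u} [AddCommGroup N] (m : CharLattice N) : (ℝ ⊗[ℤ] N) →ₗ[ℝ] ℝ :=
  LinearMap.liftBaseChange ℝ ((Int.castAddHom ℝ).toIntLinearMap ∘ₗ m)

lemma pairing_add {N : Type u} [AddCommGroup N] (a b : CharLattice N) (v : ℝ ⊗[ℤ] N) :
    pairing (a + b) v = pairing a v + pairing b v := by
  simp [pairing, LinearMap.comp_add]

lemma pairing_zero {N : Type u} [AddCommGroup N] (v : ℝ ⊗[ℤ] N) :
    pairing (0 : CharLattice N) v = 0 := by
  simp [pairing]

lemma pairing_nsmul {N : Type u} [AddCommGroup N] (k : ℕ) (a : CharLattice N) (v : ℝ ⊗[ℤ] N) :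
    pairing (k • a) v = k * pairing a v := by
  induction k with
  | zero => simp [pairing_zero]
  | succ k ih => rw [succ_nsmul, pairing_add, ih]; push_cast; ring

/-- The semigroup `S_σ = σ^∨ ∩ M` of a cone `σ`. -/
def dualMonoid {N : Type u} [AddCommGroup N] (σ : PointedCone ℝ (ℝ ⊗[ℤ] N)) :
    AddSubmonoid (CharLattice N) where
  carrier := {m | ∀ v ∈ σ, 0 ≤ pairing m v}
  zero_mem' := fun v _ => by rw [pairing_zero]
  add_mem' := fun {a b} ha hb v hv => by
    rw [pairing_add]
    exact add_nonneg (ha v hv) (hb v hv)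

lemma dualMonoid_anti {N : Type u} [AddCommGroup N] {σ τ : PointedCone ℝ (ℝ ⊗[ℤ] N)}
    (h : τ ≤ σ) : dualMonoid σ ≤ dualMonoid τ :=
  fun _ hm v hv => hm v (h hv)

/-- `τ` is the face `σ ∩ m^⊥` of `σ` cut out by some `m ∈ σ^∨ ∩ M`. (For a rational polyhedral
cone `σ` every face is cut out by a lattice point of the dual cone.) -/
def IsFace {N : Type u} [AddCommGroup N] (τ σ : PointedCone ℝ (ℝ ⊗[ℤ] N)) : Prop :=
  ∃ m ∈ dualMonoid σ, ∀ v, v ∈ τ ↔ v ∈ σ ∧ pairing m v = 0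

/-- A (nonempty, finite) fan of strongly convex rational polyhedral cones in `N_ℝ`. -/
structure Fan (N : Type u) [AddCommGroup N] where
  /-- the cones of the fan -/
  cones : Set (PointedCone ℝ (ℝ ⊗[ℤ] N))
  finite : cones.Finite
  nonempty : cones.Nonempty
  rational : ∀ σ ∈ cones, ∃ s : Finset N, σ = PointedCone.hull ℝ ((fun n : N => 1 ⊗ₜ[ℤ] n) '' s)
  stronglyConvex : ∀ σ ∈ cones, ∀ v, v ∈ σ → -v ∈ σ → v = 0
  face_mem : ∀ σ ∈ cones, ∀ τ, IsFace τ σ → τ ∈ cones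
  inter_isFace : ∀ σ ∈ cones, ∀ τ ∈ cones, IsFace (σ ⊓ τ) σ

/-- The affine toric variety `U_σ = Spec ℂ[S_σ]`, as the set of its complex points: the semigroup
homomorphisms from `S_σ` to `(ℂ, ·)`. -/
def Chart {N : Type u} [AddCommGroup N] (σ : PointedCone ℝ (ℝ ⊗[ℤ] N)) : Type u :=
  AddChar (dualMonoid σ) ℂ

instance {N : Type u} [AddCommGroup N] (σ : PointedCone ℝ (ℝ ⊗[ℤ] N)) :
    FunLike (Chart σ) (dualMonoid σ) ℂ :=
  inferInstanceAs (FunLike (AddChar (dualMonoid σ) ℂ) (dualMonoid σ) ℂ)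

/-- The classical topology on `U_σ`: the coarsest one for which all regular functions, i.e. the
characters in `S_σ`, are continuous. -/
instance {N : Type u} [AddCommGroup N] (σ : PointedCone ℝ (ℝ ⊗[ℤ] N)) :
    TopologicalSpace (Chart σ) :=
  TopologicalSpace.induced (fun x : Chart σ => (x : dualMonoid σ → ℂ)) Pi.topologicalSpace

section charts

variable {N : Type u} [AddCommGroup N] {σ τ ρ : PointedCone ℝ (ℝ ⊗[ℤ] N)}

/-- The map `U_τ → U_σ` for `τ ⊆ σ`, given by restriction of semigroup homomorphisms. -/
def Chart.res (h : τ ≤ σ) (z : Chart τ) : Chart σ :=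
  AddChar.compAddMonoidHom z (AddSubmonoid.inclusion (dualMonoid_anti h))

lemma Chart.res_apply (h : τ ≤ σ) (z : Chart τ) (m : dualMonoid σ) :
    z.res h m = z ⟨m, dualMonoid_anti h m.2⟩ := rfl

lemma Chart.ext {x y : Chart σ} (h : ∀ m, x m = y m) : x = y := DFunLike.ext _ _ h

lemma Chart.map_zero (x : Chart σ) : x 0 = 1 := AddChar.map_zero_eq_one x

lemma Chart.map_add (x : Chart σ) (a b : dualMonoid σ) : x (a + b) = x a * x b :=
  AddChar.map_add_eq_mul x a b

lemma Chart.map_nsmul (x : Chart σ) (k : ℕ) (a : dualMonoid σ) : x (k • a) = x a ^ k :=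
  AddChar.map_nsmul_eq_pow x k a

lemma Chart.continuous_eval (m : dualMonoid σ) : Continuous fun x : Chart σ => x m :=
  (continuous_apply m).comp continuous_induced_dom

lemma Chart.continuous_iff {Z : Type*} [TopologicalSpace Z] {f : Z → Chart σ} :
    Continuous f ↔ ∀ m, Continuous fun z => f z m := by
  rw [continuous_induced_rng, continuous_pi_iff]
  rfl

lemma Chart.continuous_res (h : τ ≤ σ) : Continuous (Chart.res h) :=
  Chart.continuous_iff.2 fun _ => Chart.continuous_eval _

/-- The action of the torus on `U_σ`. -/
def Chart.smul (t : Torus N) (x : Chart σ) : Chart σ :=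
  show AddChar (dualMonoid σ) ℂ from
    { toFun := fun m => t m * x m
      map_zero_eq_one' := by
        rw [Chart.map_zero, AddSubmonoid.coe_zero, AddChar.map_zero_eq_one, mul_one]
      map_add_eq_mul' := fun a b => by
        rw [Chart.map_add, AddSubmonoid.coe_add, AddChar.map_add_eq_mul, mul_mul_mul_comm] }

lemma Chart.smul_apply (t : Torus N) (x : Chart σ) (m : dualMonoid σ) :
    Chart.smul t x m = t m * x m := rfl

lemma exists_add_nsmul_mem {s : Finset N}
    (hs : σ = PointedCone.hull ℝ ((fun n : N => 1 ⊗ₜ[ℤ] n) '' s)) {m : CharLattice N}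
    (hm : m ∈ dualMonoid σ) (hτ : ∀ v, v ∈ τ ↔ v ∈ σ ∧ pairing m v = 0)
    {u : CharLattice N} (hu : u ∈ dualMonoid τ) : ∃ k : ℕ, u + k • m ∈ dualMonoid σ := by
  have hgen : ∀ n ∈ s, (1 ⊗ₜ[ℤ] n : ℝ ⊗[ℤ] N) ∈ σ := fun n hn => by
    rw [hs]; exact Submodule.subset_span ⟨n, hn, rfl⟩
  have h1 : ∀ n ∈ s, ∃ k : ℕ, ∀ l ≥ k, 0 ≤ pairing (u + l • m) (1 ⊗ₜ[ℤ] n) := by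
    intro n hn
    rcases (hm _ (hgen n hn)).eq_or_lt with h0 | h0
    · refine ⟨0, fun l _ => ?_⟩
      rw [pairing_add, pairing_nsmul, ← h0, mul_zero, add_zero]
      exact hu _ ((hτ _).2 ⟨hgen n hn, h0.symm⟩)
    · obtain ⟨k, hk⟩ := Archimedean.arch (-pairing u (1 ⊗ₜ[ℤ] n)) h0
      refine ⟨k, fun l hl => ?_⟩
      rw [pairing_add, pairing_nsmul]
      rw [nsmul_eq_mul] at hk
      have : (k : ℝ) * pairing m (1 ⊗ₜ[ℤ] n) ≤ l * pairing m (1 ⊗ₜ[ℤ] n) := by gcongr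
      linarith
  choose! k hk using h1
  refine ⟨s.sup k, fun v hv => ?_⟩
  rw [hs] at hv
  induction hv using Submodule.span_induction with
  | mem v hv =>
    obtain ⟨n, hn, rfl⟩ := hv
    exact hk n hn _ (Finset.le_sup hn)
  | zero => simp
  | add v w _ _ hv hw => rw [map_add]; exact add_nonneg hv hw
  | smul c v _ hv =>
    have : c • v = (c : ℝ) • v := rfl
    rw [this, map_smul]
    exact mul_nonneg c.2 hv

lemma exists_face_extension {s : Finset N}
    (hs : σ = PointedCone.hull ℝ ((fun n : N => 1 ⊗ₜ[ℤ] n) '' s)) {m : CharLattice N}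
    (hm : m ∈ dualMonoid σ) (hτ : ∀ v, v ∈ τ ↔ v ∈ σ ∧ pairing m v = 0) (hle : τ ≤ σ) :
    (∀ z z' : Chart τ, z.res hle = z'.res hle → z = z') ∧
    (∀ z : Chart τ, z.res hle ⟨m, hm⟩ ≠ 0) ∧
    (∃ e : {x : Chart σ // x ⟨m, hm⟩ ≠ 0} → Chart τ, Continuous e ∧
      ∀ x, (e x).res hle = x.1) := by
  have hk : ∀ u : dualMonoid τ, ∃ k : ℕ, (u : CharLattice N) + k • m ∈ dualMonoid σ :=
    fun u => exists_add_nsmul_mem hs hm hτ u.2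
  have hneg : -m ∈ dualMonoid τ := fun v hv => by
    have := pairing_add m (-m) v
    rw [add_neg_cancel, pairing_zero, ((hτ v).1 hv).2] at this
    linarith
  have hne : ∀ z : Chart τ, z.res hle ⟨m, hm⟩ ≠ 0 := by
    intro z h0
    have h1 := z.map_add ⟨m, dualMonoid_anti hle hm⟩ ⟨-m, hneg⟩
    have h2 : (⟨m, dualMonoid_anti hle hm⟩ + ⟨-m, hneg⟩ : dualMonoid τ) = 0 :=
      Subtype.ext (add_neg_cancel m)
    rw [h2, z.map_zero, ← Chart.res_apply hle z ⟨m, hm⟩, h0, zero_mul] at h1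
    exact one_ne_zero h1
  refine ⟨fun z z' h => Chart.ext fun u => ?_, hne, ?_⟩
  · obtain ⟨k, hk⟩ := hk u
    have key : ∀ z : Chart τ,
        z.res hle ⟨_, hk⟩ = z u * z.res hle ⟨m, hm⟩ ^ k := by
      intro z
      rw [Chart.res_apply, Chart.res_apply, ← Chart.map_nsmul, ← Chart.map_add]
      rfl
    have h1 := key z
    rw [h, key z'] at h1
    exact (mul_right_cancel₀ (pow_ne_zero k (hne z')) h1).symm
  · choose k hk using hk
    have indep : ∀ (x : Chart σ), x ⟨m, hm⟩ ≠ 0 → ∀ (u : CharLattice N) (a b : ℕ)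
        (ha : u + a • m ∈ dualMonoid σ) (hb : u + b • m ∈ dualMonoid σ),
        x ⟨_, ha⟩ / x ⟨m, hm⟩ ^ a = x ⟨_, hb⟩ / x ⟨m, hm⟩ ^ b := by
      intro x hx u a b ha hb
      rw [div_eq_div_iff (pow_ne_zero _ hx) (pow_ne_zero _ hx), ← Chart.map_nsmul,
        ← Chart.map_nsmul, ← Chart.map_add, ← Chart.map_add]
      congr 1
      exact Subtype.ext (add_right_comm u (a • m) (b • m))
    have heq : ∀ u v : dualMonoid τ, ((u + v : dualMonoid τ) : CharLattice N) + (k u + k v) • m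
        = (u + k u • m) + (v + k v • m) := fun u v => by
      rw [add_smul, AddSubmonoid.coe_add, add_add_add_comm]
    refine ⟨fun x => (show AddChar (dualMonoid τ) ℂ from
      { toFun := fun u => x.1 ⟨_, hk u⟩ / x.1 ⟨m, hm⟩ ^ k u
        map_zero_eq_one' := ?_
        map_add_eq_mul' := ?_ }), ?_, ?_⟩
    · rw [indep x.1 x.2 _ (k 0) 0 _ (by simp)]
      have : (⟨((0 : dualMonoid τ) : CharLattice N) + 0 • m,
          by simp⟩ : dualMonoid σ) = 0 := Subtype.ext (by simp)
      rw [this, Chart.map_zero, pow_zero, div_one]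
    · intro u v
      have hmem : ((u + v : dualMonoid τ) : CharLattice N) + (k u + k v) • m ∈ dualMonoid σ := by
        have := (dualMonoid σ).add_mem (hk u) (hk v)
        rwa [← heq u v] at this
      rw [indep x.1 x.2 _ (k (u + v)) (k u + k v) _ hmem, div_mul_div_comm, ← pow_add,
        ← Chart.map_add]
      congr 2
      exact Subtype.ext (heq u v)
    · refine Chart.continuous_iff.2 fun u => ?_
      refine Continuous.div ?_ ?_ fun x => pow_ne_zero _ x.2
      · exact (Chart.continuous_eval _).comp continuous_subtype_val
      · exact ((Chart.continuous_eval _).comp continuous_subtype_val).pow _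
    · intro x
      refine Chart.ext fun u => ?_
      have := indep x.1 x.2 (u : CharLattice N) (k ⟨u, dualMonoid_anti hle u.2⟩) 0
        (hk ⟨u, dualMonoid_anti hle u.2⟩) (by rw [zero_smul, add_zero]; exact u.2)
      have h0 : (⟨(u : CharLattice N) + 0 • m, by rw [zero_smul, add_zero]; exact u.2⟩ :
          dualMonoid σ) = u :=
        Subtype.ext ((congrArg _ (zero_smul ℕ m)).trans (add_zero _))
      rw [pow_zero, div_one, h0] at this
      exact this

end charts

/-- The gluing data: points of two charts `U_σ`, `U_τ` are identified if they come from the same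
point of `U_{σ ∩ τ}`. -/
def Fan.setoid {N : Type u} [AddCommGroup N] (Δ : Fan N) :
    Setoid (Σ σ : Δ.cones, Chart σ.1) where
  r p q := ∃ z : Chart (p.1.1 ⊓ q.1.1), z.res inf_le_left = p.2 ∧ z.res inf_le_right = q.2
  iseqv :=
    { refl := fun p => ⟨p.2.res (le_inf le_rfl le_rfl), rfl, rfl⟩
      symm := by
        rintro p q ⟨z, hp, hq⟩
        exact ⟨z.res (le_inf inf_le_right inf_le_left), hq, hp⟩
      trans := by
        rintro ⟨⟨σ, hσ⟩, x⟩ ⟨⟨τ, hτ⟩, y⟩ ⟨⟨ρ, hρ⟩, w⟩ ⟨z₁, h₁, h₁'⟩ ⟨z₂, h₂, h₂'⟩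
        dsimp only at *
        obtain ⟨s, hs⟩ := Δ.rational τ hτ
        obtain ⟨m₁, hm₁, hf₁⟩ := Δ.inter_isFace τ hτ σ hσ
        rw [inf_comm] at hf₁
        obtain ⟨m₂, hm₂, hf₂⟩ := Δ.inter_isFace τ hτ ρ hρ
        have e₁ := exists_face_extension hs hm₁ hf₁ inf_le_right
        have e₂ := exists_face_extension hs hm₂ hf₂ inf_le_left
        have hf : ∀ v, v ∈ σ ⊓ τ ⊓ ρ ↔ v ∈ τ ∧ pairing (m₁ + m₂) v = 0 := by
          intro v
          have a₁ := hf₁ v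
          have a₂ := hf₂ v
          rw [pairing_add]
          simp only [Submodule.mem_inf] at *
          constructor
          · rintro ⟨⟨b₁, b₂⟩, b₃⟩
            exact ⟨b₂, by rw [(a₁.1 ⟨b₁, b₂⟩).2, (a₂.1 ⟨b₂, b₃⟩).2, add_zero]⟩
          · rintro ⟨b₂, b⟩
            have c₁ := hm₁ v b₂
            have c₂ := hm₂ v b₂
            exact ⟨a₁.2 ⟨b₂, by linarith⟩, (a₂.2 ⟨b₂, by linarith⟩).2⟩
        have e := exists_face_extension hs ((dualMonoid τ).add_mem hm₁ hm₂) hf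
          (inf_le_left.trans inf_le_right)
        obtain ⟨f, -, hf⟩ := e.2.2
        have hy : y ⟨m₁ + m₂, (dualMonoid τ).add_mem hm₁ hm₂⟩ ≠ 0 := by
          have : (⟨m₁ + m₂, (dualMonoid τ).add_mem hm₁ hm₂⟩ : dualMonoid τ)
            = ⟨m₁, hm₁⟩ + ⟨m₂, hm₂⟩ := rfl
          rw [this, Chart.map_add]
          refine mul_ne_zero ?_ ?_
          · rw [← h₁']; exact e₁.2.1 z₁
          · rw [← h₂]; exact e₂.2.1 z₂
        have g₁ : (f ⟨y, hy⟩).res inf_le_left = z₁ := e₁.1 _ _ (by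
          rw [h₁']; exact hf ⟨y, hy⟩)
        have g₂ : (f ⟨y, hy⟩).res (le_inf (inf_le_left.trans inf_le_right) inf_le_right) = z₂ :=
          e₂.1 _ _ (by rw [h₂]; exact hf ⟨y, hy⟩)
        refine ⟨(f ⟨y, hy⟩).res (le_inf (inf_le_left.trans inf_le_left) inf_le_right), ?_, ?_⟩
        · rw [← h₁, ← g₁]; rfl
        · rw [← h₂', ← g₂]; rfl }

/-- The toric variety `X_Δ` of the fan `Δ` (as the set of its complex points), obtained by gluing
the affine toric varieties `U_σ` and `U_τ` along `U_{σ ∩ τ}` for all `σ, τ ∈ Δ`. -/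
def Fan.X {N : Type u} [AddCommGroup N] (Δ : Fan N) : Type u := Quotient Δ.setoid

/-- The classical topology of `X_Δ`. -/
instance {N : Type u} [AddCommGroup N] (Δ : Fan N) : TopologicalSpace Δ.X :=
  inferInstanceAs (TopologicalSpace (Quotient Δ.setoid))

/-- The action of the torus `T` on `X_Δ`. -/
instance {N : Type u} [AddCommGroup N] (Δ : Fan N) : MulAction (Torus N) Δ.X where
  smul t := Quotient.map (fun p => ⟨p.1, Chart.smul t p.2⟩) (by
    rintro p q ⟨z, hp, hq⟩
    refine ⟨Chart.smul t z, ?_, ?_⟩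
    · rw [← hp]; rfl
    · rw [← hq]; rfl)
  one_smul := by
    rintro ⟨σ, x⟩
    refine congrArg (fun y : Chart σ.1 => (Quotient.mk Δ.setoid ⟨σ, y⟩))
      (Chart.ext fun m => ?_)
    exact (Chart.smul_apply _ _ _).trans (one_mul _)
  mul_smul := by
    rintro s t ⟨σ, x⟩
    refine congrArg (fun y : Chart σ.1 => (Quotient.mk Δ.setoid ⟨σ, y⟩))
      (Chart.ext fun m => ?_)
    simp only [Chart.smul_apply, AddChar.mul_apply, mul_assoc]

/-- The inclusion of the chart `U_σ` in `X_Δ`. -/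
def Fan.chart {N : Type u} [AddCommGroup N] (Δ : Fan N) (σ : Δ.cones) (x : Chart σ.1) : Δ.X :=
  Quotient.mk Δ.setoid ⟨σ, x⟩

lemma Fan.isOpenEmbedding_chart {N : Type u} [AddCommGroup N] (Δ : Fan N) (σ : Δ.cones) :
    Topology.IsOpenEmbedding (Δ.chart σ) := by
  refine Topology.IsOpenEmbedding.of_continuous_injective_isOpenMap ?_ ?_ ?_
  · exact continuous_quotient_mk'.comp continuous_sigmaMk
  · intro x y h
    obtain ⟨z, hx, hy⟩ := Quotient.exact h
    exact hx.symm.trans hy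
  · intro W hW
    have h0 : IsOpen ((Quotient.mk Δ.setoid) ⁻¹' (Δ.chart σ '' W)) := by
      rw [isOpen_sigma_iff]
      intro τ
      obtain ⟨s, hs⟩ := Δ.rational τ.1 τ.2
      obtain ⟨m, hm, hf⟩ := Δ.inter_isFace τ.1 τ.2 σ.1 σ.2
      rw [inf_comm] at hf
      obtain ⟨e₁, e₂, e, he, her⟩ := exists_face_extension hs hm hf inf_le_right
      have hopen : IsOpen {x : Chart τ.1 | x ⟨m, hm⟩ ≠ 0} :=
        isOpen_ne.preimage (Chart.continuous_eval _)
      have := hopen.isOpenMap_subtype_val _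
        (hW.preimage ((Chart.continuous_res (inf_le_left : σ.1 ⊓ τ.1 ≤ σ.1)).comp he))
      convert this using 1
      ext y
      constructor
      · rintro ⟨x, hx, hxy⟩
        obtain ⟨z, hzx, hzy⟩ := Quotient.exact hxy
        have hy : y ⟨m, hm⟩ ≠ 0 := by
          have := e₂ z
          rwa [hzy] at this
        refine ⟨⟨y, hy⟩, ?_, rfl⟩
        have : e ⟨y, hy⟩ = z := e₁ _ _ ((her _).trans hzy.symm)
        simp only [Set.mem_preimage, Function.comp_apply, this]
        rwa [hzx]
      · rintro ⟨⟨y, hy⟩, hyW, rfl⟩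
        exact ⟨_, hyW, Quotient.sound ⟨e ⟨y, hy⟩, rfl, her _⟩⟩
    exact h0

lemma Fan.smul_chart {N : Type u} [AddCommGroup N] (Δ : Fan N) (σ : Δ.cones) (t : Torus N)
    (x : Chart σ.1) : t • Δ.chart σ x = Δ.chart σ (Chart.smul t x) := rfl

/-- Orbits are locally connected (they are tori); this is what makes the sheaves that are locally
constant on each orbit an abelian subcategory. -/
instance Fan.locallyConnectedSpace_orbit {N : Type u} [AddCommGroup N] [Module.Free ℤ N]
    [Module.Finite ℤ N] (Δ : Fan N) (x : Δ.X) :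
    LocallyConnectedSpace (MulAction.orbit (Torus N) x) := by
  obtain ⟨⟨σ, u⟩, rfl⟩ := Quotient.exists_rep x
  change LocallyConnectedSpace (MulAction.orbit (Torus N) (Δ.chart σ u))
  let F : Set (CharLattice N) := {m | ∃ h : m ∈ dualMonoid σ.1, u ⟨m, h⟩ ≠ 0}
  let L : Submodule ℤ (CharLattice N) := Submodule.span ℤ F
  let b := Module.Free.chooseBasis ℤ L
  let I := Module.Free.ChooseBasisIndex ℤ L
  let D : Set (I → ℂ) := {z | ∀ i, z i ≠ 0}
  have hD : IsOpen D := by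
    have : D = ⋂ i, {z : I → ℂ | z i ≠ 0} := by ext; simp [D]
    rw [this]
    exact isOpen_iInter_of_finite fun i => isOpen_ne.preimage (continuous_apply i)
  have : LocallyConnectedSpace D := hD.locallyConnectedSpace
  -- the character of `L` with given values on the basis
  let c : D → L → ℂ := fun z l => ∏ i, z.1 i ^ (b.repr l i)
  have c_add : ∀ z l l', c z (l + l') = c z l * c z l' := by
    intro z l l'
    simp only [c, map_add, Finsupp.coe_add, Pi.add_apply]
    rw [← Finset.prod_mul_distrib]
    exact Finset.prod_congr rfl fun i _ => zpow_add₀ (z.2 i) _ _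
  have c_ne : ∀ z l, c z l ≠ 0 := fun z l =>
    Finset.prod_ne_zero_iff.2 fun i _ => zpow_ne_zero _ (z.2 i)
  have c_zero : ∀ z, c z 0 = 1 := fun z => by simp [c]
  have c_cont : ∀ l, Continuous fun z => c z l := fun l =>
    continuous_finsetProd _ fun i _ => Continuous.zpow₀
      ((continuous_apply i).comp continuous_subtype_val) _ fun z => Or.inl (z.2 i)
  have c_basis : ∀ z i, c z (b i) = z.1 i := by
    classical
    intro z i
    simp only [c, Module.Basis.repr_self]
    rw [Finset.prod_eq_single i]
    · simp
    · intro j _ hj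
      rw [Finsupp.single_eq_of_ne hj, zpow_zero]
    · simp
  have hF : ∀ m : dualMonoid σ.1, u m ≠ 0 → (m : CharLattice N) ∈ L := fun m hm =>
    Submodule.subset_span ⟨m.2, hm⟩
  classical
  let g : D → Chart σ.1 := fun z => (show AddChar (dualMonoid σ.1) ℂ from
    { toFun := fun m => if h : u m ≠ 0 then c z ⟨m, hF m h⟩ * u m else 0
      map_zero_eq_one' := by
        have h0 : u 0 ≠ 0 := by rw [Chart.map_zero]; exact one_ne_zero
        rw [dif_pos h0, Chart.map_zero, mul_one]
        exact c_zero z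
      map_add_eq_mul' := fun m m' => by
        by_cases h : u m ≠ 0
        · by_cases h' : u m' ≠ 0
          · have h2 : u (m + m') ≠ 0 := by rw [Chart.map_add]; exact mul_ne_zero h h'
            rw [dif_pos h, dif_pos h', dif_pos h2, Chart.map_add, mul_mul_mul_comm, ← c_add]
            rfl
          · have h2 : ¬ u (m + m') ≠ 0 := by
              rw [Chart.map_add, not_not.1 h', mul_zero]; exact not_not.2 rfl
            rw [dif_neg h', dif_neg h2, mul_zero]
        · have h2 : ¬ u (m + m') ≠ 0 := by
            rw [Chart.map_add, not_not.1 h, zero_mul]; exact not_not.2 rfl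
          rw [dif_neg h, dif_neg h2, zero_mul] })
  have g_pos : ∀ z m (h : u m ≠ 0), g z m = c z ⟨m, hF m h⟩ * u m := fun z m h => dif_pos h
  have g_neg : ∀ z m, u m = 0 → g z m = 0 := fun z m h => dif_neg (not_not.2 h)
  have g_cont : Continuous g := by
    refine Chart.continuous_iff.2 fun m => ?_
    by_cases h : u m ≠ 0
    · simp only [g_pos _ m h]
      exact (c_cont _).mul continuous_const
    · simp only [g_neg _ m (not_not.1 h)]
      exact continuous_const
  have g_ind : Topology.IsInducing g := by
    refine ⟨le_antisymm g_cont.le_induced ?_⟩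
    let t0 : TopologicalSpace D := TopologicalSpace.induced g inferInstance
    have hg : Continuous[t0, _] g := continuous_induced_dom
    have key : ∀ l : L, Continuous[t0, _] fun z => c z l := by
      rintro ⟨l, hl⟩
      induction hl using Submodule.span_induction with
      | mem m hm =>
        obtain ⟨hm, hu⟩ := hm
        have h1 : (fun z => c z ⟨m, hF ⟨m, hm⟩ hu⟩) = fun z => g z ⟨m, hm⟩ / u ⟨m, hm⟩ := by
          funext z
          rw [g_pos z ⟨m, hm⟩ hu, mul_div_cancel_right₀ _ hu]
        exact h1 ▸ (((Chart.continuous_eval _).comp hg).div_const _)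
      | zero =>
        have h1 : (fun z => c z ⟨0, L.zero_mem⟩) = fun _ => 1 := funext c_zero
        exact h1 ▸ continuous_const
      | add m m' hm hm' h h' =>
        have h1 : (fun z => c z ⟨m + m', L.add_mem hm hm'⟩)
          = fun z => c z ⟨m, hm⟩ * c z ⟨m', hm'⟩ := funext fun z => c_add z ⟨m, hm⟩ ⟨m', hm'⟩
        exact h1 ▸ (h.mul h')
      | smul a m hm h =>
        have h1 : (fun z => c z ⟨a • m, L.smul_mem a hm⟩) = fun z => c z ⟨m, hm⟩ ^ a := by
          funext z
          have : (⟨a • m, L.smul_mem a hm⟩ : L) = a • ⟨m, hm⟩ := rfl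
          rw [this]
          simp only [c, map_smul, Finsupp.coe_smul, Pi.smul_apply, smul_eq_mul]
          rw [← Finset.prod_zpow]
          exact Finset.prod_congr rfl fun i _ => by rw [mul_comm, zpow_mul]
        exact h1 ▸ (h.zpow₀ a fun z => Or.inl (c_ne z _))
    have : Continuous[t0, _] (Subtype.val : D → I → ℂ) :=
      continuous_pi fun i => by
        have h1 : (fun z : D => z.1 i) = fun z => c z (b i) := funext fun z => (c_basis z i).symm
        exact h1 ▸ key (b i)
    exact continuous_iff_le_induced.1 this
  have hind : Topology.IsInducing (Δ.chart σ ∘ g) :=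
    (Δ.isOpenEmbedding_chart σ).isInducing.comp g_ind
  -- every character of `L` extends to `M`
  have hsurj : ∀ z : D, ∃ t : Torus N, ∀ l : L, t l = c z l := by
    intro z
    let f : L →+ ℂ := (b.constr ℤ (fun i => Complex.log (z.1 i))).toAddMonoidHom
    obtain ⟨f', hf'⟩ := (Module.Baer.of_divisible ℂ).extension_property_addMonoidHom
      L.subtype.toAddMonoidHom Subtype.val_injective f
    refine ⟨{ toFun := fun m => Complex.exp (f' m)
              map_zero_eq_one' := by rw [map_zero, Complex.exp_zero]
              map_add_eq_mul' := fun m m' => by rw [map_add, Complex.exp_add] }, fun l => ?_⟩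
    have h1 : f' l = f l := DFunLike.congr_fun hf' l
    change Complex.exp (f' l) = _
    rw [h1]
    change Complex.exp ((b.constr ℤ (fun i => Complex.log (z.1 i))) l) = _
    rw [Module.Basis.constr_apply_fintype, Complex.exp_sum]
    refine Finset.prod_congr rfl fun i _ => ?_
    rw [zsmul_eq_mul, Complex.exp_int_mul, Complex.exp_log (z.2 i)]
    rfl
  have hmem : ∀ z, Δ.chart σ (g z) ∈ MulAction.orbit (Torus N) (Δ.chart σ u) := by
    intro z
    obtain ⟨t, ht⟩ := hsurj z
    refine ⟨t, congrArg (Δ.chart σ) (Chart.ext fun m => ?_)⟩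
    change Chart.smul t u m = _
    rw [Chart.smul_apply]
    by_cases h : u m ≠ 0
    · rw [g_pos z m h, ← ht]
    · rw [g_neg z m (not_not.1 h), not_not.1 h, mul_zero]
  let q : D → MulAction.orbit (Torus N) (Δ.chart σ u) := fun z => ⟨_, hmem z⟩
  have q_ind : Topology.IsInducing q := Topology.IsInducing.of_comp
    (by exact hind.continuous.codRestrict hmem) continuous_subtype_val hind
  have q_surj : Function.Surjective q := by
    rintro ⟨_, t, rfl⟩
    refine ⟨⟨fun i => t (b i), fun i h => ?_⟩, Subtype.ext (congrArg (Δ.chart σ)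
      (Chart.ext fun m => ?_))⟩
    · replace h : t (b i : CharLattice N) = 0 := h
      have h1 := AddChar.map_add_eq_mul t (b i : CharLattice N) (-(b i : CharLattice N))
      rw [h, zero_mul, add_neg_cancel, AddChar.map_zero_eq_one] at h1
      exact one_ne_zero h1
    · change _ = Chart.smul t u m
      rw [Chart.smul_apply]
      by_cases h : u m ≠ 0
      · rw [g_pos _ m h]
        congr 1
        have h2 : (m : CharLattice N) = ∑ i, b.repr ⟨m, hF m h⟩ i • (b i : CharLattice N) := by
          have := congrArg (Subtype.val : L → CharLattice N) (b.sum_repr ⟨m, hF m h⟩)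
          exact this.symm.trans (AddSubmonoidClass.coe_finsetSum _ _)
        have h3 := map_prod t.toMonoidHom (fun i => Multiplicative.ofAdd
          (b.repr ⟨m, hF m h⟩ i • (b i : CharLattice N))) Finset.univ
        rw [← ofAdd_sum, ← h2] at h3
        refine Eq.trans ?_ h3.symm
        exact Finset.prod_congr rfl fun i _ => (AddChar.map_zsmul_eq_zpow t _ _).symm
      · rw [g_neg _ m (not_not.1 h), not_not.1 h, mul_zero]
  exact (q_ind.isQuotientMap_of_surjective q_surj).isCoinducing.locallyConnectedSpace

/-- Sheaves of complex vector spaces on `Y`. -/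
abbrev Sh (Y : TopCat.{0}) := TopCat.Sheaf (ModuleCat.{0} ℂ) Y

/-- The sheaf `F` is locally constant: every point has an open neighbourhood `U` such that `F|_U`
is isomorphic to a constant sheaf `A_U`. A morphism of sheaves `A_U ⟶ F|_U` is the same as a linear
map `A → F(U)`, and it is an isomorphism if and only if the induced maps `A → F_z` to the stalks
at the points `z ∈ U` are. -/
def IsLocallyConstantSheaf {Y : TopCat.{0}} (F : Sh Y) : Prop :=
  ∀ y : Y, ∃ U : Opens Y, y ∈ U ∧ ∃ (A : ModuleCat.{0} ℂ) (φ : A ⟶ F.presheaf.obj (.op U)),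
    ∀ (z : Y) (hz : z ∈ U), IsIso (φ ≫ F.presheaf.germ U z hz)

section
variable {Y : TopCat.{0}}

lemma isIso_of_isIso_germ (G : Sh Y) (V : Opens Y) (hV : IsConnected (V : Set Y))
    (B : ModuleCat.{0} ℂ) (ψ : B ⟶ G.presheaf.obj (.op V))
    (hψ : ∀ (z : Y) (hz : z ∈ V), IsIso (ψ ≫ G.presheaf.germ V z hz)) : IsIso ψ := by
  obtain ⟨y, hy⟩ := hV.nonempty
  have hbij : ∀ (z : Y) (hz : z ∈ V), Function.Bijective (ψ ≫ G.presheaf.germ V z hz) :=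
    fun z hz => ConcreteCategory.bijective_of_isIso _
  refine (ConcreteCategory.isIso_iff_bijective ψ).2 ⟨fun a b hab => ?_, fun s => ?_⟩
  · exact (hbij y hy).1 (by simp [hab])
  · have hc : ∀ z : V, ∃ b : B, G.presheaf.germ V z.1 z.2 (ψ b) = G.presheaf.germ V z.1 z.2 s :=
      fun z => by
        obtain ⟨b, hb⟩ := (hbij z.1 z.2).2 (G.presheaf.germ V z.1 z.2 s)
        exact ⟨b, hb⟩
    choose c hc using hc
    have hlc : IsLocallyConstant c := by
      rw [IsLocallyConstant.iff_exists_open]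
      intro z
      obtain ⟨W, hzW, i₁, i₂, hW⟩ := G.presheaf.germ_eq z.1 z.2 z.2 _ _ (hc z)
      refine ⟨Subtype.val ⁻¹' (W : Set Y), W.2.preimage continuous_subtype_val, hzW, ?_⟩
      intro z' hz'
      apply (hbij z'.1 z'.2).1
      refine (hc z').trans ?_
      exact (TopCat.Presheaf.germ_ext G.presheaf W hz' i₁ i₂ hW).symm
    have : PreconnectedSpace V := isPreconnected_iff_preconnectedSpace.1 hV.isPreconnected
    refine ⟨c ⟨y, hy⟩, ?_⟩
    refine TopCat.Presheaf.section_ext G V _ _ fun z hz => ?_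
    have := hlc.apply_eq_of_preconnectedSpace ⟨y, hy⟩ ⟨z, hz⟩
    rw [this]
    exact hc ⟨z, hz⟩

/-- The functor of sections over `V`. -/
def sectionsFunctor (V : Opens Y) : Sh Y ⥤ ModuleCat.{0} ℂ :=
  TopCat.Sheaf.forget _ Y ⋙ (evaluation _ _).obj (.op V)

/-- The functor of stalks at `z`. -/
def stalkF (z : Y) : Sh Y ⥤ ModuleCat.{0} ℂ :=
  TopCat.Sheaf.forget _ Y ⋙ TopCat.Presheaf.stalkFunctor _ z

/-- The natural map from sections to stalks. -/
def germF (V : Opens Y) (z : Y) (hz : z ∈ V) : sectionsFunctor V ⟶ stalkF z where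
  app F := F.presheaf.germ V z hz
  naturality _ _ f := (TopCat.Presheaf.stalkFunctor_map_germ V z hz f.1).symm

instance (V : Opens Y) : PreservesFiniteLimits (sectionsFunctor V) := by
  have : PreservesFiniteLimits (TopCat.Sheaf.forget (ModuleCat.{0} ℂ) Y) :=
    inferInstanceAs (PreservesFiniteLimits (sheafToPresheaf _ _))
  have : PreservesFiniteLimits ((evaluation (Opens Y)ᵒᵖ (ModuleCat.{0} ℂ)).obj (.op V)) :=
    ⟨fun J _ _ => inferInstance⟩
  exact comp_preservesFiniteLimits _ _

instance (V : Opens Y) : (sectionsFunctor V).Additive where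

instance (z : Y) : PreservesFiniteLimits (stalkF z) :=
  inferInstanceAs (PreservesFiniteLimits
    (TopCat.Sheaf.forget (ModuleCat.{0} ℂ) Y ⋙ TopCat.Presheaf.stalkFunctor _ z))

instance (z : Y) : PreservesFiniteColimits (stalkF z) :=
  inferInstanceAs (PreservesFiniteColimits
    (TopCat.Sheaf.forget (ModuleCat.{0} ℂ) Y ⋙ TopCat.Presheaf.stalkFunctor _ z))

instance (z : Y) : (stalkF z).Additive :=
  inferInstanceAs (TopCat.Sheaf.forget (ModuleCat.{0} ℂ) Y ⋙
    TopCat.Presheaf.stalkFunctor _ z).Additive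

variable (Y) in
/-- The property of being a locally constant sheaf. -/
def locallyConstantSheaf : ObjectProperty (Sh Y) := IsLocallyConstantSheaf

lemma locallyConstantSheaf_iff (F : Sh Y) : locallyConstantSheaf Y F ↔
    ∀ y : Y, ∃ U : Opens Y, y ∈ U ∧ ∃ (A : ModuleCat.{0} ℂ) (φ : A ⟶ (sectionsFunctor U).obj F),
      ∀ (z : Y) (hz : z ∈ U), IsIso (φ ≫ (germF U z hz).app F) := Iff.rfl

/-- Restriction of sections. -/
def resF {U V : Opens Y} (h : V ≤ U) : sectionsFunctor U ⟶ sectionsFunctor V where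
  app F := F.presheaf.map (homOfLE h).op
  naturality _ _ f := (f.1.naturality (homOfLE h).op).symm

lemma resF_germF {U V : Opens Y} (h : V ≤ U) (z : Y) (hz : z ∈ V) (F : Sh Y) :
    (resF h).app F ≫ (germF V z hz).app F = (germF U z (h hz)).app F :=
  TopCat.Presheaf.germ_res F.presheaf (homOfLE h) z hz

lemma exists_common_open [LocallyConnectedSpace Y] {F G : Sh Y}
    (hF : locallyConstantSheaf Y F) (hG : locallyConstantSheaf Y G) (y : Y) :
    ∃ V : Opens Y, y ∈ V ∧ ∃ (A B : ModuleCat.{0} ℂ) (φ : A ⟶ (sectionsFunctor V).obj F)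
      (ψ : B ⟶ (sectionsFunctor V).obj G), IsIso ψ ∧
      (∀ (z : Y) (hz : z ∈ V), IsIso (φ ≫ (germF V z hz).app F)) ∧
      (∀ (z : Y) (hz : z ∈ V), IsIso (ψ ≫ (germF V z hz).app G)) := by
  obtain ⟨U₁, hy₁, A, φ, hφ⟩ := (locallyConstantSheaf_iff F).1 hF y
  obtain ⟨U₂, hy₂, B, ψ, hψ⟩ := (locallyConstantSheaf_iff G).1 hG y
  obtain ⟨V, hVU, hVo, hyV, hVc⟩ := locallyConnectedSpace_iff_subsets_isOpen_isConnected.1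
    (inferInstance : LocallyConnectedSpace Y) y (U₁ ⊓ U₂ : Opens Y)
    ((U₁ ⊓ U₂).2.mem_nhds ⟨hy₁, hy₂⟩)
  let V' : Opens Y := ⟨V, hVo⟩
  have h₁ : V' ≤ U₁ := fun z hz => (hVU hz).1
  have h₂ : V' ≤ U₂ := fun z hz => (hVU hz).2
  have hψ' : ∀ (z : Y) (hz : z ∈ V'), IsIso ((ψ ≫ (resF h₂).app G) ≫ (germF V' z hz).app G) := by
    intro z hz
    rw [Category.assoc, resF_germF]
    exact hψ z (h₂ hz)
  refine ⟨V', hyV, A, B, φ ≫ (resF h₁).app F, ψ ≫ (resF h₂).app G,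
    isIso_of_isIso_germ G V' hVc B _ hψ', fun z hz => ?_, hψ'⟩
  rw [Category.assoc, resF_germF]
  exact hφ z (h₁ hz)

lemma exists_common_chart [LocallyConnectedSpace Y] {F G : Sh Y} (f : F ⟶ G)
    (hF : locallyConstantSheaf Y F) (hG : locallyConstantSheaf Y G) (y : Y) :
    ∃ V : Opens Y, y ∈ V ∧ ∃ (A B : ModuleCat.{0} ℂ) (φ : A ⟶ (sectionsFunctor V).obj F)
      (ψ : B ⟶ (sectionsFunctor V).obj G) (h : A ⟶ B), φ ≫ (sectionsFunctor V).map f = h ≫ ψ ∧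
      (∀ (z : Y) (hz : z ∈ V), IsIso (φ ≫ (germF V z hz).app F)) ∧
      (∀ (z : Y) (hz : z ∈ V), IsIso (ψ ≫ (germF V z hz).app G)) := by
  obtain ⟨V, hy, A, B, φ, ψ, hi, hφ, hψ⟩ := exists_common_open hF hG y
  exact ⟨V, hy, A, B, φ, ψ, φ ≫ (sectionsFunctor V).map f ≫ inv ψ, by simp, hφ, hψ⟩

lemma isIso_of_kernel {C : Type*} [Category* C] [Abelian C] {A B K F G : C} {h : A ⟶ B} {f : F ⟶ G}
    {i : K ⟶ F} [Mono i] (w : i ≫ f = 0) {α : A ⟶ F} {β : B ⟶ G} [IsIso α] [IsIso β]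
    (comm : α ≫ f = h ≫ β) {κ : kernel h ⟶ K} (hκ : κ ≫ i = kernel.ι h ≫ α) : IsIso κ := by
  have w' : (i ≫ inv α) ≫ h = 0 := by
    rw [← cancel_mono β]
    simp [← comm, w]
  refine ⟨kernel.lift h (i ≫ inv α) w', ?_, ?_⟩
  · rw [← cancel_mono (kernel.ι h)]
    simp [reassoc_of% hκ]
  · rw [← cancel_mono i]
    simp [hκ]

lemma isIso_of_cokernel {C : Type*} [Category* C] [Abelian C] {A B F G : C} {h : A ⟶ B}
    {f : F ⟶ G} {α : A ⟶ F} {β : B ⟶ G} [IsIso α] [IsIso β]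
    (comm : α ≫ f = h ≫ β) {κ : cokernel h ⟶ cokernel f}
    (hκ : cokernel.π h ≫ κ = β ≫ cokernel.π f) : IsIso κ := by
  have w' : f ≫ inv β ≫ cokernel.π h = 0 := by
    rw [← cancel_epi α, ← Category.assoc, comm]
    simp
  refine ⟨cokernel.desc f (inv β ≫ cokernel.π h) w', ?_, ?_⟩
  · rw [← cancel_epi (cokernel.π h)]
    simp [reassoc_of% hκ]
  · rw [← cancel_epi (cokernel.π f)]
    simp [hκ]

instance : (locallyConstantSheaf Y).IsClosedUnderIsomorphisms where
  of_iso {F G} e hF := by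
    rw [locallyConstantSheaf_iff] at hF ⊢
    intro y
    obtain ⟨U, hy, A, φ, hφ⟩ := hF y
    refine ⟨U, hy, A, φ ≫ (sectionsFunctor U).map e.hom, fun z hz => ?_⟩
    have := hφ z hz
    rw [Category.assoc, NatTrans.naturality, ← Category.assoc]
    infer_instance

instance [LocallyConnectedSpace Y] : (locallyConstantSheaf Y).IsClosedUnderKernels where
  kernels_le := by
    rintro _ ⟨f, k, hk, hF, hG⟩
    refine (locallyConstantSheaf Y).prop_of_iso
      (IsLimit.conePointUniqueUpToIso (kernelIsKernel f) hk) ?_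
    change locallyConstantSheaf Y (kernel f)
    rw [locallyConstantSheaf_iff]
    intro y
    obtain ⟨V, hy, A, B, φ, ψ, h, hh, hφ, hψ⟩ := exists_common_chart f hF hG y
    have w : (kernel.ι h ≫ φ) ≫ (sectionsFunctor V).map f = 0 := by simp [hh]
    refine ⟨V, hy, kernel h, kernel.lift _ _ w ≫ (PreservesKernel.iso (sectionsFunctor V) f).inv,
      fun z hz => ?_⟩
    have := hφ z hz
    have := hψ z hz
    refine isIso_of_kernel (h := h) (f := (stalkF z).map f) (i := (stalkF z).map (kernel.ι f))
      (α := φ ≫ (germF V z hz).app _) (β := ψ ≫ (germF V z hz).app _) ?_ ?_ ?_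
    · rw [← Functor.map_comp, kernel.condition, Functor.map_zero]
    · simp [← reassoc_of% hh]
    · simp [← NatTrans.naturality, PreservesKernel.iso_inv_ι_assoc]

instance [LocallyConnectedSpace Y] : (locallyConstantSheaf Y).IsClosedUnderCokernels where
  cokernels_le := by
    rintro _ ⟨f, k, hk, hF, hG⟩
    refine (locallyConstantSheaf Y).prop_of_iso
      (IsColimit.coconePointUniqueUpToIso (cokernelIsCokernel f) hk) ?_
    change locallyConstantSheaf Y (cokernel f)
    rw [locallyConstantSheaf_iff]
    intro y
    obtain ⟨V, hy, A, B, φ, ψ, h, hh, hφ, hψ⟩ := exists_common_chart f hF hG y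
    have w : h ≫ ψ ≫ (sectionsFunctor V).map (cokernel.π f) = 0 := by
      rw [← Category.assoc, ← hh, Category.assoc, ← Functor.map_comp, cokernel.condition,
        Functor.map_zero, comp_zero]
    refine ⟨V, hy, cokernel h, cokernel.desc h _ w, fun z hz => ?_⟩
    have := hφ z hz
    have := hψ z hz
    have := isIso_of_cokernel (h := h) (f := (stalkF z).map f)
      (α := φ ≫ (germF V z hz).app _) (β := ψ ≫ (germF V z hz).app _)
      (κ := (cokernel.desc h _ w ≫ (germF V z hz).app _) ≫
        (PreservesCokernel.iso (stalkF z) f).hom) (by simp [← reassoc_of% hh]) (by simp)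
    exact IsIso.of_isIso_comp_right _ (PreservesCokernel.iso (stalkF z) f).hom

open ZeroObject in
instance : (locallyConstantSheaf Y).ContainsZero where
  exists_zero := by
    refine ⟨0, isZero_zero _, (locallyConstantSheaf_iff _).2 fun y =>
      ⟨⊤, trivial, 0, 0, fun z hz => ?_⟩⟩
    exact isIso_of_source_target_iso_zero _ (Iso.refl _)
      ((stalkF z).map_isZero (isZero_zero _)).isoZero

lemma locallyConstantSheaf_biprod [LocallyConnectedSpace Y] {F G : Sh Y}
    (hF : locallyConstantSheaf Y F) (hG : locallyConstantSheaf Y G) :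
    locallyConstantSheaf Y (F ⊞ G) := by
  rw [locallyConstantSheaf_iff]
  intro y
  obtain ⟨V, hy, A, B, φ, ψ, -, hφ, hψ⟩ := exists_common_open hF hG y
  refine ⟨V, hy, A ⊞ B, biprod.desc (φ ≫ (sectionsFunctor V).map biprod.inl)
    (ψ ≫ (sectionsFunctor V).map biprod.inr), fun z hz => ?_⟩
  have := preservesBinaryBiproduct_of_preservesBinaryProduct (stalkF z) (X := F) (Y := G)
  obtain ⟨α, hα⟩ : ∃ α, α = φ ≫ (germF V z hz).app F := ⟨_, rfl⟩
  obtain ⟨β, hβ⟩ : ∃ β, β = ψ ≫ (germF V z hz).app G := ⟨_, rfl⟩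
  have : IsIso α := hα ▸ hφ z hz
  have : IsIso β := hβ ▸ hψ z hz
  have h : biprod.desc (φ ≫ (sectionsFunctor V).map biprod.inl)
      (ψ ≫ (sectionsFunctor V).map biprod.inr) ≫ (germF V z hz).app (F ⊞ G) =
      (biprod.mapIso (asIso α) (asIso β)).hom ≫ ((stalkF z).mapBiprod F G).inv := by
    apply biprod.hom_ext'
    · rw [biprod.inl_desc_assoc, Category.assoc, NatTrans.naturality, ← Category.assoc, ← hα,
        biprod.mapIso_hom, asIso_hom, asIso_hom, biprod.inl_map_assoc, Functor.mapBiprod_inv,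
        biprod.inl_desc]
    · rw [biprod.inr_desc_assoc, Category.assoc, NatTrans.naturality, ← Category.assoc, ← hβ,
        biprod.mapIso_hom, asIso_hom, asIso_hom, biprod.inr_map_assoc, Functor.mapBiprod_inv,
        biprod.inr_desc]
  rw [h]
  infer_instance

instance [LocallyConnectedSpace Y] : (locallyConstantSheaf Y).IsClosedUnderFiniteProducts := by
  have : (locallyConstantSheaf Y).IsClosedUnderBinaryProducts := by
    refine ⟨?_⟩
    rintro X ⟨p, hp⟩
    have e : p.diag.obj ⟨.left⟩ ⊞ p.diag.obj ⟨.right⟩ ≅ X :=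
      biprod.isoProd _ _ ≪≫ (HasLimit.isoOfNatIso (diagramIsoPair p.diag)).symm ≪≫
        limit.isoLimitCone ⟨_, p.isLimit⟩
    exact (locallyConstantSheaf Y).prop_of_iso e
      (locallyConstantSheaf_biprod (hp ⟨.left⟩) (hp ⟨.right⟩))
  exact .mk'
end

section

variable {Z Y : TopCat.{0}}

/-- The inverse image functor on sheaves of complex vector spaces. -/
abbrev pull (f : Z ⟶ Y) : Sh Y ⥤ Sh Z := TopCat.Sheaf.pullback (ModuleCat.{0} ℂ) f

/-- The direct image functor on sheaves of complex vector spaces. -/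
abbrev push (f : Z ⟶ Y) : Sh Z ⥤ Sh Y := TopCat.Sheaf.pushforward (ModuleCat.{0} ℂ) f

attribute [local instance] reflectsLimits_of_reflectsIsomorphisms in
instance (f : Z ⟶ Y) : PreservesFiniteLimits (pull f) := by
  apply Functor.sheafPullbackConstruction.preservesFiniteLimits

instance (f : Z ⟶ Y) : (push f).Additive where

instance (f : Z ⟶ Y) : (pull f).Additive :=
  (TopCat.Sheaf.pullbackPushforwardAdjunction (ModuleCat.{0} ℂ) f).left_adjoint_additive

/-- The compatibility of inverse images with composition. -/
def pullComp {W : TopCat.{0}} (g : W ⟶ Z) (f : Z ⟶ Y) : pull (g ≫ f) ≅ pull f ⋙ pull g :=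
  Adjunction.leftAdjointUniq
    (TopCat.Sheaf.pullbackPushforwardAdjunction (ModuleCat.{0} ℂ) (g ≫ f))
    ((TopCat.Sheaf.pullbackPushforwardAdjunction (ModuleCat.{0} ℂ) f).comp
      (TopCat.Sheaf.pullbackPushforwardAdjunction (ModuleCat.{0} ℂ) g))

end

section

variable {Y : TopCat.{0}} {A : Type} {O : A → TopCat.{0}}

/-- For a space `Y` with a family of subspaces `i_a : O_a → Y` (the orbits), the sheaves on `Y` that
are locally constant on each `O_a`. -/
def locConstOn (i : ∀ a, O a ⟶ Y) : ObjectProperty (Sh Y) :=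
  fun F => ∀ a, IsLocallyConstantSheaf ((pull (i a)).obj F)

variable (i : ∀ a, O a ⟶ Y)

instance : (locConstOn i).IsClosedUnderIsomorphisms where
  of_iso e hF a := (locallyConstantSheaf (O a)).prop_of_iso ((pull (i a)).mapIso e) (hF a)

instance : (locConstOn i).ContainsZero where
  exists_zero := ⟨_, isZero_zero _, fun a => (locallyConstantSheaf (O a)).prop_of_isZero
    ((pull (i a)).map_isZero (isZero_zero _))⟩

variable [∀ a, LocallyConnectedSpace (O a)]

instance : (locConstOn i).IsClosedUnderKernels where
  kernels_le := by
    rintro _ ⟨f, k, hk, hF, hG⟩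
    refine (locConstOn i).prop_of_iso
      (IsLimit.conePointUniqueUpToIso (kernelIsKernel f) hk) fun a => ?_
    exact (locallyConstantSheaf (O a)).prop_of_iso (PreservesKernel.iso (pull (i a)) f).symm
      ((locallyConstantSheaf (O a)).prop_kernel _ (hF a) (hG a))

instance : (locConstOn i).IsClosedUnderCokernels where
  cokernels_le := by
    rintro _ ⟨f, k, hk, hF, hG⟩
    refine (locConstOn i).prop_of_iso
      (IsColimit.coconePointUniqueUpToIso (cokernelIsCokernel f) hk) fun a => ?_
    exact (locallyConstantSheaf (O a)).prop_of_iso (PreservesCokernel.iso (pull (i a)) f).symm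
      ((locallyConstantSheaf (O a)).prop_cokernel _ (hF a) (hG a))

instance : (locConstOn i).IsClosedUnderFiniteProducts := by
  have : (locConstOn i).IsClosedUnderBinaryProducts := by
    refine ⟨?_⟩
    rintro X ⟨p, hp⟩
    have e : p.diag.obj ⟨.left⟩ ⊞ p.diag.obj ⟨.right⟩ ≅ X :=
      biprod.isoProd _ _ ≪≫ (HasLimit.isoOfNatIso (diagramIsoPair p.diag)).symm ≪≫
        limit.isoLimitCone ⟨_, p.isLimit⟩
    refine (locConstOn i).prop_of_iso e fun a => ?_
    have := preservesBinaryBiproduct_of_preservesBinaryProduct (pull (i a))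
      (X := p.diag.obj ⟨.left⟩) (Y := p.diag.obj ⟨.right⟩)
    exact (locallyConstantSheaf (O a)).prop_of_iso ((pull (i a)).mapBiprod _ _).symm
      (locallyConstantSheaf_biprod (hp ⟨.left⟩ a) (hp ⟨.right⟩ a))
  exact .mk'

/-- The category of sheaves that are locally constant on each of the subspaces `O_a`. -/
abbrev LCOn : Type 1 := (locConstOn i).FullSubcategory

instance : Abelian (LCOn i) := inferInstance

instance : PreservesFiniteLimits (locConstOn i).ι := by
  have := (locConstOn i).preservesKernels_ι
  exact Functor.preservesFiniteLimits_of_preservesKernels _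

instance : PreservesFiniteColimits (locConstOn i).ι := by
  have := (locConstOn i).preservesCokernels_ι
  exact Functor.preservesFiniteColimits_of_preservesCokernels _

end

section

open DerivedCategory.TStructure

universe v₁ v₂ u₁ u₂ w₁ w₂

variable {C : Type u₁} [Category.{v₁} C] [Abelian C] [HasDerivedCategory.{w₁} C]
  {D : Type u₂} [Category.{v₂} D] [Abelian D] [HasDerivedCategory.{w₂} D]

/-- An exact functor commutes with the cohomology of complexes. -/
def homologyMapDerivedIso (F : C ⥤ D) [F.Additive] [PreservesFiniteLimits F]
    [PreservesFiniteColimits F] (n : ℤ) (K : DerivedCategory C) :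
    (DerivedCategory.homologyFunctor D n).obj (F.mapDerivedCategory.obj K) ≅
      F.obj ((DerivedCategory.homologyFunctor C n).obj K) :=
  (DerivedCategory.homologyFunctor D n).mapIso
      (F.mapDerivedCategory.mapIso (DerivedCategory.Q.objObjPreimageIso K).symm ≪≫
        F.mapDerivedCategoryFactors.app _) ≪≫
    (DerivedCategory.homologyFunctorFactors D n).app _ ≪≫
    ((DerivedCategory.Q.objPreimage K).sc n).mapHomologyIso F ≪≫
    F.mapIso ((DerivedCategory.homologyFunctorFactors C n).symm.app _ ≪≫
      (DerivedCategory.homologyFunctor C n).mapIso (DerivedCategory.Q.objObjPreimageIso K))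

lemma bounded_mapDerivedCategory (F : C ⥤ D) [F.Additive] [PreservesFiniteLimits F]
    [PreservesFiniteColimits F] (K : DerivedCategory C) (hK : t.bounded K) :
    t.bounded (F.mapDerivedCategory.obj K) := by
  obtain ⟨⟨a, ha⟩, b, hb⟩ := hK
  refine ⟨⟨a, ?_⟩, b, ?_⟩
  · exact (DerivedCategory.isGE_iff _ _).2 fun n hn =>
      (F.map_isZero ((DerivedCategory.isGE_iff _ _).1 ha n hn)).of_iso (homologyMapDerivedIso F n K)
  · exact (DerivedCategory.isLE_iff _ _).2 fun n hn =>
      (F.map_isZero ((DerivedCategory.isLE_iff _ _).1 hb n hn)).of_iso (homologyMapDerivedIso F n K)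

/-- The bounded complexes with cohomology in `P`. -/
def boundedWith (P : ObjectProperty C) : ObjectProperty (DerivedCategory C) :=
  fun K => t.bounded K ∧ ∀ n : ℤ, P ((DerivedCategory.homologyFunctor C n).obj K)

lemma bounded_le_plus : (t.bounded : ObjectProperty (DerivedCategory C)) ≤ t.plus :=
  fun _ h => h.1

lemma boundedWith_le_plus (P : ObjectProperty C) : boundedWith P ≤ t.plus :=
  fun _ h => h.1.1

/-- The functor between bounded derived categories induced by an exact functor. -/
def mapBounded (F : C ⥤ D) [F.Additive] [PreservesFiniteLimits F] [PreservesFiniteColimits F] :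
    DerivedCategory.Bounded C ⥤ DerivedCategory.Bounded D :=
  t.bounded.lift (DerivedCategory.Bounded.ι ⋙ F.mapDerivedCategory)
    fun K => bounded_mapDerivedCategory F K.1 K.2

/-- The functor `D^b_P(C) ⥤ D^b_Q(D)` induced by an exact functor that maps `P` to `Q`. -/
def mapBoundedWith (F : C ⥤ D) [F.Additive] [PreservesFiniteLimits F] [PreservesFiniteColimits F]
    (P : ObjectProperty C) (Q : ObjectProperty D) [Q.IsClosedUnderIsomorphisms]
    (h : ∀ A, P A → Q (F.obj A)) :
    (boundedWith P).FullSubcategory ⥤ (boundedWith Q).FullSubcategory :=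
  (boundedWith Q).lift ((boundedWith P).ι ⋙ F.mapDerivedCategory) fun K =>
    ⟨bounded_mapDerivedCategory F K.1 K.2.1, fun n =>
      Q.prop_of_iso (homologyMapDerivedIso F n K.1).symm (h _ (K.2.2 n))⟩

/-- The right derived functor `RF : D^+(C) ⥤ D^+(D)` maps the objects of `P` to objects of `Q`. -/
def RightDerivedMapsTo (F : C ⥤ D) [F.Additive] [EnoughInjectives C]
    {P : ObjectProperty (DerivedCategory C)} (hP : P ≤ t.plus)
    (Q : ObjectProperty (DerivedCategory D)) : Prop :=
  ∀ (K : DerivedCategory C) (hK : P K), Q (F.rightDerivedFunctorPlus.obj ⟨K, hP K hK⟩).obj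

/-- The right derived functor of `F`, restricted to a functor between the full subcategories
of `D^+(C)` and of `D(D)` given by `P` and `Q`. -/
def rightDerivedOn (F : C ⥤ D) [F.Additive] [EnoughInjectives C]
    {P : ObjectProperty (DerivedCategory C)} (hP : P ≤ t.plus)
    {Q : ObjectProperty (DerivedCategory D)} (h : RightDerivedMapsTo F hP Q) :
    P.FullSubcategory ⥤ Q.FullSubcategory :=
  Q.lift (ObjectProperty.ιOfLE hP ⋙ F.rightDerivedFunctorPlus ⋙ DerivedCategory.Plus.ι)
    fun K => h K.1 K.2

end

section

variable {Y : TopCat.{0}} {A : Type} {O : A → TopCat.{0}} (i : ∀ a, O a ⟶ Y)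
  [∀ a, LocallyConnectedSpace (O a)]

/-- The natural functor `D^b(LC) ⥤ D^b_{LC}(Sh)` induced by the (exact) inclusion `LC ⥤ Sh`. -/
def naturalFunctor [HasDerivedCategory.{w} (LCOn i)] [HasDerivedCategory.{w} (Sh Y)] :
    DerivedCategory.Bounded (LCOn i) ⥤ (boundedWith (locConstOn i)).FullSubcategory :=
  (boundedWith (locConstOn i)).lift (DerivedCategory.Bounded.ι ⋙ (locConstOn i).ι.mapDerivedCategory)
    fun K => ⟨bounded_mapDerivedCategory _ K.1 K.2, fun n =>
      (locConstOn i).prop_of_iso (homologyMapDerivedIso (locConstOn i).ι n K.1).symm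
        ((DerivedCategory.homologyFunctor (LCOn i) n).obj K.1).property⟩

end

section

variable {Y : TopCat.{0}}

/-- The functor `F ↦ (V ↦ F(V ∩ U))`, that is `u_* u^*` for the inclusion `u` of the open
subset `U`. -/
def openSections (U : Opens Y) : Sh Y ⥤ Sh Y :=
  U.isOpenEmbedding.sheafPullback (ModuleCat.{0} ℂ) (f := U.inclusion') ⋙ push U.inclusion'

/-- The restriction maps `F(V ∩ U) → F(V ∩ W)` for `W ⊆ U`. -/
def openSectionsRes {U W : Opens Y} (h : W ≤ U) : openSections U ⟶ openSections W where
  app F := ⟨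
    { app := fun V => F.presheaf.map (homOfLE (by
        rintro _ ⟨z, hz, rfl⟩
        exact ⟨⟨z.1, h z.2⟩, hz, rfl⟩)).op
      naturality := fun V V' f => by
        refine (F.presheaf.map_comp _ _).symm.trans (Eq.trans ?_ (F.presheaf.map_comp _
          (W.isOpenEmbedding.isOpenMap.functor.op.map ((Opens.map W.inclusion').op.map f))))
        rfl }⟩
  naturality F G f := by
    apply Sheaf.hom_ext
    ext V : 2
    exact (f.1.naturality _).symm

/-- Sections with support in a locally closed subset `S`: `Γ_S F` is the sheaf
`V ↦ {s ∈ F(V ∩ U) | s = 0 on V ∩ U ∖ S}`, where `U` is the largest open subset in which `S` is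
closed, i.e. the complement of `closure S ∖ S`; note that `U ∖ S` is the complement of
`closure S`. If `S` is closed, then `U = Y`. -/
def sectionsWithSupport (S : Set Y) (hS : IsLocallyClosed S) : Sh Y ⥤ Sh Y where
  obj F := kernel ((openSectionsRes (U := ⟨coborder S, hS.isOpen_coborder⟩)
    (W := ⟨(closure S)ᶜ, isClosed_closure.isOpen_compl⟩)
    (fun _ hz hz' => hz hz'.1)).app F)
  map f := kernel.map _ _ ((openSections _).map f) ((openSections _).map f)
    ((openSectionsRes _).naturality f).symm
  map_id F := by
    rw [← cancel_mono (kernel.ι _)]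
    simp
  map_comp f g := by
    rw [← cancel_mono (kernel.ι _)]
    simp

instance (U : Opens Y) : (openSections U).Additive where

instance (S : Set Y) (hS : IsLocallyClosed S) : (sectionsWithSupport S hS).Additive where
  map_add {F G f g} := by
    refine (cancel_mono (kernel.ι _)).1 ?_
    refine (kernel.lift_ι _ _ _).trans ?_
    refine Eq.trans ?_ (Preadditive.add_comp _ _ _ _ _ _).symm
    refine Eq.trans ?_ (congrArg₂ (· + ·) (kernel.lift_ι _ _ _) (kernel.lift_ι _ _ _)).symm
    rw [Functor.map_add, Preadditive.comp_add]
    rfl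

end

section

variable {Y Z : TopCat.{0}} {A B : Type} {O : A → TopCat.{0}} {O' : B → TopCat.{0}}
  (i : ∀ a, O a ⟶ Y) (i' : ∀ b, O' b ⟶ Z)

lemma locConstOn_pull (g : Y ⟶ Z) (h : ∀ F, locConstOn i' F →
    ∀ a, IsLocallyConstantSheaf ((pull (i a ≫ g)).obj F)) (F : Sh Z) (hF : locConstOn i' F) :
    locConstOn i ((pull g).obj F) := fun a =>
  (locallyConstantSheaf (O a)).prop_of_iso ((pullComp (i a) g).app F) (h F hF a)

variable [∀ a, LocallyConnectedSpace (O a)] [∀ b, LocallyConnectedSpace (O' b)]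

/-- The functor between categories of sheaves locally constant along given subspaces that is
induced by a functor between categories of sheaves. -/
def liftLC (G : Sh Y ⥤ Sh Z) (h : ∀ F, locConstOn i F → locConstOn i' (G.obj F)) :
    LCOn i ⥤ LCOn i' :=
  (locConstOn i').lift ((locConstOn i).ι ⋙ G) fun F => h F.1 F.2

variable (G : Sh Y ⥤ Sh Z) (h : ∀ F, locConstOn i F → locConstOn i' (G.obj F))

instance [G.Additive] : (liftLC i i' G h).Additive where
  map_add {F F' f g} := by
    apply (locConstOn i').hom_ext
    exact G.map_add

instance [PreservesFiniteLimits G] : PreservesFiniteLimits (liftLC i i' G h) := by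
  have : PreservesFiniteLimits (liftLC i i' G h ⋙ (locConstOn i').ι) :=
    inferInstanceAs (PreservesFiniteLimits ((locConstOn i).ι ⋙ G))
  exact ⟨fun J _ _ => preservesLimitsOfShape_of_reflects_of_preserves _ (locConstOn i').ι⟩

instance [PreservesFiniteColimits G] : PreservesFiniteColimits (liftLC i i' G h) := by
  have : PreservesFiniteColimits (liftLC i i' G h ⋙ (locConstOn i').ι) :=
    inferInstanceAs (PreservesFiniteColimits ((locConstOn i).ι ⋙ G))
  exact ⟨fun J _ _ => preservesColimitsOfShape_of_reflects_of_preserves _ (locConstOn i').ι⟩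

end

section

variable {N : Type} [AddCommGroup N] (Δ : Fan N)

/-- The inclusion of the orbit of a point `x` of `X_Δ`. -/
def Fan.orbitIncl (x : Δ.X) : TopCat.of (MulAction.orbit (Torus N) x) ⟶ TopCat.of Δ.X :=
  TopCat.ofHom ⟨Subtype.val, continuous_subtype_val⟩

variable {Δ} (Y : SubMulAction (Torus N) Δ.X)

/-- The inclusion `j : Y → X_Δ` of a `T`-invariant subspace. -/
def subIncl : TopCat.of Y ⟶ TopCat.of Δ.X :=
  TopCat.ofHom ⟨Subtype.val, continuous_subtype_val⟩

variable {Y} in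
lemma mem_of_mem_orbit {y z : Δ.X} (hy : y ∈ Y) (hz : z ∈ MulAction.orbit (Torus N) y) :
    z ∈ Y := by
  obtain ⟨t, rfl⟩ := hz
  exact Y.smul_mem t hy

/-- The inclusion in a `T`-invariant subspace `Y` of the orbit of a point `y` of `Y`. -/
def orbitInclSub (y : Y) : TopCat.of (MulAction.orbit (Torus N) (y : Δ.X)) ⟶ TopCat.of Y :=
  TopCat.ofHom ⟨fun z => ⟨z.1, mem_of_mem_orbit y.2 z.2⟩, continuous_subtype_val.subtype_mk _⟩

variable (Δ) in
/-- The property of sheaves on `X = X_Δ` of being locally constant on each orbit. -/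
abbrev Fan.lc : ObjectProperty (Sh (TopCat.of Δ.X)) := locConstOn Δ.orbitIncl

/-- The property of sheaves on `Y` of being locally constant on each orbit. -/
abbrev lcSub : ObjectProperty (Sh (TopCat.of Y)) := locConstOn (orbitInclSub Y)

variable (Δ) in
/-- The category `LC(X)` for `X = X_Δ`. -/
abbrev Fan.LC : Type 1 := LCOn Δ.orbitIncl

/-- The category `LC(Y)` for a `T`-invariant subspace `Y` of `X_Δ`. -/
abbrev LCSub : Type 1 := LCOn (orbitInclSub Y)

lemma lcSub_pull (F : Sh (TopCat.of Δ.X)) (hF : Δ.lc F) :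
    lcSub Y ((pull (subIncl Y)).obj F) :=
  locConstOn_pull (orbitInclSub Y) Δ.orbitIncl (subIncl Y) (fun _ hF y => hF y.1) F hF

variable [Module.Free ℤ N] [Module.Finite ℤ N]

instance (x : Δ.X) : LocallyConnectedSpace (TopCat.of (MulAction.orbit (Torus N) x)) :=
  Δ.locallyConnectedSpace_orbit x

/-- The exact functor `j^* : LC(X) ⥤ LC(Y)`. -/
abbrev pullLC : Δ.LC ⥤ LCSub Y :=
  liftLC Δ.orbitIncl (orbitInclSub Y) (pull (subIncl Y)) (lcSub_pull Y)

variable (Δ) in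
/-- The natural functor `D^b(LC(X)) ⥤ D^b_{LC}(Sh(X))` for `X = X_Δ`. -/
abbrev Fan.toDbLC [HasDerivedCategory.{w} Δ.LC] [HasDerivedCategory.{w} (Sh (TopCat.of Δ.X))] :
    DerivedCategory.Bounded Δ.LC ⥤ (boundedWith Δ.lc).FullSubcategory :=
  naturalFunctor Δ.orbitIncl

/-- The natural functor `D^b(LC(Y)) ⥤ D^b_{LC}(Sh(Y))` for a `T`-invariant subspace `Y`. -/
abbrev toDbLCSub [HasDerivedCategory.{w} (LCSub Y)] [HasDerivedCategory.{w} (Sh (TopCat.of Y))] :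
    DerivedCategory.Bounded (LCSub Y) ⥤ (boundedWith (lcSub Y)).FullSubcategory :=
  naturalFunctor (orbitInclSub Y)

/-- The functor `j_* : LC(Y) ⥤ LC(X)`, given that `j_*` preserves local constancy on orbits. -/
abbrev pushLC (hj : ∀ F, lcSub Y F → Δ.lc ((push (subIncl Y)).obj F)) : LCSub Y ⥤ Δ.LC :=
  liftLC (orbitInclSub Y) Δ.orbitIncl (push (subIncl Y)) hj

/-- The functor `Γ_Y : Sh(X) ⥤ Sh(X)` of sections with support in `Y`. -/
abbrev gammaSub (hY : IsLocallyClosed (Y : Set Δ.X)) :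
    Sh (TopCat.of Δ.X) ⥤ Sh (TopCat.of Δ.X) :=
  sectionsWithSupport (Y := TopCat.of Δ.X) (Y : Set Δ.X) hY

/-- The functor `Γ_Y : LC(X) ⥤ LC(X)`, given that `Γ_Y` preserves local constancy on orbits. -/
abbrev gammaLC (hY : IsLocallyClosed (Y : Set Δ.X))
    (hΓ : ∀ F, Δ.lc F → Δ.lc ((gammaSub Y hY).obj F)) : Δ.LC ⥤ Δ.LC :=
  liftLC Δ.orbitIncl Δ.orbitIncl (gammaSub Y hY) hΓ

end

end

end Toric

/-! Let `q` be the disjoint union, over all points x of X (or of Y), of the maps Lie T → X, l ↦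
exp(l)x. Each sheet of `q` lands in one orbit, so the inverse image of a sheaf in LC is locally
constant on a disjoint union of vector spaces, which amounts to a family of complex vector spaces.
Moreover X is conical along its orbits: the points have basic neighbourhoods whose inverse images
under `q` are disjoint unions of convex open cells, and a smaller basic neighbourhood has one
smaller cell in each of these (`Fan.niceAlong`). Hence q_*G lies in LC for G locally constant. Since
families of vector spaces pose no extension problems, q_*G is injective in LC by adjunction; and F
embeds in q_*q^*F because `q` is surjective. So LC has enough injectives, and all of them are
retracts of such q_*G.

The sheaves q_*G are also acyclic in Sh. Embed G in an injective sheaf J on the sheets. Sections of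
J/G lift over cells, so q_* keeps the sequence exact, and q_*J is injective; morphisms from a sheaf
F of LC to q_*(J/G) lift by adjunction. Dimension shifting gives Ext^n(F, q_*G) = 0 for n > 0
(`subsingleton_ext_push`). Therefore Ext in LC and in Sh agree, and dévissage along truncations
yields the equivalence (`naturalFunctor_isEquivalence`).

For j_* and Γ_Y the same argument runs with other test objects in place of F, namely `freeSh` and
`suppSh`, which represent the sections over good open sets. Injectives of LC are acyclic for them,
and bounded below complexes of such acyclic sheaves compute the usual derived functors, so both
derived functors are given by the same complex (`nonempty_rightDerived_comparison`). As D^b(LC)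
exhausts D^b_LC(Sh), this also shows that the usual derived functor has cohomology in LC.
Boundedness is a dimension argument: charts embed in Euclidean space, and cutting compact sets by
hyperplanes bounds the degrees in which a flasque complex, exact in high degrees, can fail to be
exact on sections (`exists_d_eq_of_embedding`). The statement on j^! follows from that on Γ_Y by
composing with the exact functor j^*. -/

set_option linter.unusedSectionVars false

namespace Toric

noncomputable section

/-! ### Full faithfulness of triangulated functors by dévissage -/

section TriangulatedDevissage

open Pretriangulated

universe v₁ v₂ u₁ u₂

variable {T : Type u₁} [Category.{v₁} T] [HasZeroObject T] [HasShift T ℤ] [Preadditive T]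
  [∀ n : ℤ, (shiftFunctor T n).Additive] [Pretriangulated T]
  {T₂ : Type u₂} [Category.{v₂} T₂] [HasZeroObject T₂] [HasShift T₂ ℤ] [Preadditive T₂]
  [∀ n : ℤ, (shiftFunctor T₂ n).Additive] [Pretriangulated T₂]
  (Φ : T ⥤ T₂)

/-- `Φ` is bijective on the morphisms from `K` to `L`. -/
def BijHom (K L : T) : Prop := Function.Bijective (Φ.map : (K ⟶ L) → _)

variable {Φ}

lemma BijHom.of_iso {K K' L L' : T} (h : BijHom Φ K L) (e : K ≅ K') (e' : L ≅ L') :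
    BijHom Φ K' L' := by
  refine ⟨fun f g hfg => ?_, fun f => ?_⟩
  · rw [← cancel_epi e.hom, ← cancel_mono e'.inv]
    apply h.1
    rw [Φ.map_comp, Φ.map_comp, Φ.map_comp, Φ.map_comp, hfg]
  · obtain ⟨g, hg⟩ := h.2 (Φ.map e.hom ≫ f ≫ Φ.map e'.inv)
    refine ⟨e.inv ≫ g ≫ e'.hom, ?_⟩
    rw [Φ.map_comp, Φ.map_comp, hg, Category.assoc, Category.assoc, ← Φ.map_comp,
      e'.inv_hom_id, Φ.map_id, Category.comp_id, ← Category.assoc, ← Φ.map_comp, e.inv_hom_id,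
      Φ.map_id, Category.id_comp]

lemma BijHom.shift [Φ.CommShift ℤ] {K L : T} (h : BijHom Φ K L) (a : ℤ) :
    BijHom Φ (K⟦a⟧) (L⟦a⟧) := by
  have key : (Φ.map : (K⟦a⟧ ⟶ L⟦a⟧) → _) ∘ (shiftFunctor T a).map =
      (fun f => (Φ.commShiftIso a).hom.app K ≫ f ≫ (Φ.commShiftIso a).inv.app L) ∘
        (shiftFunctor T₂ a).map ∘ Φ.map := by
    funext f
    simp
  have h₁ : Function.Bijective ((shiftFunctor T a).map : (K ⟶ L) → _) :=
    Functor.FullyFaithful.map_bijective (Functor.FullyFaithful.ofFullyFaithful _) _ _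
  have h₂ : Function.Bijective ((shiftFunctor T₂ a).map : (Φ.obj K ⟶ Φ.obj L) → _) :=
    Functor.FullyFaithful.map_bijective (Functor.FullyFaithful.ofFullyFaithful _) _ _
  have h₃ : Function.Bijective (fun f : (Φ.obj K)⟦a⟧ ⟶ (Φ.obj L)⟦a⟧ =>
      (Φ.commShiftIso a).hom.app K ≫ f ≫ (Φ.commShiftIso a).inv.app L) := by
    refine ⟨fun f g hfg => ?_, fun f => ⟨(Φ.commShiftIso a).inv.app K ≫ f ≫
      (Φ.commShiftIso a).hom.app L, by simp⟩⟩
    dsimp only at hfg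
    rwa [cancel_epi, cancel_mono] at hfg
  exact (Function.Bijective.of_comp_iff _ h₁).1 (key ▸ h₃.comp (h₂.comp h))

variable [Φ.CommShift ℤ] [Φ.IsTriangulated]

/-- The inverse rotation supplies the map out of `S.obj₃⟦-1⟧`. Exactness is recorded in the source
category for maps out of `S.obj₁` and in the target category for maps into `Φ.obj S.obj₁`; the
contravariant and the covariant five lemma below use one each. -/
lemma exists_connecting {S : Triangle T} (hS : S ∈ distTriang T) :
    ∃ δ : S.obj₃⟦(-1 : ℤ)⟧ ⟶ S.obj₁, δ ≫ S.mor₁ = 0 ∧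
      (∀ (X : T) (a : S.obj₁ ⟶ X), δ ≫ a = 0 → ∃ b, a = S.mor₁ ≫ b) ∧
      (∀ (X : T₂) (f : X ⟶ Φ.obj S.obj₁), f ≫ Φ.map S.mor₁ = 0 → ∃ g, f = g ≫ Φ.map δ) :=
  have hinv := inv_rot_of_distTriang _ hS
  ⟨S.invRotate.mor₁, comp_distTriang_mor_zero₁₂ _ hinv,
    fun _ a ha => Triangle.yoneda_exact₂ _ hinv a ha,
    fun _ f hf => Triangle.coyoneda_exact₂ _ (Φ.map_distinguished _ hinv) f hf⟩

lemma map_yoneda_exact₂ {S : Triangle T} (hS : S ∈ distTriang T) {X : T₂}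
    (f : Φ.obj S.obj₂ ⟶ X) (hf : Φ.map S.mor₁ ≫ f = 0) : ∃ g, f = Φ.map S.mor₂ ≫ g :=
  Triangle.yoneda_exact₂ _ (Φ.map_distinguished S hS) f hf

lemma map_coyoneda_exact₂ {S : Triangle T} (hS : S ∈ distTriang T) {X : T₂}
    (f : X ⟶ Φ.obj S.obj₂) (hf : f ≫ Φ.map S.mor₂ = 0) : ∃ g, f = g ≫ Φ.map S.mor₁ :=
  Triangle.coyoneda_exact₂ _ (Φ.map_distinguished S hS) f hf

lemma map_yoneda_exact₃ {S : Triangle T} (hS : S ∈ distTriang T) {X : T₂}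
    (f : Φ.obj S.obj₃ ⟶ X) (hf : Φ.map S.mor₂ ≫ f = 0) : ∃ g, f = Φ.map S.mor₃ ≫ g := by
  obtain ⟨g, hg⟩ := Triangle.yoneda_exact₃ _ (Φ.map_distinguished S hS) f hf
  exact ⟨(Φ.commShiftIso (1 : ℤ)).hom.app _ ≫ g, hg.trans (Category.assoc _ _ _)⟩

/-- The five lemma for the long exact sequences of Hom into `L` and into its image, as a diagram
chase. The shifted hypotheses enter only through surjectivity at `S.obj₁⟦1⟧` and injectivity at
`S.obj₃⟦-1⟧`. -/
lemma BijHom.of_distinguished₂ {S : Triangle T} (hS : S ∈ distTriang T) {L : T}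
    (h₁ : BijHom Φ S.obj₁ L) (h₃ : BijHom Φ S.obj₃ L)
    (h₁' : BijHom Φ (S.obj₁⟦(1 : ℤ)⟧) L) (h₃' : BijHom Φ (S.obj₃⟦(-1 : ℤ)⟧) L) :
    BijHom Φ S.obj₂ L := by
  obtain ⟨δ, hδ, hδ', -⟩ := exists_connecting (Φ := Φ) hS
  refine ⟨?_, fun f => ?_⟩
  · suffices ∀ f : S.obj₂ ⟶ L, Φ.map f = 0 → f = 0 by
      intro f g hfg
      exact sub_eq_zero.1 (this _ (by rw [Φ.map_sub]; exact sub_eq_zero.2 hfg))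
    intro f hf
    obtain ⟨g, rfl⟩ := Triangle.yoneda_exact₂ S hS f (h₁.1 (by simp [hf]))
    obtain ⟨c, hc⟩ := map_yoneda_exact₃ hS (Φ.map g) (by simpa using hf)
    obtain ⟨d, rfl⟩ := h₁'.2 c
    have : g = S.mor₃ ≫ d := h₃.1 (by rw [hc, Φ.map_comp])
    rw [this, ← Category.assoc, comp_distTriang_mor_zero₂₃ _ hS, zero_comp]
  · obtain ⟨a, ha⟩ := h₁.2 (Φ.map S.mor₁ ≫ f)
    obtain ⟨b, hb⟩ := hδ' _ a (h₃'.1 (by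
      rw [Φ.map_comp, ha, ← Φ.map_comp_assoc, hδ]; simp))
    obtain ⟨c, hc⟩ := map_yoneda_exact₂ hS (f - Φ.map b) (by
      rw [Preadditive.comp_sub, ← ha, hb, Φ.map_comp, sub_self])
    obtain ⟨d, rfl⟩ := h₃.2 c
    refine ⟨b + S.mor₂ ≫ d, ?_⟩
    rw [Φ.map_add, Φ.map_comp]
    exact (add_comm _ _).trans (sub_eq_iff_eq_add.1 hc).symm

/-- The covariant five lemma; here injectivity is used at `S.obj₁⟦1⟧` and surjectivity at
`S.obj₃⟦-1⟧`. -/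
lemma BijHom.of_distinguished₂' {S : Triangle T} (hS : S ∈ distTriang T) {L : T}
    (h₁ : BijHom Φ L S.obj₁) (h₃ : BijHom Φ L S.obj₃)
    (h₁' : BijHom Φ L (S.obj₁⟦(1 : ℤ)⟧)) (h₃' : BijHom Φ L (S.obj₃⟦(-1 : ℤ)⟧)) :
    BijHom Φ L S.obj₂ := by
  obtain ⟨δ, hδ, -, hδ'⟩ := exists_connecting (Φ := Φ) hS
  refine ⟨?_, fun f => ?_⟩
  · suffices ∀ f : L ⟶ S.obj₂, Φ.map f = 0 → f = 0 by
      intro f g hfg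
      exact sub_eq_zero.1 (this _ (by rw [Φ.map_sub]; exact sub_eq_zero.2 hfg))
    intro f hf
    obtain ⟨g, rfl⟩ := Triangle.coyoneda_exact₂ S hS f (h₃.1 (by simp [hf]))
    obtain ⟨c, hc⟩ := hδ' _ (Φ.map g) (by simpa using hf)
    obtain ⟨d, rfl⟩ := h₃'.2 c
    have : g = d ≫ δ := h₁.1 (by rw [hc, Φ.map_comp])
    rw [this, Category.assoc, hδ, comp_zero]
  · obtain ⟨a, ha⟩ := h₃.2 (f ≫ Φ.map S.mor₂)
    obtain ⟨b, hb⟩ : ∃ b, a = b ≫ S.mor₂ := by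
      refine Triangle.coyoneda_exact₃ _ hS a (h₁'.1 ?_)
      rw [Φ.map_comp, ha, Category.assoc, ← Φ.map_comp, comp_distTriang_mor_zero₂₃ _ hS]
      simp
    obtain ⟨c, hc⟩ := map_coyoneda_exact₂ hS (f - Φ.map b) (by
      rw [Preadditive.sub_comp, ← ha, hb, Φ.map_comp, sub_self])
    obtain ⟨d, rfl⟩ := h₁.2 c
    refine ⟨b + d ≫ S.mor₁, ?_⟩
    rw [Φ.map_add, Φ.map_comp]
    exact (add_comm _ _).trans (sub_eq_iff_eq_add.1 hc).symm

variable (Φ) in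
/-- `Φ` is bijective on the morphisms between all shifts of `K` and of `L`. -/
def BijShiftedHom (K L : T) : Prop := ∀ a b : ℤ, BijHom Φ (K⟦a⟧) (L⟦b⟧)

lemma BijShiftedHom.of_iso {K K' L L' : T} (h : BijShiftedHom Φ K L) (e : K ≅ K') (e' : L ≅ L') :
    BijShiftedHom Φ K' L' := fun a b =>
  (h a b).of_iso ((shiftFunctor T a).mapIso e) ((shiftFunctor T b).mapIso e')

/-- Shifting both arguments by `a` reduces the pair of shifts `a, b` to `0, b - a`. -/
lemma BijShiftedHom.mk' {K L : T} (h : ∀ n : ℤ, BijHom Φ K (L⟦n⟧)) : BijShiftedHom Φ K L :=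
  fun a b => ((h (b - a)).shift a).of_iso (Iso.refl _)
    ((shiftFunctorAdd' T (b - a) a b (by lia)).symm.app L)

lemma BijShiftedHom.shift_left {K L : T} (h : BijShiftedHom Φ K L) (n : ℤ) :
    BijShiftedHom Φ (K⟦n⟧) L := fun a b =>
  (h (n + a) b).of_iso ((shiftFunctorAdd T n a).app K) (Iso.refl _)

lemma BijShiftedHom.shift_right {K L : T} (h : BijShiftedHom Φ K L) (n : ℤ) :
    BijShiftedHom Φ K (L⟦n⟧) := fun a b =>
  (h a (n + b)).of_iso (Iso.refl _) ((shiftFunctorAdd T n b).app L)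

lemma BijShiftedHom.of_distinguished₂ {S : Triangle T} (hS : S ∈ distTriang T) {L : T}
    (h₁ : BijShiftedHom Φ S.obj₁ L) (h₃ : BijShiftedHom Φ S.obj₃ L) :
    BijShiftedHom Φ S.obj₂ L := fun a b =>
  BijHom.of_distinguished₂ (Triangle.shift_distinguished S hS a) (h₁ a b) (h₃ a b)
    (h₁.shift_left a 1 b) (h₃.shift_left a (-1) b)

lemma BijShiftedHom.of_distinguished₂' {S : Triangle T} (hS : S ∈ distTriang T) {L : T}
    (h₁ : BijShiftedHom Φ L S.obj₁) (h₃ : BijShiftedHom Φ L S.obj₃) :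
    BijShiftedHom Φ L S.obj₂ := fun a b =>
  BijHom.of_distinguished₂' (Triangle.shift_distinguished S hS b) (h₁ a b) (h₃ a b)
    (h₁.shift_right b a 1) (h₃.shift_right b a (-1))

end TriangulatedDevissage

/-! ### Exact functors and bounded derived categories -/

section BoundedDerived

open DerivedCategory DerivedCategory.TStructure Pretriangulated

universe v₁ v₂ u₁ u₂ w₁ w₂ w₃ w₄

variable {C : Type u₁} [Category.{v₁} C] [Abelian C] [HasDerivedCategory.{w₁} C]

/-- Dévissage of bounded objects of the derived category with given cohomology. -/
lemma bounded_induction (P : ObjectProperty C) [P.IsClosedUnderIsomorphisms]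
    (R : ObjectProperty (DerivedCategory C)) [R.IsClosedUnderIsomorphisms]
    (hzero : ∀ K, IsZero K → R K)
    (hsingle : ∀ (X : C) (n : ℤ), P X → R ((singleFunctor C n).obj X))
    (htri : ∀ S ∈ distTriang (DerivedCategory C), boundedWith P S.obj₁ → R S.obj₁ →
      boundedWith P S.obj₃ → R S.obj₃ → R S.obj₂)
    (K : DerivedCategory C) (hK : boundedWith P K) : R K := by
  obtain ⟨⟨⟨a, ha⟩, b, hb⟩, hP⟩ := hK
  -- `n` bounds the number of degrees in which cohomology can live. For `n = 0` one has `b < a`, and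
  -- `K` is zero.
  obtain ⟨n, hn⟩ : ∃ n : ℕ, b < a + n := ⟨(b - a + 1).toNat, by lia⟩
  induction n generalizing K b with
  | zero => exact hzero K (t.isZero K b a (by lia))
  | succ n ih =>
    -- Split off the top cohomology: the last term of the truncation triangle turns out to sit in
    -- the single degree `b`, the first one in degrees below `b`.
    let S := (t.triangleLTGE b).obj K
    have hS : S ∈ distTriang _ := t.triangleLTGE_distinguished b K
    have h₁ : t.IsLE S.obj₁ (b - 1) := inferInstance
    have h₃ : t.IsGE S.obj₃ b := inferInstance
    have hz₁ : ∀ m, b - 1 < m → IsZero ((homologyFunctor C m).obj S.obj₁) :=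
      (isLE_iff S.obj₁ (b - 1)).1 h₁
    have hz₃ : ∀ m, m < b → IsZero ((homologyFunctor C m).obj S.obj₃) :=
      (isGE_iff S.obj₃ b).1 h₃
    have i₁ : ∀ m, m < b → IsIso ((homologyFunctor C m).map S.mor₁) := by
      intro m hm
      have : Mono ((homologyFunctor C m).map S.mor₁) :=
        (HomologySequence.mono_homologyMap_mor₁_iff S hS (m - 1) m (by lia)).2
          ((hz₃ _ (by lia)).eq_of_src _ _)
      have : Epi ((homologyFunctor C m).map S.mor₁) :=
        (HomologySequence.epi_homologyMap_mor₁_iff S hS m).2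
          ((hz₃ _ (by lia)).eq_of_tgt _ _)
      exact isIso_of_mono_of_epi _
    have i₃ : ∀ m, b ≤ m → IsIso ((homologyFunctor C m).map S.mor₂) := by
      intro m hm
      have : Mono ((homologyFunctor C m).map S.mor₂) :=
        (HomologySequence.mono_homologyMap_mor₂_iff S hS m).2
          ((hz₁ _ (by lia)).eq_of_src _ _)
      have : Epi ((homologyFunctor C m).map S.mor₂) :=
        (HomologySequence.epi_homologyMap_mor₂_iff S hS m (m + 1) rfl).2
          ((hz₁ _ (by lia)).eq_of_tgt _ _)
      exact isIso_of_mono_of_epi _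
    -- The truncations have vanishing cohomology in some degrees, so `P` must contain the zero
    -- objects. One of them is the cohomology of `K` in degree `a - 1`.
    have hPz : ∀ X : C, IsZero X → P X := fun X hX =>
      P.prop_of_iso (hX.iso (hX.of_iso (Iso.refl _))) (by
        exact P.prop_of_iso (((isGE_iff K a).1 ha (a - 1) (by lia)).iso hX) (hP (a - 1)))
    have hP₁ : ∀ m, P ((homologyFunctor C m).obj S.obj₁) := by
      intro m
      rcases lt_or_ge m b with hm | hm
      · have := i₁ m hm
        exact P.prop_of_iso (asIso ((homologyFunctor C m).map S.mor₁)).symm (hP m)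
      · exact hPz _ (hz₁ m (by lia))
    have hP₃ : ∀ m, P ((homologyFunctor C m).obj S.obj₃) := by
      intro m
      rcases lt_or_ge m b with hm | hm
      · exact hPz _ (hz₃ m hm)
      · have := i₃ m hm
        exact P.prop_of_iso (asIso ((homologyFunctor C m).map S.mor₂)) (hP m)
    have hge₁ : t.IsGE S.obj₁ a := (isGE_iff _ _).2 fun m hm => by
      rcases lt_or_ge m b with hm' | hm'
      · have := i₁ m hm'
        exact ((isGE_iff K a).1 ha m hm).of_iso
          (@asIso _ _ _ _ ((homologyFunctor C m).map S.mor₁) this)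
      · exact hz₁ m (by lia)
    have hle₃ : t.IsLE S.obj₃ b := (isLE_iff _ _).2 fun m hm => by
      have := i₃ m (by lia)
      exact ((isLE_iff K b).1 hb m hm).of_iso (asIso ((homologyFunctor C m).map S.mor₂)).symm
    have : DerivedCategory.IsGE S.obj₃ b := h₃
    have : DerivedCategory.IsLE S.obj₃ b := hle₃
    obtain ⟨X, ⟨e⟩⟩ := exists_iso_singleFunctor_obj_of_isGE_of_isLE S.obj₃ b
    have hX : P X := P.prop_of_iso ((homologyFunctor C b).mapIso e ≪≫
      ((singleFunctorCompHomologyFunctorIso C b).app X)) (hP₃ b)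
    refine htri S hS ⟨⟨⟨a, hge₁⟩, b - 1, h₁⟩, hP₁⟩ ?_ ⟨⟨⟨b, h₃⟩, b, hle₃⟩, hP₃⟩
      (R.prop_of_iso e.symm (hsingle X b hX))
    exact ih S.obj₁ hP₁ hge₁ (b - 1) h₁ (by lia)

variable {D : Type u₂} [Category.{v₂} D] [Abelian D] [HasDerivedCategory.{w₂} D]
  (F : C ⥤ D) [F.Additive] [PreservesFiniteLimits F] [PreservesFiniteColimits F]
  [F.Full] [F.Faithful] [EnoughInjectives C]

open Abelian in
attribute [local instance] Ext.subsingleton_of_injective in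
/-- A fully faithful exact functor that maps injective objects to objects that are acyclic for the
functors `Hom(F X, -)` is bijective on `Ext`. -/
lemma mapExt_bijective_of_subsingleton [HasExt.{w₃} C] [HasExt.{w₄} D]
    (hI : ∀ (X I : C) [Injective I] (n : ℕ), Subsingleton (Ext.{w₄} (F.obj X) (F.obj I) (n + 1)))
    (X Y : C) (n : ℕ) : Function.Bijective (F.mapExtAddHom X Y n) := by
  induction n generalizing Y with
  | zero => simpa [Ext.mapExactFunctor₀] using
      ⟨Functor.Faithful.map_injective, Functor.Full.map_surjective⟩
  | succ n hn =>
    -- Dimension shifting: on both sides, Ext in degree `n + 1` is the cokernel of the same map in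
    -- degree `n`, because the middle term of an injective presentation has no higher Ext before or
    -- after applying `F`.
    let I : InjectivePresentation Y := Classical.arbitrary _
    let S := ShortComplex.mk _ _ (cokernel.condition I.f)
    have : Injective S.X₂ := I.injective
    have hS : S.ShortExact := { exact := ShortComplex.exact_cokernel I.f }
    have : Subsingleton (Ext.{w₄} (F.obj X) (S.map F).X₂ (n + 1)) := hI X S.X₂ n
    exact AddMonoidHom.bijective_of_surjective_of_bijective_of_right_exact _ _ _ _
      (F.mapExtAddHom X S.X₂ n) (F.mapExtAddHom X S.X₃ n) (F.mapExtAddHom X S.X₁ (n + 1))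
      (AddMonoidHom.ext fun e => by
        refine Eq.symm (?_ : (e.comp (Ext.mk₀ S.g) (add_zero n)).mapExactFunctor F =
          (e.mapExactFunctor F).comp (Ext.mk₀ (F.map S.g)) (add_zero n))
        rw [Ext.mapExactFunctor_comp, Ext.mapExactFunctor_mk₀])
      (AddMonoidHom.ext fun e => by
        refine Eq.symm (?_ : (e.comp hS.extClass rfl).mapExactFunctor F =
          (e.mapExactFunctor F).comp (hS.map F).extClass rfl)
        rw [Ext.mapExactFunctor_comp, Ext.mapExactFunctor_extClass]
        rfl)
      ((ShortComplex.ab_exact_iff_function_exact _).mp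
        (Ext.covariant_sequence_exact₃' X hS n (n + 1) rfl))
      ((ShortComplex.ab_exact_iff_function_exact _).mp
        (Ext.covariant_sequence_exact₃' (F.obj X) (hS.map F) n (n + 1) rfl))
      (hn _).surjective (hn _)
      (fun x₁ ↦ Ext.covariant_sequence_exact₁ _ hS x₁ (by subsingleton) rfl)
      (fun y₁ ↦ Ext.covariant_sequence_exact₁ _ (hS.map F) y₁ (by subsingleton) rfl)

open Abelian in
-- In negative shifts both Hom groups vanish by the t-structure; in the others they are Ext groups,
-- on which the functor acts by `mapExtAddHom`.
lemma bijShiftedHom_single [HasExt.{w₄} D]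
    (hI : ∀ (X I : C) [Injective I] (n : ℕ), Subsingleton (Ext.{w₄} (F.obj X) (F.obj I) (n + 1)))
    (X Y : C) : BijShiftedHom F.mapDerivedCategory ((singleFunctor C 0).obj X)
      ((singleFunctor C 0).obj Y) := by
  have : HasExt.{w₁} C := hasExt_of_hasDerivedCategory C
  refine BijShiftedHom.mk' fun n => ?_
  rcases lt_or_ge n 0 with hn | hn
  · have : t.IsGE (((singleFunctor C 0).obj Y)⟦n⟧) (-n) :=
      t.isGE_shift _ 0 n (-n) (by lia)
    have h₁ : ∀ f : (singleFunctor C 0).obj X ⟶ ((singleFunctor C 0).obj Y)⟦n⟧, f = 0 :=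
      fun f => t.zero f 0 (-n) (by lia)
    let e₁ : F.mapDerivedCategory.obj ((singleFunctor C 0).obj X) ≅
        (singleFunctor D 0).obj (F.obj X) := (F.mapDerivedCategorySingleFunctor 0).app X
    let e₂ : F.mapDerivedCategory.obj (((singleFunctor C 0).obj Y)⟦n⟧) ≅
        ((singleFunctor D 0).obj (F.obj Y))⟦n⟧ :=
        (F.mapDerivedCategory.commShiftIso n).app ((singleFunctor C 0).obj Y) ≪≫
      (shiftFunctor _ n).mapIso ((F.mapDerivedCategorySingleFunctor 0).app Y)
    have : t.IsGE (((singleFunctor D 0).obj (F.obj Y))⟦n⟧) (-n) :=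
      t.isGE_shift _ 0 n (-n) (by lia)
    have h₂ : ∀ f : F.mapDerivedCategory.obj ((singleFunctor C 0).obj X) ⟶
        F.mapDerivedCategory.obj (((singleFunctor C 0).obj Y)⟦n⟧), f = 0 := fun f => by
      have := t.zero (e₁.inv ≫ f ≫ e₂.hom) 0 (-n) (by lia)
      rw [← cancel_epi e₁.inv, ← cancel_mono e₂.hom]
      simpa using this
    exact ⟨fun f g _ => by rw [h₁ f, h₁ g], fun f => ⟨0, by rw [h₂ f, Functor.map_zero]⟩⟩
  · obtain ⟨k, rfl⟩ := Int.eq_ofNat_of_zero_le hn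
    have hb := mapExt_bijective_of_subsingleton F hI X Y k
    -- Conjugation with the isomorphisms comparing `F` with single functors and shifts; it
    -- translates the action on morphisms into the map of Ext groups.
    have hc : Function.Bijective (fun f : F.mapDerivedCategory.obj ((singleFunctor C 0).obj X) ⟶
        F.mapDerivedCategory.obj (((singleFunctor C 0).obj Y)⟦(k : ℤ)⟧) =>
        (F.mapDerivedCategorySingleFunctor 0).inv.app X ≫ (f ≫
          (F.mapDerivedCategory.commShiftIso (k : ℤ)).hom.app ((singleFunctor C 0).obj Y)) ≫
        ((F.mapDerivedCategorySingleFunctor 0).hom.app Y)⟦(k : ℤ)⟧') := by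
      refine ⟨fun f g hfg => ?_, fun f => ⟨(F.mapDerivedCategorySingleFunctor 0).hom.app X ≫ f ≫
        ((F.mapDerivedCategorySingleFunctor 0).inv.app Y)⟦(k : ℤ)⟧' ≫
          (F.mapDerivedCategory.commShiftIso (k : ℤ)).inv.app ((singleFunctor C 0).obj Y), ?_⟩⟩
      · dsimp only at hfg
        rwa [cancel_epi, cancel_mono, cancel_mono] at hfg
      · simp [← Functor.map_comp]
    have key : (fun f : F.mapDerivedCategory.obj ((singleFunctor C 0).obj X) ⟶
        F.mapDerivedCategory.obj (((singleFunctor C 0).obj Y)⟦(k : ℤ)⟧) =>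
        (F.mapDerivedCategorySingleFunctor 0).inv.app X ≫ (f ≫
          (F.mapDerivedCategory.commShiftIso (k : ℤ)).hom.app ((singleFunctor C 0).obj Y)) ≫
        ((F.mapDerivedCategorySingleFunctor 0).hom.app Y)⟦(k : ℤ)⟧') ∘
        (F.mapDerivedCategory.map : ((singleFunctor C 0).obj X ⟶ _) → _) ∘
          (Ext.homEquiv : Ext X Y k ≃ _) =
        (Ext.homEquiv : Ext (F.obj X) (F.obj Y) k ≃ _) ∘ F.mapExtAddHom X Y k := by
      funext e
      exact (Ext.mapExactFunctor_hom F e).symm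
    have h₁ : Function.Bijective ((Ext.homEquiv : Ext (F.obj X) (F.obj Y) k ≃
        ShiftedHom ((singleFunctor D 0).obj (F.obj X)) ((singleFunctor D 0).obj (F.obj Y)) (k : ℤ)) ∘
        F.mapExtAddHom X Y k) := (Equiv.bijective _).comp hb
    rw [← key] at h₁
    have h₂ := (Function.Bijective.of_comp_iff' hc _).1 h₁
    exact (Function.Bijective.of_comp_iff _ (Equiv.bijective _)).1 h₂

open Abelian in
-- Dévissage in each variable: the target first, with a single object as source, and then the
-- source.
lemma bijShiftedHom_bounded [HasExt.{w₄} D]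
    (hI : ∀ (X I : C) [Injective I] (n : ℕ), Subsingleton (Ext.{w₄} (F.obj X) (F.obj I) (n + 1)))
    (K L : DerivedCategory C) (hK : t.bounded K) (hL : t.bounded L) :
    BijShiftedHom F.mapDerivedCategory K L := by
  have hz : ∀ K L : DerivedCategory C, IsZero K ∨ IsZero L →
      BijShiftedHom F.mapDerivedCategory K L := by
    intro K L h a b
    have h₁ : IsZero (K⟦a⟧) ∨ IsZero (L⟦b⟧) :=
      h.imp (fun h => (shiftFunctor _ a).map_isZero h) fun h => (shiftFunctor _ b).map_isZero h
    rcases h₁ with h₁ | h₁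
    · exact ⟨fun f g _ => h₁.eq_of_src _ _, fun f =>
        ⟨0, (F.mapDerivedCategory.map_isZero h₁).eq_of_src _ _⟩⟩
    · exact ⟨fun f g _ => h₁.eq_of_tgt _ _, fun f =>
        ⟨0, (F.mapDerivedCategory.map_isZero h₁).eq_of_tgt _ _⟩⟩
  have hs : ∀ (X : C) (n : ℤ), Nonempty (((singleFunctor C 0).obj X)⟦-n⟧ ≅
      (singleFunctor C n).obj X) := fun X n =>
    ⟨((singleFunctors C).shiftIso (-n) n 0 (by lia)).app X⟩
  have h₁ : ∀ (X : C), BijShiftedHom F.mapDerivedCategory ((singleFunctor C 0).obj X) L := by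
    intro X
    let R : ObjectProperty (DerivedCategory C) :=
      fun L => BijShiftedHom F.mapDerivedCategory ((singleFunctor C 0).obj X) L
    have : R.IsClosedUnderIsomorphisms := ⟨fun e h => h.of_iso (Iso.refl _) e⟩
    refine bounded_induction ⊤ R (fun L h => hz _ _ (Or.inr h)) (fun Y n _ => ?_)
      (fun S hS _ h₁ _ h₃ => h₁.of_distinguished₂' hS h₃) L ⟨hL, fun _ => trivial⟩
    obtain ⟨e⟩ := hs Y n
    exact ((bijShiftedHom_single F hI X Y).shift_right (-n)).of_iso (Iso.refl _) e
  let R : ObjectProperty (DerivedCategory C) := fun K => BijShiftedHom F.mapDerivedCategory K L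
  have : R.IsClosedUnderIsomorphisms := ⟨fun e h => h.of_iso e (Iso.refl _)⟩
  refine bounded_induction ⊤ R (fun L h => hz _ _ (Or.inl h)) (fun Y n _ => ?_)
    (fun S hS _ h₁ _ h₃ => h₁.of_distinguished₂ hS h₃) K ⟨hK, fun _ => trivial⟩
  obtain ⟨e⟩ := hs Y n
  exact ((h₁ Y).shift_left (-n)).of_iso e (Iso.refl _)

open Abelian in
-- Dévissage once more. If the outer terms of a triangle come from `C`, then so does its connecting
-- morphism, by bijectivity on shifted Homs, and the middle term is recovered by completing that
-- morphism to a triangle.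
lemma exists_bounded_preimage [HasExt.{w₄} D]
    (hI : ∀ (X I : C) [Injective I] (n : ℕ), Subsingleton (Ext.{w₄} (F.obj X) (F.obj I) (n + 1)))
    (K : DerivedCategory D) (hK : boundedWith F.essImage K) :
    ∃ K' : DerivedCategory C, t.bounded K' ∧ Nonempty (F.mapDerivedCategory.obj K' ≅ K) := by
  let R : ObjectProperty (DerivedCategory D) := fun K =>
    ∃ K' : DerivedCategory C, t.bounded K' ∧ Nonempty (F.mapDerivedCategory.obj K' ≅ K)
  have : R.IsClosedUnderIsomorphisms :=
    ⟨fun {_ _} e ⟨K', hK', ⟨e'⟩⟩ => ⟨K', hK', ⟨e' ≪≫ e⟩⟩⟩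
  refine bounded_induction F.essImage R ?_ ?_ ?_ K hK
  · intro K hK
    obtain ⟨Z, hZ⟩ := HasZeroObject.zero (C := C)
    exact ⟨(singleFunctor C 0).obj Z, ⟨⟨0, inferInstance⟩, ⟨0, inferInstance⟩⟩,
      ⟨(F.mapDerivedCategory.map_isZero ((singleFunctor C 0).map_isZero hZ)).iso hK⟩⟩
  · rintro X n ⟨Y, ⟨e⟩⟩
    refine ⟨(singleFunctor C n).obj Y, ⟨⟨n, inferInstance⟩, ⟨n, inferInstance⟩⟩,
      ⟨(F.mapDerivedCategorySingleFunctor n).app Y ≪≫ (singleFunctor D n).mapIso e⟩⟩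
  · rintro S hS - ⟨K₁, hK₁, ⟨e₁⟩⟩ - ⟨K₃, hK₃, ⟨e₃⟩⟩
    obtain ⟨f, hf⟩ := ((bijShiftedHom_bounded F hI K₃ K₁ hK₃ hK₁) 0 1).of_iso
      ((shiftFunctorZero _ ℤ).app K₃) (Iso.refl _) |>.2
      (e₃.hom ≫ S.mor₃ ≫ e₁.inv⟦(1 : ℤ)⟧' ≫
        (F.mapDerivedCategory.commShiftIso (1 : ℤ)).inv.app K₁)
    obtain ⟨K₂, a, b, hT⟩ := distinguished_cocone_triangle₂ f
    refine ⟨K₂, t.bounded.ext_of_isTriangulatedClosed₂ _ hT hK₁ hK₃, ?_⟩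
    refine ⟨Triangle.π₂.mapIso (isoTriangleOfIso₁₃
      (F.mapDerivedCategory.mapTriangle.obj (Triangle.mk a b f)) S
      (F.mapDerivedCategory.map_distinguished _ hT) hS e₁ e₃ ?_)⟩
    change (F.mapDerivedCategory.map f ≫ (F.mapDerivedCategory.commShiftIso (1 : ℤ)).hom.app K₁) ≫
      e₁.hom⟦(1 : ℤ)⟧' = e₃.hom ≫ S.mor₃
    rw [hf]
    simp [← Functor.map_comp]

end BoundedDerived

/-! ### A criterion for the natural functor to be an equivalence -/

section NaturalFunctor

open DerivedCategory DerivedCategory.TStructure Abelian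

variable {Y : TopCat.{0}} {A : Type} {O : A → TopCat.{0}} (i : ∀ a, O a ⟶ Y)
  [∀ a, LocallyConnectedSpace (O a)]
  [HasDerivedCategory.{w} (LCOn i)] [HasDerivedCategory.{w} (Sh Y)]

/-- This isolates what geometry must provide: enough injectives in LC, and their acyclicity as
sheaves against all objects of LC. -/
lemma naturalFunctor_isEquivalence [EnoughInjectives (LCOn i)] [HasExt.{0} (Sh Y)]
    (hI : ∀ (X I : LCOn i) [Injective I] (n : ℕ),
      Subsingleton (Ext.{0} X.obj I.obj (n + 1))) :
    (naturalFunctor i).IsEquivalence := by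
  have key : ∀ K L : Bounded (LCOn i),
      BijHom (locConstOn i).ι.mapDerivedCategory K.1 L.1 := fun K L =>
    (bijShiftedHom_bounded (locConstOn i).ι hI K.1 L.1 K.2 L.2 0 0).of_iso
      ((shiftFunctorZero _ ℤ).app _) ((shiftFunctorZero _ ℤ).app _)
  have h₁ : (naturalFunctor i).Faithful := ⟨fun {K L} f g h => by
    apply ObjectProperty.hom_ext
    exact (key K L).1 (congrArg (fun f => f.hom) h)⟩
  have h₂ : (naturalFunctor i).Full := ⟨fun {K L} f => by
    obtain ⟨g, hg⟩ := (key K L).2 f.hom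
    exact ⟨ObjectProperty.homMk g, ObjectProperty.hom_ext _ hg⟩⟩
  have h₃ : (naturalFunctor i).EssSurj := ⟨fun K => by
    obtain ⟨K', hK', ⟨e⟩⟩ := exists_bounded_preimage (locConstOn i).ι hI K.1
      ⟨K.2.1, fun n => ⟨⟨_, K.2.2 n⟩, ⟨Iso.refl _⟩⟩⟩
    exact ⟨⟨K', hK'⟩, ⟨(boundedWith (locConstOn i)).isoMk e⟩⟩⟩
  exact {}

end NaturalFunctor

end

end Toric

namespace Toric

noncomputable section

/-! ### Objects acyclic for a family of test objects -/

section ExtAcyclic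

open Abelian

universe w₃ v₁ v₂ u₁ u₂

variable {B : Type u₁} [Category.{v₁} B] [Abelian B] [HasExt.{w₃} B] {κ : Type*} (P : κ → B)

/-- The objects `X` such that `Ext^n(P_a, X) = 0` for all `a` and all `n > 0`. -/
def ExtAcyclic : ObjectProperty B := fun X => ∀ a (n : ℕ), Subsingleton (Ext.{w₃} (P a) X (n + 1))

variable {P}

lemma ExtAcyclic.of_injective (I : B) [Injective I] : ExtAcyclic P I := fun _ _ =>
  Ext.subsingleton_of_injective _ _ _

lemma ExtAcyclic.of_isZero {I : B} (h : IsZero I) : ExtAcyclic P I :=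
  have : Injective I := ⟨fun _ _ _ => ⟨0, h.eq_of_tgt _ _⟩⟩
  .of_injective I

/-- Splitting the identity of `X` suffices to kill Ext classes. The terms of a mapping cone come in
this form, and retracts are the case of a zero second summand. -/
lemma ExtAcyclic.of_decomposition {X X₁ X₂ : B} (h₁ : ExtAcyclic P X₁) (h₂ : ExtAcyclic P X₂)
    (p₁ : X ⟶ X₁) (p₂ : X ⟶ X₂) (i₁ : X₁ ⟶ X) (i₂ : X₂ ⟶ X)
    (h : p₁ ≫ i₁ + p₂ ≫ i₂ = 𝟙 X) : ExtAcyclic P X := fun a n => by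
  have := h₁ a n
  have := h₂ a n
  refine subsingleton_of_forall_eq 0 fun e => ?_
  have e₁ : e.comp (Ext.mk₀ p₁) (add_zero _) = 0 := Subsingleton.elim _ _
  have e₂ : e.comp (Ext.mk₀ p₂) (add_zero _) = 0 := Subsingleton.elim _ _
  rw [← Ext.comp_mk₀_id e, ← h, Ext.mk₀_add, Ext.comp_add, ← Ext.mk₀_comp_mk₀, ← Ext.mk₀_comp_mk₀,
    ← Ext.comp_assoc_of_third_deg_zero, ← Ext.comp_assoc_of_third_deg_zero, e₁, e₂, Ext.zero_comp,
    Ext.zero_comp, add_zero]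

lemma ExtAcyclic.of_retract {X X₁ : B} (h₁ : ExtAcyclic P X₁) (r : Retract X X₁) :
    ExtAcyclic P X :=
  h₁.of_decomposition h₁ r.i 0 r.r 0 (by simp)

/-- Ext in degree `n + 1` of the quotient lies between that of the middle term and Ext in degree `n
+ 2` of the subobject. -/
lemma ExtAcyclic.of_shortExact {S : ShortComplex B} (hS : S.ShortExact) (h₁ : ExtAcyclic P S.X₁)
    (h₂ : ExtAcyclic P S.X₂) : ExtAcyclic P S.X₃ := fun a n => by
  have := h₁ a (n + 1)
  have := h₂ a n
  refine subsingleton_of_forall_eq 0 fun e => ?_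
  obtain ⟨x, hx⟩ := Ext.covariant_sequence_exact₃ (P a) hS e rfl (Subsingleton.elim _ _)
  rw [← hx, Subsingleton.elim x 0, Ext.zero_comp]

variable {B' : Type u₂} [Category.{v₂} B'] [Abelian B']

/-- Exactness at `n + 1` says precisely that `M.X n` maps onto the next cycles. All dimension shifts
along complexes rest on these sequences. -/
lemma shortExact_cycles (M : CochainComplex B ℤ) (n : ℤ) (hM : M.ExactAt (n + 1)) :
    (ShortComplex.mk (M.iCycles n) (M.toCycles n (n + 1)) (by
      rw [← cancel_mono (M.iCycles (n + 1))]; simp)).ShortExact := by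
  have : Epi (M.toCycles n (n + 1)) :=
    Preadditive.epi_of_isZero_cokernel' _ (M.homologyIsCokernel n (n + 1) (by simp))
      hM.isZero_homology
  have : Mono (M.iCycles n) := inferInstance
  refine { exact := ?_, mono_f := this, epi_g := by assumption }
  refine ShortComplex.exact_of_f_is_kernel _ (KernelFork.IsLimit.ofι' _ _ fun k hk =>
    ⟨M.liftCycles k (n + 1) (by simp) ?_, M.liftCycles_i _ _ _ _⟩)
  have := congrArg (· ≫ M.iCycles (n + 1)) hk
  simpa using this

/-- A left exact functor preserves the acyclicity of bounded below complexes of objects that are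
acyclic with respect to a family of objects which detects the epimorphisms after applying `G`. -/
lemma acyclic_map_of_extAcyclic (G : B ⥤ B') [G.Additive] [PreservesFiniteLimits G]
    (hG : ∀ S : ShortComplex B, S.ShortExact → ExtAcyclic P S.X₁ → Epi (G.map S.g))
    (M : CochainComplex B ℤ) (hM : M.Acyclic) (n₀ : ℤ) [M.IsStrictlyGE n₀]
    (hP : ∀ n, ExtAcyclic P (M.X n)) :
    ((G.mapHomologicalComplex (.up ℤ)).obj M).Acyclic := by
  -- The cycles vanish below `n₀`, and acyclicity climbs one degree at a time along the sequences of
  -- cycles.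
  have hcyc : ∀ k : ℕ, ExtAcyclic P (M.cycles (n₀ - 1 + k)) := by
    intro k
    induction k with
    | zero =>
      have h : IsZero (M.X (n₀ - 1)) := M.isZero_of_isStrictlyGE n₀ _ (by lia)
      refine ExtAcyclic.of_isZero ?_
      rw [Nat.cast_zero, add_zero]
      exact IsZero.of_mono (M.iCycles _) h
    | succ k ih =>
      have := ExtAcyclic.of_shortExact (shortExact_cycles M (n₀ - 1 + k) (hM _)) ih (hP _)
      rw [Nat.cast_succ, ← add_assoc]
      exact this
  have hcyc' : ∀ n, ExtAcyclic P (M.cycles n) := by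
    intro n
    rcases lt_or_ge n n₀ with hn | hn
    · exact ExtAcyclic.of_isZero (IsZero.of_mono (M.iCycles _) (M.isZero_of_isStrictlyGE n₀ _ hn))
    · obtain ⟨k, rfl⟩ : ∃ k : ℕ, n = n₀ - 1 + k := ⟨(n - (n₀ - 1)).toNat, by lia⟩
      exact hcyc k
  intro m
  obtain ⟨n, rfl⟩ : ∃ n, m = n + 1 := ⟨m - 1, by lia⟩
  rw [HomologicalComplex.exactAt_iff' _ n (n + 1) (n + 1 + 1) (by simp) (by simp)]
  have hepi : Epi (G.map (M.toCycles n (n + 1))) := hG _ (shortExact_cycles M n (hM _)) (hcyc' n)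
  -- The left exact `G` preserves the kernel `M.cycles (n + 1)`; replacing it by `M.X n` keeps
  -- exactness because `G.map (M.toCycles n (n + 1))` is epi.
  let S₁ : ShortComplex B' := ShortComplex.mk (G.map (M.iCycles (n + 1)))
    (G.map (M.d (n + 1) (n + 1 + 1))) (by rw [← G.map_comp]; simp)
  have hS₁ : S₁.Exact := by
    refine ShortComplex.exact_of_f_is_kernel _ ?_
    exact isLimitForkMapOfIsLimit' G (by simp) (M.cyclesIsKernel (n + 1) (n + 1 + 1) (by simp))
  let φ : ((G.mapHomologicalComplex (.up ℤ)).obj M).sc' n (n + 1) (n + 1 + 1) ⟶ S₁ :=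
    { τ₁ := G.map (M.toCycles n (n + 1))
      τ₂ := 𝟙 _
      τ₃ := 𝟙 _
      comm₁₂ := by
        refine Eq.trans ?_ (Category.comp_id _).symm
        exact (G.map_comp _ _).symm.trans (congrArg G.map (M.toCycles_i n (n + 1)))
      comm₂₃ := (Category.id_comp _).trans (Category.comp_id _).symm }
  have : Epi φ.τ₁ := hepi
  have : IsIso φ.τ₂ := inferInstanceAs (IsIso (𝟙 _))
  have : Mono φ.τ₃ := inferInstanceAs (Mono (𝟙 _))
  exact (ShortComplex.exact_iff_of_epi_of_isIso_of_mono φ).2 hS₁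

lemma quasiIso_iff_acyclic_mappingCone {B : Type u₁} [Category.{v₁} B] [Abelian B]
    {K L : CochainComplex B ℤ} (f : K ⟶ L) :
    QuasiIso f ↔ (CochainComplex.mappingCone f).Acyclic := by
  have h := (HomotopyCategory.subcategoryAcyclic B).trW_iff_of_distinguished _
    (HomotopyCategory.mappingCone_triangleh_distinguished f)
  rw [← HomotopyCategory.quasiIso_eq_trW_subcategoryAcyclic] at h
  refine (HomotopyCategory.quotient_map_mem_quasiIso_iff f).symm.trans (h.trans ?_)
  exact HomotopyCategory.quotient_obj_mem_subcategoryAcyclic_iff_acyclic _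

/-- A left exact functor preserves quasi-isomorphisms between bounded below complexes of
acyclic objects. -/
lemma quasiIso_map_of_extAcyclic (G : B ⥤ B') [G.Additive] [PreservesFiniteLimits G]
    (hG : ∀ S : ShortComplex B, S.ShortExact → ExtAcyclic P S.X₁ → Epi (G.map S.g))
    {K L : CochainComplex B ℤ} (f : K ⟶ L) [QuasiIso f]
    (n₀ n₁ : ℤ) [K.IsStrictlyGE n₀] [L.IsStrictlyGE n₁]
    (hK : ∀ n, ExtAcyclic P (K.X n)) (hL : ∀ n, ExtAcyclic P (L.X n)) :
    QuasiIso ((G.mapHomologicalComplex (.up ℤ)).map f) := by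
  rw [quasiIso_iff_acyclic_mappingCone]
  let M := CochainComplex.mappingCone f
  have hM : M.Acyclic := (quasiIso_iff_acyclic_mappingCone f).1 inferInstance
  -- The cone in degree `i` contains `K` in degree `i + 1`, hence the shift by one.
  have hge : M.IsStrictlyGE (min n₀ n₁ - 1) := by
    rw [CochainComplex.isStrictlyGE_iff]
    intro i hi
    rw [CochainComplex.mappingCone.isZero_X_iff]
    exact ⟨K.isZero_of_isStrictlyGE n₀ _ (by lia), L.isZero_of_isStrictlyGE n₁ _ (by lia)⟩
  have h := acyclic_map_of_extAcyclic G hG M hM (min n₀ n₁ - 1) fun n =>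
    (hK (n + 1)).of_decomposition (hL n)
      ((CochainComplex.mappingCone.fst f).1.v n (n + 1) rfl)
      ((CochainComplex.mappingCone.snd f).v n n (add_zero _))
      ((CochainComplex.mappingCone.inl f).v (n + 1) n (by lia))
      ((CochainComplex.mappingCone.inr f).f n) (CochainComplex.mappingCone.id_X f n (n + 1) rfl)
  exact fun n => (h n).of_iso (CochainComplex.mappingCone.mapHomologicalComplexIso f G)

end ExtAcyclic

/-! ### Comparison of right derived functors on D^+ -/

section Comparison

open DerivedCategory DerivedCategory.TStructure Abelian

universe w₁ w₂ w₃ w₄ w₅ v₁ v₂ v₃ v₄ u₁ u₂ u₃ u₄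

variable {B : Type u₁} [Category.{v₁} B] [Abelian B] [HasDerivedCategory.{w₁} B]
  {B' : Type u₂} [Category.{v₂} B'] [Abelian B'] [HasDerivedCategory.{w₂} B']

/-- Acyclic complexes compute the derived functor: `G` preserves the quasi-isomorphism from `K` to
an injective resolution, where the unit is an isomorphism, and naturality carries this back to `K`.
-/
lemma isIso_rightDerivedFunctorPlusUnit_app [EnoughInjectives B] [HasExt.{w₃} B] {κ : Type*}
    (P : κ → B) (G : B ⥤ B') [G.Additive] [PreservesFiniteLimits G]
    (hG : ∀ S : ShortComplex B, S.ShortExact → ExtAcyclic P S.X₁ → Epi (G.map S.g))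
    (K : CochainComplex.Plus B) (hK : ∀ n, ExtAcyclic P (K.obj.X n)) :
    IsIso (G.rightDerivedFunctorPlusUnit.app ((HomotopyCategory.Plus.quotient B).obj K)) := by
  obtain ⟨n, hn⟩ := K.2
  have : K.obj.IsStrictlyGE n := hn
  obtain ⟨L, hL, i, hi⟩ := CochainComplex.Plus.exists_quasiIso_injective K n
  have : QuasiIso i.hom := hi
  have hinj : ∀ n, Injective ((((InjectiveObject.ι B).mapCochainComplexPlus.obj L).obj).X n) :=
    fun n => (L.obj.X n).property
  have : (((InjectiveObject.ι B).mapCochainComplexPlus.obj L).obj).IsStrictlyGE n :=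
    inferInstanceAs (CochainComplex.IsStrictlyGE
      (((InjectiveObject.ι B).mapHomologicalComplex _).obj L.obj) n)
  have hq : QuasiIso ((G.mapHomologicalComplex (.up ℤ)).map i.hom) :=
    quasiIso_map_of_extAcyclic G hG i.hom n n hK fun n => by
      have := hinj n
      exact ExtAcyclic.of_injective _
  have h₁ : IsIso (Plus.Qh.map ((HomotopyCategory.Plus.quotient B).map i)) := by
    refine Localization.inverts Plus.Qh (HomotopyCategory.Plus.quasiIso B) _ ?_
    exact (HomotopyCategory.quotient_map_mem_quasiIso_iff i.hom).2 hi
  have h₂ : IsIso ((G.mapHomotopyCategoryPlus ⋙ Plus.Qh).map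
      ((HomotopyCategory.Plus.quotient B).map i)) := by
    refine Localization.inverts Plus.Qh (HomotopyCategory.Plus.quasiIso B') _ ?_
    exact (HomotopyCategory.quotient_map_mem_quasiIso_iff _).2 hq
  have h₃ : IsIso (G.rightDerivedFunctorPlusUnit.app ((HomotopyCategory.Plus.quotient B).obj
        ((InjectiveObject.ι B).mapCochainComplexPlus.obj L))) := inferInstance
  have h₄ : IsIso ((Plus.Qh ⋙ G.rightDerivedFunctorPlus).map
      ((HomotopyCategory.Plus.quotient B).map i)) :=
    inferInstanceAs (IsIso (G.rightDerivedFunctorPlus.map _))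
  have nat := G.rightDerivedFunctorPlusUnit.naturality ((HomotopyCategory.Plus.quotient B).map i)
  have h₅ : IsIso (G.rightDerivedFunctorPlusUnit.app ((HomotopyCategory.Plus.quotient B).obj K) ≫
      (Plus.Qh ⋙ G.rightDerivedFunctorPlus).map ((HomotopyCategory.Plus.quotient B).map i)) := by
    rw [← nat]; infer_instance
  exact IsIso.of_isIso_comp_right _ ((Plus.Qh ⋙ G.rightDerivedFunctorPlus).map
      ((HomotopyCategory.Plus.quotient B).map i))

variable {A' : Type u₄} [Category.{v₄} A'] [Abelian A'] [HasDerivedCategory.{w₅} A']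
  {A : Type u₃} [Category.{v₃} A] [Abelian A] [HasDerivedCategory.{w₄} A]

/-- The functor between bounded below derived categories induced by an exact functor. -/
def mapPlus (F : A ⥤ B) [F.Additive] [PreservesFiniteLimits F] [PreservesFiniteColimits F] :
    Plus A ⥤ Plus B :=
  t.plus.lift (Plus.ι ⋙ F.mapDerivedCategory) fun K => by
    obtain ⟨a, ha⟩ := K.2
    exact ⟨a, (isGE_iff _ _).2 fun n hn =>
      (F.map_isZero ((isGE_iff _ _).1 ha n hn)).of_iso (homologyMapDerivedIso F n K.1)⟩

def mapPlusFactors (F : A ⥤ B) [F.Additive] [PreservesFiniteLimits F]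
    [PreservesFiniteColimits F] :
    Plus.Qh ⋙ mapPlus F ≅ F.mapHomotopyCategoryPlus ⋙ Plus.Qh :=
  (t.plus.fullyFaithfulι.whiskeringRight _).preimageIso
    (Functor.isoWhiskerLeft (HomotopyCategory.Plus.ι A) F.mapDerivedCategoryFactorsh)

variable (A) in
/-- The functor from complexes of injective objects up to homotopy to the derived category. -/
abbrev injectiveQh : HomotopyCategory.Plus (InjectiveObject A) ⥤ Plus A :=
  (InjectiveObject.ι A).mapHomotopyCategoryPlus ⋙ Plus.Qh

/-- Bounded below complexes of injectives are K-injective, so their morphisms in the derived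
category are homotopy classes of maps; essential surjectivity is the existence of injective
resolutions. -/
instance injectiveQh_isEquivalence [EnoughInjectives A] : (injectiveQh A).IsEquivalence := by
  have key : ∀ K L, Function.Bijective ((injectiveQh A).map : (K ⟶ L) → _) := by
    intro K L
    have h₁ : Function.Bijective ((InjectiveObject.ι A).mapHomotopyCategoryPlus.map :
        (K ⟶ L) → _) := Functor.FullyFaithful.map_bijective (.ofFullyFaithful _) _ _
    have : CochainComplex.IsKInjective
        ((InjectiveObject.ι A).mapHomotopyCategoryPlus.obj L).1.as := by
      obtain ⟨L, rfl⟩ := HomotopyCategory.Plus.quotient_obj_surjective L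
      exact inferInstanceAs (CochainComplex.IsKInjective
        (((InjectiveObject.ι A).mapHomologicalComplex (.up ℤ)).obj L.obj))
    exact (Plus.Qh_map_bijective_of_isKInjective _ _ this).comp h₁
  have h₁ : (injectiveQh A).Faithful := ⟨fun {K L} _ _ h => (key K L).1 h⟩
  have h₂ : (injectiveQh A).Full := ⟨fun {K L} => (key K L).2⟩
  exact {}

/-- The comparison of the derived functors of `G_A` and `G` when `ι' ∘ G_A ≅ G ∘ ι`. -/
theorem nonempty_rightDerived_comparison [EnoughInjectives A] [EnoughInjectives B] [HasExt.{w₃} B]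
    {κ : Type*} (P : κ → B) (G : B ⥤ B') [G.Additive] [PreservesFiniteLimits G]
    (hG : ∀ S : ShortComplex B, S.ShortExact → ExtAcyclic P S.X₁ → Epi (G.map S.g))
    (GA : A ⥤ A') [GA.Additive]
    (F : A ⥤ B) [F.Additive] [PreservesFiniteLimits F] [PreservesFiniteColimits F]
    (F' : A' ⥤ B') [F'.Additive] [PreservesFiniteLimits F'] [PreservesFiniteColimits F']
    (e : GA ⋙ F' ≅ F ⋙ G) (hF : ∀ (I : A) [Injective I], ExtAcyclic P (F.obj I)) :
    Nonempty (GA.rightDerivedFunctorPlus ⋙ mapPlus F' ≅ mapPlus F ⋙ G.rightDerivedFunctorPlus) := by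
  let i := (InjectiveObject.ι A).mapHomotopyCategoryPlus
  have hu : ∀ K, IsIso ((Functor.whiskerLeft i GA.rightDerivedFunctorPlusUnit).app K) := fun K =>
    inferInstanceAs (IsIso (GA.rightDerivedFunctorPlusUnit.app (i.obj K)))
  have : IsIso (Functor.whiskerLeft i GA.rightDerivedFunctorPlusUnit) :=
    NatIso.isIso_of_isIso_app _
  have hu' : ∀ K, IsIso ((Functor.whiskerLeft (i ⋙ F.mapHomotopyCategoryPlus)
      G.rightDerivedFunctorPlusUnit).app K) := by
    intro K
    obtain ⟨K, rfl⟩ := HomotopyCategory.Plus.quotient_obj_surjective K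
    exact isIso_rightDerivedFunctorPlusUnit_app P G hG
      (F.mapCochainComplexPlus.obj ((InjectiveObject.ι A).mapCochainComplexPlus.obj K))
      fun n => hF (K.obj.X n).obj
  have : IsIso (Functor.whiskerLeft (i ⋙ F.mapHomotopyCategoryPlus)
      G.rightDerivedFunctorPlusUnit) :=
    NatIso.isIso_of_isIso_app _
  have e' : GA.mapHomotopyCategoryPlus ⋙ F'.mapHomotopyCategoryPlus ≅
      F.mapHomotopyCategoryPlus ⋙ G.mapHomotopyCategoryPlus :=
    Functor.mapHomotopyCategoryPlusCompIso e ≪≫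
      (Functor.mapHomotopyCategoryPlusCompIso (Iso.refl _)).symm
  -- On complexes of injectives of `A` both sides are computed termwise: the left one by
  -- injectivity, the right one because `F` makes injectives acyclic. As `injectiveQh A` is an
  -- equivalence, an isomorphism after precomposition with it suffices.
  let E : injectiveQh A ⋙ GA.rightDerivedFunctorPlus ⋙ mapPlus F' ≅
      injectiveQh A ⋙ mapPlus F ⋙ G.rightDerivedFunctorPlus :=
    (Functor.isoWhiskerRight (asIso (Functor.whiskerLeft i GA.rightDerivedFunctorPlusUnit)).symm
      (mapPlus F') :) ≪≫
    (Functor.isoWhiskerLeft (i ⋙ GA.mapHomotopyCategoryPlus) (mapPlusFactors F') :) ≪≫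
    (Functor.isoWhiskerLeft i (Functor.isoWhiskerRight e' Plus.Qh) :) ≪≫
    (asIso (Functor.whiskerLeft (i ⋙ F.mapHomotopyCategoryPlus) G.rightDerivedFunctorPlusUnit) :) ≪≫
    (Functor.isoWhiskerLeft i (Functor.isoWhiskerRight (mapPlusFactors F).symm
      G.rightDerivedFunctorPlus) :)
  exact ⟨((Functor.whiskeringLeft _ _ _).obj (injectiveQh A)).preimageIso E⟩

end Comparison

end

end Toric

namespace Toric

noncomputable section

/-! ### Boundedness of derived functors -/

section Bounded

open DerivedCategory DerivedCategory.TStructure Abelian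

universe w₁ w₂ v₁ v₂ u₁ u₂

variable {B : Type u₁} [Category.{v₁} B] [Abelian B] [HasDerivedCategory.{w₁} B]
  {B' : Type u₂} [Category.{v₂} B'] [Abelian B'] [HasDerivedCategory.{w₂} B']

/-- An injective resolution of a bounded complex is exact in high degrees, and `hb`, a form of
finite cohomological dimension, says that `G` keeps it so. -/
lemma bounded_rightDerivedFunctorPlus [EnoughInjectives B] (G : B ⥤ B') [G.Additive]
    (hb : ∀ (J : CochainComplex B ℤ), (∀ n, Injective (J.X n)) → ∀ b : ℤ,
      (∀ n > b, J.ExactAt n) → ∃ b' : ℤ, ∀ n > b',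
        ((G.mapHomologicalComplex (.up ℤ)).obj J).ExactAt n)
    (K : Plus B) (hK : t.bounded K.obj) :
    t.bounded (G.rightDerivedFunctorPlus.obj K).obj := by
  refine ⟨(G.rightDerivedFunctorPlus.obj K).property, ?_⟩
  obtain ⟨⟨a, ha⟩, b, hb'⟩ := hK
  have : K.IsGE a := ⟨ha.1⟩
  obtain ⟨L, _, ⟨e⟩⟩ := Plus.exists_injective_nonempty_iso K a
  let J := (InjectiveObject.ι B).mapCochainComplexPlus.obj L
  have e₁ : Q.obj J.obj ≅ K.obj :=
    ((quotientCompQhIso B).symm.app J.obj) ≪≫ Plus.ι.mapIso e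
  have hJ : ∀ n > b, J.obj.ExactAt n := fun n hn => by
    rw [HomologicalComplex.exactAt_iff_isZero_homology]
    exact ((isLE_iff K.obj b).1 hb' n hn).of_iso
      (((homologyFunctorFactors B n).app _).symm ≪≫ (homologyFunctor B n).mapIso e₁)
  obtain ⟨b', h⟩ := hb J.obj (fun n => (L.obj.X n).property) b hJ
  refine ⟨b', (isLE_iff _ _).2 fun n hn => ?_⟩
  have e₂ : G.rightDerivedFunctorPlus.obj K ≅
      Plus.Qh.obj (G.mapHomotopyCategoryPlus.obj ((HomotopyCategory.Plus.quotient B).obj J)) :=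
    G.rightDerivedFunctorPlus.mapIso e.symm ≪≫
      (asIso (G.rightDerivedFunctorPlusUnit.app ((HomotopyCategory.Plus.quotient B).obj J))).symm
  have e₃ : (G.rightDerivedFunctorPlus.obj K).obj ≅
      Q.obj ((G.mapHomologicalComplex (.up ℤ)).obj J.obj) :=
    Plus.ι.mapIso e₂ ≪≫ (quotientCompQhIso B').app _
  exact ((h n hn).isZero_homology).of_iso ((homologyFunctor B' n).mapIso e₃ ≪≫
    (homologyFunctorFactors B' n).app _)

end Bounded

/-! ### Derived functors on LC and on sheaves with cohomology in LC -/

section LC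

open DerivedCategory DerivedCategory.TStructure Abelian

variable {Y Z : TopCat.{0}} {A A' : Type} {O : A → TopCat.{0}} {O' : A' → TopCat.{0}}
  (i : ∀ a, O a ⟶ Y) (i' : ∀ b, O' b ⟶ Z)
  [∀ a, LocallyConnectedSpace (O a)] [∀ b, LocallyConnectedSpace (O' b)]
  [HasDerivedCategory.{w} (LCOn i)] [HasDerivedCategory.{w} (Sh Y)]
  [HasDerivedCategory.{w} (LCOn i')] [HasDerivedCategory.{w} (Sh Z)]

/-- The comparison on D^+ yields everything. It bounds the derived functor on LC by the one on
sheaves; and as every object of D^b_LC comes from D^b(LC), it shows that the usual derived functor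
has cohomology in LC. -/
theorem exists_rightDerivedOn_iso [EnoughInjectives (LCOn i)]
    [(naturalFunctor i).IsEquivalence]
    [HasExt.{0} (Sh Y)] {κ : Type} (P : κ → Sh Y) (G : Sh Y ⥤ Sh Z) [G.Additive]
    [PreservesFiniteLimits G]
    (hG : ∀ S : ShortComplex (Sh Y), S.ShortExact → ExtAcyclic P S.X₁ → Epi (G.map S.g))
    (hF : ∀ (I : LCOn i) [Injective I], ExtAcyclic P I.obj)
    (hb : ∀ (J : CochainComplex (Sh Y) ℤ), (∀ n, Injective (J.X n)) → ∀ b : ℤ,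
      (∀ n > b, J.ExactAt n) → ∃ b' : ℤ, ∀ n > b',
        ((G.mapHomologicalComplex (.up ℤ)).obj J).ExactAt n)
    (h : ∀ F, locConstOn i F → locConstOn i' (G.obj F)) :
    ∃ (h₁ : RightDerivedMapsTo (liftLC i i' G h) bounded_le_plus t.bounded)
      (h₂ : RightDerivedMapsTo G (boundedWith_le_plus (locConstOn i)) (boundedWith (locConstOn i'))),
      Nonempty (rightDerivedOn _ _ h₁ ⋙ naturalFunctor i' ≅
        naturalFunctor i ⋙ rightDerivedOn _ _ h₂) := by
  obtain ⟨e⟩ := nonempty_rightDerived_comparison P G hG (liftLC i i' G h) (locConstOn i).ι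
    (locConstOn i').ι (Iso.refl _) hF
  have hbd : ∀ (K : DerivedCategory (LCOn i)) (hK : t.bounded K),
      t.bounded (G.rightDerivedFunctorPlus.obj ((mapPlus (locConstOn i).ι).obj
        ⟨K, bounded_le_plus K hK⟩)).obj := fun K hK =>
    bounded_rightDerivedFunctorPlus G hb _ (bounded_mapDerivedCategory (locConstOn i).ι K hK)
  have h₁ : RightDerivedMapsTo (liftLC i i' G h) bounded_le_plus t.bounded := by
    intro K hK
    let L := (liftLC i i' G h).rightDerivedFunctorPlus.obj ⟨K, bounded_le_plus K hK⟩
    refine ⟨L.property, ?_⟩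
    obtain ⟨-, b, hb⟩ := hbd K hK
    refine ⟨b, (isLE_iff _ _).2 fun n hn => ?_⟩
    have e₁ : (locConstOn i').ι.obj ((homologyFunctor _ n).obj L.obj) ≅
        (homologyFunctor _ n).obj (G.rightDerivedFunctorPlus.obj ((mapPlus (locConstOn i).ι).obj
          ⟨K, bounded_le_plus K hK⟩)).obj :=
      (homologyMapDerivedIso (locConstOn i').ι n L.obj).symm ≪≫
        (homologyFunctor _ n).mapIso (Plus.ι.mapIso (e.app ⟨K, bounded_le_plus K hK⟩))
    have hz := ((isLE_iff _ _).1 hb n hn).of_iso e₁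
    -- The inclusion of LC is faithful, so it reflects zero objects.
    rw [IsZero.iff_id_eq_zero] at hz ⊢
    exact (locConstOn i').ι.map_injective (by
      rw [CategoryTheory.Functor.map_id, CategoryTheory.Functor.map_zero]; exact hz)
  have h₂ : RightDerivedMapsTo G (boundedWith_le_plus (locConstOn i))
      (boundedWith (locConstOn i')) := by
    intro K hK
    let K₀ : (boundedWith (locConstOn i)).FullSubcategory := ⟨K, hK⟩
    let K' := (naturalFunctor i).objPreimage K₀
    let eK := (ObjectProperty.ιOfLE (boundedWith_le_plus (locConstOn i))).mapIso
      ((naturalFunctor i).objObjPreimageIso K₀)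
    let K'' : Plus (LCOn i) := ⟨K'.obj, bounded_le_plus _ K'.property⟩
    have e₂ : G.rightDerivedFunctorPlus.obj ((mapPlus (locConstOn i).ι).obj K'') ≅
        G.rightDerivedFunctorPlus.obj ⟨K, boundedWith_le_plus _ K hK⟩ :=
      G.rightDerivedFunctorPlus.mapIso eK
    refine ⟨t.bounded.prop_of_iso (Plus.ι.mapIso e₂) (hbd K'.obj K'.property), fun n => ?_⟩
    refine (locConstOn i').prop_of_iso ?_ ((homologyFunctor _ n).obj
      ((liftLC i i' G h).rightDerivedFunctorPlus.obj K'').obj).property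
    exact (homologyMapDerivedIso (locConstOn i').ι n _).symm ≪≫
      (homologyFunctor _ n).mapIso (Plus.ι.mapIso (e.app K'' ≪≫ e₂))
  refine ⟨h₁, h₂, ⟨?_⟩⟩
  exact ((boundedWith (locConstOn i')).fullyFaithfulι.whiskeringRight _).preimageIso
    (Functor.isoWhiskerLeft (ObjectProperty.ιOfLE bounded_le_plus)
      (Functor.isoWhiskerRight e Plus.ι) :)

end LC

/-! ### Compatibility with exact functors -/

section PullBack

open DerivedCategory DerivedCategory.TStructure Abelian

universe w₁ w₂ w₃ w₄ v₁ v₂ v₃ v₄ u₁ u₂ u₃ u₄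

/-- Isomorphic composites of exact functors induce isomorphic composites on derived categories. -/
def mapDerivedCategorySquare
    {A : Type u₁} [Category.{v₁} A] [Abelian A] [HasDerivedCategory.{w₁} A]
    {B : Type u₂} [Category.{v₂} B] [Abelian B] [HasDerivedCategory.{w₂} B]
    {B' : Type u₄} [Category.{v₄} B'] [Abelian B'] [HasDerivedCategory.{w₄} B']
    {C : Type u₃} [Category.{v₃} C] [Abelian C] [HasDerivedCategory.{w₃} C]
    (F : A ⥤ B) [F.Additive] [PreservesFiniteLimits F] [PreservesFiniteColimits F]
    (G : B ⥤ C) [G.Additive] [PreservesFiniteLimits G] [PreservesFiniteColimits G]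
    (F' : A ⥤ B') [F'.Additive] [PreservesFiniteLimits F'] [PreservesFiniteColimits F']
    (G' : B' ⥤ C) [G'.Additive] [PreservesFiniteLimits G'] [PreservesFiniteColimits G']
    (e : F ⋙ G ≅ F' ⋙ G') :
    F.mapDerivedCategory ⋙ G.mapDerivedCategory ≅ F'.mapDerivedCategory ⋙ G'.mapDerivedCategory :=
  let l : Localization.Lifting Q (HomologicalComplex.quasiIso A (.up ℤ))
      (F.mapHomologicalComplex (.up ℤ) ⋙ G.mapHomologicalComplex (.up ℤ) ⋙ Q)
      (F.mapDerivedCategory ⋙ G.mapDerivedCategory) :=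
    ⟨(Functor.isoWhiskerRight F.mapDerivedCategoryFactors G.mapDerivedCategory :) ≪≫
      (Functor.isoWhiskerLeft (F.mapHomologicalComplex (.up ℤ)) G.mapDerivedCategoryFactors :)⟩
  let l' : Localization.Lifting Q (HomologicalComplex.quasiIso A (.up ℤ))
      (F'.mapHomologicalComplex (.up ℤ) ⋙ G'.mapHomologicalComplex (.up ℤ) ⋙ Q)
      (F'.mapDerivedCategory ⋙ G'.mapDerivedCategory) :=
    ⟨(Functor.isoWhiskerRight F'.mapDerivedCategoryFactors G'.mapDerivedCategory :) ≪≫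
      (Functor.isoWhiskerLeft (F'.mapHomologicalComplex (.up ℤ)) G'.mapDerivedCategoryFactors :)⟩
  Localization.liftNatIso Q (HomologicalComplex.quasiIso A (.up ℤ))
    (F.mapHomologicalComplex (.up ℤ) ⋙ G.mapHomologicalComplex (.up ℤ) ⋙ Q)
    (F'.mapHomologicalComplex (.up ℤ) ⋙ G'.mapHomologicalComplex (.up ℤ) ⋙ Q) _ _
    (Functor.isoWhiskerRight (NatIso.mapHomologicalComplex e (.up ℤ)) Q :)

variable {Y Z : TopCat.{0}} {A A' : Type} {O : A → TopCat.{0}} {O' : A' → TopCat.{0}}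
  (i : ∀ a, O a ⟶ Y) (i' : ∀ b, O' b ⟶ Z)
  [∀ a, LocallyConnectedSpace (O a)] [∀ b, LocallyConnectedSpace (O' b)]
  [HasDerivedCategory.{w} (LCOn i)] [HasDerivedCategory.{w} (Sh Y)]
  [HasDerivedCategory.{w} (LCOn i')] [HasDerivedCategory.{w} (Sh Z)]

/-- The natural functors commute with exact functors. -/
def naturalFunctorSquare (G : Sh Y ⥤ Sh Z) [G.Additive]
    [PreservesFiniteLimits G] [PreservesFiniteColimits G]
    (h : ∀ F, locConstOn i F → locConstOn i' (G.obj F)) :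
    mapBounded (liftLC i i' G h) ⋙ naturalFunctor i' ≅
      naturalFunctor i ⋙ mapBoundedWith G (locConstOn i) (locConstOn i') h :=
  ((boundedWith (locConstOn i')).fullyFaithfulι.whiskeringRight _).preimageIso
    (Functor.isoWhiskerLeft Bounded.ι (mapDerivedCategorySquare (liftLC i i' G h)
      (locConstOn i').ι (locConstOn i).ι G (Iso.refl _)) :)

end PullBack

end

end Toric

namespace Toric

noncomputable section

/-! ### Sections, germs and morphisms of sheaves -/

section Sections

variable {Y : TopCat.{0}}

/-- The vector space of sections of `F` over `V`. -/
abbrev Sec (F : Sh Y) (V : Opens Y) : Type := F.presheaf.obj (.op V)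

/-- The stalk of `F` at `z`. -/
abbrev Stk (F : Sh Y) (z : Y) : Type := F.presheaf.stalk z

/-- Restriction of sections. -/
def rs (F : Sh Y) {U V : Opens Y} (h : V ≤ U) : Sec F U →ₗ[ℂ] Sec F V :=
  (F.presheaf.map (homOfLE h).op).hom

/-- The germ of a section. -/
def gm (F : Sh Y) {V : Opens Y} (z : Y) (hz : z ∈ V) : Sec F V →ₗ[ℂ] Stk F z :=
  (F.presheaf.germ V z hz).hom

/-- The map on sections induced by a morphism of sheaves. -/
def sm {F G : Sh Y} (f : F ⟶ G) (V : Opens Y) : Sec F V →ₗ[ℂ] Sec G V := (f.1.app (.op V)).hom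

/-- The map on stalks induced by a morphism of sheaves. -/
def km {F G : Sh Y} (f : F ⟶ G) (z : Y) : Stk F z →ₗ[ℂ] Stk G z := ((stalkF z).map f).hom

lemma gm_rs (F : Sh Y) {U V : Opens Y} (h : V ≤ U) (z : Y) (hz : z ∈ V) (s : Sec F U) :
    gm F z hz (rs F h s) = gm F z (h hz) s :=
  F.presheaf.germ_res_apply (homOfLE h) z hz s

lemma rs_rs (F : Sh Y) {U V W : Opens Y} (h : V ≤ U) (h' : W ≤ V) (s : Sec F U) :
    rs F h' (rs F h s) = rs F (h'.trans h) s :=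
  (ConcreteCategory.congr_hom (F.presheaf.map_comp (homOfLE h).op (homOfLE h').op) s).symm

lemma sm_rs {F G : Sh Y} (f : F ⟶ G) {U V : Opens Y} (h : V ≤ U) (s : Sec F U) :
    sm f V (rs F h s) = rs G h (sm f U s) :=
  ConcreteCategory.congr_hom (f.1.naturality (homOfLE h).op) s

lemma km_gm {F G : Sh Y} (f : F ⟶ G) {V : Opens Y} (z : Y) (hz : z ∈ V) (s : Sec F V) :
    km f z (gm F z hz s) = gm G z hz (sm f V s) :=
  ConcreteCategory.congr_hom (TopCat.Presheaf.stalkFunctor_map_germ V z hz f.1) s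

lemma sm_comp {F G H : Sh Y} (f : F ⟶ G) (g : G ⟶ H) (V : Opens Y) (s : Sec F V) :
    sm (f ≫ g) V s = sm g V (sm f V s) := rfl

lemma sm_zero (F G : Sh Y) (V : Opens Y) (s : Sec F V) : sm (0 : F ⟶ G) V s = 0 := rfl

lemma km_comp {F G H : Sh Y} (f : F ⟶ G) (g : G ⟶ H) (z : Y) (s : Stk F z) :
    km (f ≫ g) z s = km g z (km f z s) :=
  ConcreteCategory.congr_hom ((stalkF z).map_comp f g) s

lemma sm_hom_ext {F G : Sh Y} {f g : F ⟶ G} (h : ∀ V s, sm f V s = sm g V s) : f = g := by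
  apply Sheaf.hom_ext
  ext V s
  exact h V.unop s

lemma sec_ext (F : Sh Y) {V : Opens Y} {s t : Sec F V}
    (h : ∀ z (hz : z ∈ V), gm F z hz s = gm F z hz t) :
    s = t :=
  TopCat.Presheaf.section_ext F V s t h

lemma exists_rs_eq_of_gm_eq (F : Sh Y) {U V : Opens Y} {z : Y} {hU : z ∈ U} {hV : z ∈ V}
    {s : Sec F U} {t : Sec F V} (h : gm F z hU s = gm F z hV t) :
    ∃ (W : Opens Y) (_ : z ∈ W) (h₁ : W ≤ U) (h₂ : W ≤ V), rs F h₁ s = rs F h₂ t := by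
  obtain ⟨W, hz, i, j, h⟩ := F.presheaf.germ_eq z hU hV s t h
  exact ⟨W, hz, i.le, j.le, h⟩

lemma exists_gm_eq (F : Sh Y) {z : Y} (t : Stk F z) {V : Opens Y} (hV : z ∈ V) :
    ∃ (U : Opens Y) (_ : U ≤ V) (hz : z ∈ U) (s : Sec F U), gm F z hz s = t := by
  obtain ⟨U, hU, hz, s, h⟩ := F.presheaf.exists_le_germ_eq t hV
  exact ⟨U, hU, hz, s, h⟩

/-- The set of points where two sections have the same germ is open. -/
lemma isOpen_gm_eq (F : Sh Y) {U V : Opens Y} (s : Sec F U) (t : Sec F V) :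
    IsOpen {z | ∃ (hU : z ∈ U) (hV : z ∈ V), gm F z hU s = gm F z hV t} := by
  rw [isOpen_iff_forall_mem_open]
  rintro z ⟨hU, hV, h⟩
  obtain ⟨W, hz, h₁, h₂, h⟩ := exists_rs_eq_of_gm_eq F h
  refine ⟨W, fun y hy => ⟨h₁ hy, h₂ hy, ?_⟩, W.2, hz⟩
  rw [← gm_rs F h₁ y hy, h, gm_rs]

/-- A family of germs that is locally given by sections is given by a section. -/
lemma exists_gm_eq_of_local (F : Sh Y) (V : Opens Y) (g : ∀ z, z ∈ V → Stk F z)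
    (h : ∀ z ∈ V, ∃ (U : Opens Y) (_ : z ∈ U) (s : Sec F U), ∀ y (hy : y ∈ U) (hy' : y ∈ V),
      gm F y hy s = g y hy') : ∃ s : Sec F V, ∀ z hz, gm F z hz s = g z hz := by
  have h' : ∀ z : V, ∃ (U : Opens Y) (_ : z.1 ∈ U) (hU : U ≤ V) (s : Sec F U),
      ∀ y (hy : y ∈ U), gm F y hy s = g y (hU hy) := by
    intro z
    obtain ⟨U, hz, s, hs⟩ := h z.1 z.2
    refine ⟨U ⊓ V, ⟨hz, z.2⟩, inf_le_right, rs F inf_le_left s, fun y hy => ?_⟩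
    rw [gm_rs, hs y hy.1 hy.2]
  choose U hzU hUV s hs using h'
  obtain ⟨t, ht, -⟩ := F.existsUnique_gluing' U V (fun z => homOfLE (hUV z))
    (fun z hz => Opens.mem_iSup.2 ⟨⟨z, hz⟩, hzU _⟩) s (fun i j => by
      refine sec_ext F fun y hy => ?_
      have h₁ := gm_rs F (inf_le_left : U i ⊓ U j ≤ U i) y hy (s i)
      have h₂ := gm_rs F (inf_le_right : U i ⊓ U j ≤ U j) y hy (s j)
      rw [hs] at h₁ h₂
      exact h₁.trans h₂.symm)
  refine ⟨t, fun z hz => ?_⟩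
  rw [← gm_rs F (hUV ⟨z, hz⟩) z (hzU ⟨z, hz⟩), ← hs ⟨z, hz⟩ z (hzU ⟨z, hz⟩)]
  exact congrArg _ (ht ⟨z, hz⟩)

/-- A morphism of sheaves is given by linear maps of stalks that are locally compatible with
sections. -/
lemma exists_hom_of_stalks {F G : Sh Y} (θ : ∀ z, Stk F z →ₗ[ℂ] Stk G z)
    (h : ∀ (V : Opens Y) (s : Sec F V), ∀ z ∈ V, ∃ (U : Opens Y) (_ : z ∈ U) (t : Sec G U),
      ∀ y (hy : y ∈ U) (hy' : y ∈ V), gm G y hy t = θ y (gm F y hy' s)) :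
    ∃ f : F ⟶ G, ∀ z, km f z = θ z := by
  have h' : ∀ (V : Opens Y) (s : Sec F V), ∃ t : Sec G V, ∀ z hz, gm G z hz t = θ z (gm F z hz s) :=
    fun V s => exists_gm_eq_of_local G V _ (h V s)
  choose t ht using h'
  let f : F ⟶ G := ⟨
    { app := fun V => ModuleCat.ofHom
        { toFun := t V.unop
          map_add' := fun a b => sec_ext G fun z hz => by simp [ht]
          map_smul' := fun c a => sec_ext G fun z hz => by simp [ht] }
      naturality := fun V V' i => by
        ext s
        refine sec_ext G fun z hz => ?_
        have h₁ := ht V'.unop (rs F i.unop.le s) z hz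
        rw [gm_rs, ← ht, ← gm_rs G i.unop.le] at h₁
        exact h₁ }⟩
  refine ⟨f, fun z => LinearMap.ext fun x => ?_⟩
  obtain ⟨U, -, hz, s, rfl⟩ := exists_gm_eq F x (V := ⊤) trivial
  rw [km_gm, ← ht U s z hz]
  rfl

lemma km_hom_ext {F G : Sh Y} {f g : F ⟶ G} (h : ∀ z s, km f z s = km g z s) : f = g :=
  sm_hom_ext fun V s => sec_ext G fun z hz => by rw [← km_gm, h, km_gm]

lemma mono_of_km_injective {F G : Sh Y} (f : F ⟶ G) (h : ∀ z, Function.Injective (km f z)) :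
    Mono f :=
  ⟨fun a b hab => km_hom_ext fun z s => h z (by rw [← km_comp, hab, km_comp])⟩

lemma sm_injective {F G : Sh Y} (f : F ⟶ G) [Mono f] (V : Opens Y) :
    Function.Injective (sm f V) :=
  (ModuleCat.mono_iff_injective ((sectionsFunctor V).map f)).1 inferInstance

lemma km_surjective {F G : Sh Y} (f : F ⟶ G) [Epi f] (z : Y) : Function.Surjective (km f z) :=
  (ModuleCat.epi_iff_surjective ((stalkF z).map f)).1 inferInstance

lemma epi_of_km_surjective {F G : Sh Y} (f : F ⟶ G) (h : ∀ z, Function.Surjective (km f z)) :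
    Epi f :=
  ⟨fun a b hab => km_hom_ext fun z s => by
    obtain ⟨s, rfl⟩ := h z s
    rw [← km_comp, hab, km_comp]⟩

lemma epi_of_locally_surjective {F G : Sh Y} (f : F ⟶ G)
    (h : ∀ z (U : Opens Y), z ∈ U → ∃ V : Opens Y, z ∈ V ∧ V ≤ U ∧ Function.Surjective (sm f V)) :
    Epi f := by
  refine epi_of_km_surjective f fun z t => ?_
  obtain ⟨U, -, hz, s, rfl⟩ := exists_gm_eq G t (V := ⊤) trivial
  obtain ⟨V, hzV, hVU, hV⟩ := h z U hz
  obtain ⟨r, hr⟩ := hV (rs G hVU s)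
  exact ⟨gm F z hzV r, by rw [km_gm, hr, gm_rs]⟩

lemma exists_sm_eq_of_exact {S : ShortComplex (Sh Y)} (hS : S.Exact) [Mono S.f] (V : Opens Y)
    (s : Sec S.X₂ V) (hs : sm S.g V s = 0) : ∃ r : Sec S.X₁ V, sm S.f V r = s := by
  have := hS.map_of_mono_of_preservesKernel (sectionsFunctor V) inferInstance inferInstance
  exact (ShortComplex.moduleCat_exact_iff _).1 this s hs

lemma exact_of_stalks {S : ShortComplex (Sh Y)}
    (h : ∀ z (s : Stk S.X₂ z), km S.g z s = 0 → ∃ r : Stk S.X₁ z, km S.f z r = s) : S.Exact :=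
  (TopCat.Sheaf.exact_iff_stalkFunctor_map_exact S).2 fun z =>
    (ShortComplex.moduleCat_exact_iff _).2 (h z)

end Sections

/-! ### Stalks of inverse images -/

section Pull

variable {Z Y : TopCat.{0}} (f : Z ⟶ Y)

/-- The unit of the adjunction between inverse and direct images. -/
def pullUnit (F : Sh Y) : F ⟶ (push f).obj ((pull f).obj F) :=
  (TopCat.Sheaf.pullbackPushforwardAdjunction (ModuleCat.{0} ℂ) f).unit.app F

/-- The inverse image of a section. -/
def psec (F : Sh Y) (V : Opens Y) : Sec F V →ₗ[ℂ] Sec ((pull f).obj F) ((Opens.map f).obj V) :=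
  sm (pullUnit f F) V

/-- The map between the stalks of a sheaf and of its inverse image. -/
def pstkHom (F : Sh Y) (z : Z) :
    F.presheaf.stalk (f z) ⟶ ((pull f).obj F).presheaf.stalk z :=
  (stalkF (f z)).map (pullUnit f F) ≫
    TopCat.Presheaf.stalkPushforward _ f ((pull f).obj F).presheaf z

/-- The inverse image is the sheafification of the presheaf pullback. The latter has the expected
stalks and sheafification does not change stalks; that the resulting isomorphism is this particular
map is verified on germs, by comparing the units of the adjunctions. -/
instance (F : Sh Y) (z : Z) : IsIso (pstkHom f F z) := by
  let adj := TopCat.Sheaf.pullbackPushforwardAdjunction (ModuleCat.{0} ℂ) f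
  let adj' := Functor.sheafPullbackConstruction.sheafAdjunctionContinuous (Opens.map f)
    (ModuleCat.{0} ℂ) (Opens.grothendieckTopology Y) (Opens.grothendieckTopology Z)
  let e := TopCat.Sheaf.pullbackIso (ModuleCat.{0} ℂ) f
  have h₁ : adj.unit.app F ≫ (push f).map (e.hom.app F) = adj'.unit.app F :=
    Adjunction.unit_leftAdjointUniq_hom_app adj adj' F
  let P := (TopCat.Presheaf.pullback (ModuleCat.{0} ℂ) f).obj F.presheaf
  let T := CategoryTheory.toSheafify (Opens.grothendieckTopology Z) P
  have h₂ : (adj'.unit.app F).1 =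
      (TopCat.Presheaf.pullbackPushforwardAdjunction (ModuleCat.{0} ℂ) f).unit.app F.presheaf ≫
        (TopCat.Presheaf.pushforward _ f).map T := by
    have := Adjunction.map_restrictFullyFaithful_unit_app
      (L := Functor.sheafPullbackConstruction.sheafPullback (Opens.map f)
        (ModuleCat.{0} ℂ) (Opens.grothendieckTopology Y) (Opens.grothendieckTopology Z))
      (R := (Opens.map f).sheafPushforwardContinuous
        (ModuleCat.{0} ℂ) (Opens.grothendieckTopology Y) (Opens.grothendieckTopology Z))
      (((Opens.map f).op.lanAdjunction (ModuleCat.{0} ℂ)).comp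
        (sheafificationAdjunction (Opens.grothendieckTopology Z) (ModuleCat.{0} ℂ)))
      (fullyFaithfulSheafToPresheaf (Opens.grothendieckTopology Y) (ModuleCat.{0} ℂ))
      (Functor.FullyFaithful.id _)
      (Iso.refl _) (Iso.refl _) F
    refine this.trans ?_
    refine Eq.trans ?_ (Adjunction.comp_unit_app ((Opens.map f).op.lanAdjunction (ModuleCat.{0} ℂ))
      (sheafificationAdjunction (Opens.grothendieckTopology Z) (ModuleCat.{0} ℂ)) F.presheaf)
    apply NatTrans.ext
    funext V
    apply ModuleCat.hom_ext
    ext s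
    rfl
  have h₃ : ∀ V : Opens Y, (adj.unit.app F).1.app (.op V) ≫
      (e.hom.app F).1.app (.op ((Opens.map f).obj V)) =
      ((TopCat.Presheaf.pullbackPushforwardAdjunction (ModuleCat.{0} ℂ) f).unit.app
        F.presheaf).app (.op V) ≫ T.app (.op ((Opens.map f).obj V)) := fun V =>
    congrArg (fun g => g.app (.op V)) ((congrArg (fun g => g.1) h₁).trans h₂)
  have h₄ : pstkHom f F z ≫ (stalkF z).map (e.hom.app F) =
      TopCat.Presheaf.stalkPullbackHom _ f F.presheaf z ≫
        (TopCat.Presheaf.stalkFunctor _ z).map T := by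
    refine TopCat.Presheaf.stalk_hom_ext _ fun V hV => ?_
    have a₁ : F.presheaf.germ V (f z) hV ≫ pstkHom f F z = (adj.unit.app F).1.app (.op V) ≫
        ((pull f).obj F).presheaf.germ ((Opens.map f).obj V) z hV := by
      have b₁ := TopCat.Presheaf.stalkFunctor_map_germ V (f z) hV (adj.unit.app F).1
      have b₂ := TopCat.Presheaf.stalkPushforward_germ (ModuleCat.{0} ℂ) f
        ((pull f).obj F).presheaf V z hV
      exact ((Category.assoc _ _ _).symm.trans (congrArg (· ≫ _) b₁)).trans
        ((Category.assoc _ _ _).trans (congrArg (_ ≫ ·) b₂))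
    have a₂ := TopCat.Presheaf.stalkFunctor_map_germ ((Opens.map f).obj V) z hV (e.hom.app F).1
    have a₃ := TopCat.Presheaf.stalkFunctor_map_germ ((Opens.map f).obj V) z hV T
    have a₄ := TopCat.Presheaf.germ_stalkPullbackHom (ModuleCat.{0} ℂ) f F.presheaf z V hV
    refine ((Category.assoc _ _ _).symm.trans (congrArg (· ≫ _) a₁)).trans
      ((Category.assoc _ _ _).trans ((congrArg (_ ≫ ·) a₂).trans ?_))
    refine Eq.trans ?_ ((Category.assoc _ _ _).symm.trans (congrArg (· ≫ _) a₄)).symm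
    refine Eq.trans ?_ ((Category.assoc _ _ _).trans (congrArg (_ ≫ ·) a₃)).symm
    exact (Category.assoc _ _ _).symm.trans ((congrArg (· ≫ _) (h₃ V)).trans (Category.assoc _ _ _))
  have i₁ : IsIso (TopCat.Presheaf.stalkPullbackHom (ModuleCat.{0} ℂ) f F.presheaf z) :=
    inferInstanceAs (IsIso (TopCat.Presheaf.stalkPullbackIso _ f F.presheaf z).hom)
  have i₂ : IsIso ((TopCat.Presheaf.stalkFunctor (ModuleCat.{0} ℂ) z).map T) :=
    TopCat.Presheaf.stalkFunctor_map_unit_toSheafify_isIso z (ModuleCat.{0} ℂ) P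
  have i₃ : IsIso (pstkHom f F z ≫ (stalkF z).map (e.hom.app F)) := by
    rw [h₄]; exact IsIso.comp_isIso' i₁ i₂
  have i₄ : IsIso (e.hom.app F) := inferInstance
  have i₅ : IsIso ((stalkF z).map (e.hom.app F)) := Functor.map_isIso _ _
  exact @IsIso.of_isIso_comp_right _ _ _ _ _ (pstkHom f F z) ((stalkF z).map (e.hom.app F)) i₅ i₃

/-- The isomorphism between the stalks of a sheaf and of its inverse image. -/
def pstk (F : Sh Y) (z : Z) : Stk F (f z) ≃ₗ[ℂ] Stk ((pull f).obj F) z :=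
  (asIso (pstkHom f F z)).toLinearEquiv

lemma pstk_gm (F : Sh Y) (z : Z) {V : Opens Y} (hz : f z ∈ V) (s : Sec F V) :
    pstk f F z (gm F (f z) hz s) = gm ((pull f).obj F) z (V := (Opens.map f).obj V) hz
      (psec f F V s) := by
  have h₁ := ConcreteCategory.congr_hom
    (TopCat.Presheaf.stalkPushforward_germ (ModuleCat.{0} ℂ) f ((pull f).obj F).presheaf V z hz)
    (psec f F V s)
  refine Eq.trans ?_ h₁
  have h₂ := km_gm (pullUnit f F) (f z) hz s
  exact congrArg (TopCat.Presheaf.stalkPushforward _ f ((pull f).obj F).presheaf z) h₂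

end Pull

end

end Toric

namespace Toric

noncomputable section

/-! ### Sheaves representing sections -/

section Free

variable {Y : TopCat.{0}}

/-- The presheaf freely generated by a section over `V`. -/
abbrev freePresheaf (V : Opens Y) : TopCat.Presheaf (ModuleCat.{0} ℂ) Y :=
  yoneda.obj V ⋙ ModuleCat.free ℂ

/-- The sheaf freely generated by a section over `V`, i.e. the extension by zero of the constant
sheaf with fibre `ℂ` on `V`. -/
def freeSh (V : Opens Y) : Sh Y :=
  (presheafToSheaf (Opens.grothendieckTopology Y) (ModuleCat.{0} ℂ)).obj (freePresheaf V)

/-- The map `freeSh V ⟶ freeSh U` for `V ≤ U`. -/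
def freeMap {U V : Opens Y} (h : V ≤ U) : freeSh V ⟶ freeSh U :=
  (presheafToSheaf (Opens.grothendieckTopology Y) (ModuleCat.{0} ℂ)).map
    (Functor.whiskerRight (yoneda.map (homOfLE h)) (ModuleCat.free ℂ))

/-- The canonical section of `freeSh V` over `V`. -/
def freeGen (V : Opens Y) : Sec (freeSh V) V :=
  (toSheafify (Opens.grothendieckTopology Y) (freePresheaf V)).app (.op V)
    (ModuleCat.freeMk (𝟙 V))

/-- The composite of the adjunctions for sheafification and for free modules with the Yoneda lemma:
`freeSh V` represents sections over `V`. -/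
lemma freeHom_bijective (V : Opens Y) (F : Sh Y) :
    Function.Bijective (fun φ : freeSh V ⟶ F => sm φ V (freeGen V)) := by
  let e₁ := (sheafificationAdjunction (Opens.grothendieckTopology Y) (ModuleCat.{0} ℂ)).homEquiv
    (freePresheaf V) F
  let e₂ := ((ModuleCat.adj ℂ).whiskerRight (Opens Y)ᵒᵖ).homEquiv (yoneda.obj V) F.presheaf
  have : (fun φ : freeSh V ⟶ F => sm φ V (freeGen V)) =
      (yonedaEquiv (X := V) (F := F.presheaf ⋙ forget (ModuleCat.{0} ℂ))) ∘ e₂ ∘ e₁ := by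
    funext φ
    rfl
  rw [this]
  exact (Equiv.bijective _).comp ((Equiv.bijective _).comp (Equiv.bijective _))

lemma freeMap_gen {U V : Opens Y} (h : V ≤ U) :
    sm (freeMap h) V (freeGen V) = rs (freeSh U) h (freeGen U) := by
  let η := Functor.whiskerRight (yoneda.map (homOfLE h)) (ModuleCat.free ℂ)
  have h₁ := ConcreteCategory.congr_hom (congrArg (fun f => f.app (.op V))
    (toSheafify_naturality (Opens.grothendieckTopology Y) η)) (ModuleCat.freeMk (𝟙 V))
  have h₂ := ConcreteCategory.congr_hom
    ((toSheafify (Opens.grothendieckTopology Y) (freePresheaf U)).naturality (homOfLE h).op)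
    (ModuleCat.freeMk (𝟙 U))
  refine h₁.symm.trans (Eq.trans ?_ h₂)
  refine congrArg ((toSheafify (Opens.grothendieckTopology Y) (freePresheaf U)).app (.op V)) ?_
  refine (ModuleCat.free_map_apply _ _).trans (Eq.trans ?_ (ModuleCat.free_map_apply _ _).symm)
  rfl

/-- Injectivity holds on basis elements, hence for free modules, and sheafification preserves it.
This is why injective sheaves are flasque. -/
instance mono_freeMap {U V : Opens Y} (h : V ≤ U) : Mono (freeMap h) := by
  have : Mono (Functor.whiskerRight (yoneda.map (homOfLE h)) (ModuleCat.free ℂ)) := by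
    have : ∀ W, Mono ((Functor.whiskerRight (yoneda.map (homOfLE h)) (ModuleCat.free ℂ)).app W) := by
      intro W
      rw [ModuleCat.mono_iff_injective]
      refine Finsupp.mapDomain_injective ?_
      intro a b _
      exact Subsingleton.elim (α := (W.unop ⟶ V)) a b
    exact NatTrans.mono_of_mono_app _
  exact inferInstanceAs (Mono ((presheafToSheaf _ _).map _))

/-- Sections of injective sheaves extend to larger open subsets. -/
lemma rs_surjective_of_injective (J : Sh Y) [Injective J] {U V : Opens Y} (h : V ≤ U) :
    Function.Surjective (rs J h) := by
  intro s
  obtain ⟨φ, rfl⟩ := (freeHom_bijective V J).2 s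
  refine ⟨sm (Injective.factorThru φ (freeMap h)) U (freeGen U), ?_⟩
  rw [← sm_rs, ← freeMap_gen, ← sm_comp, Injective.comp_factorThru]

end Free

/-! ### Lifting and dimension shifting -/

section Ext

open Abelian

universe w₃ v₁ u₁

variable {B : Type u₁} [Category.{v₁} B] [Abelian B] [HasExt.{w₃} B]

/-- The obstruction to lifting `ψ` lies in the group that is assumed to vanish. -/
lemma exists_lift_of_ext_subsingleton {P : B} {S : ShortComplex B} (hS : S.ShortExact)
    [Subsingleton (Ext.{w₃} P S.X₁ 1)] (ψ : P ⟶ S.X₃) : ∃ φ, φ ≫ S.g = ψ := by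
  obtain ⟨x, hx⟩ := Ext.covariant_sequence_exact₃ P hS (Ext.mk₀ ψ) (zero_add 1)
    (Subsingleton.elim _ _)
  obtain ⟨φ, rfl⟩ := Ext.homEquiv₀.symm.surjective x
  refine ⟨φ, Ext.homEquiv₀.symm.injective ?_⟩
  simpa using hx

/-- Dimension shifting. -/
lemma ext_subsingleton_of_cosyzygies (P : B) (C : ObjectProperty B)
    (h : ∀ G, C G → ∃ (I Q : B) (f : G ⟶ I) (g : I ⟶ Q) (w : f ≫ g = 0),
      (ShortComplex.mk f g w).ShortExact ∧ Injective I ∧ C Q ∧ ∀ ψ : P ⟶ Q, ∃ φ, φ ≫ g = ψ)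
    (G : B) (hG : C G) (n : ℕ) : Subsingleton (Ext.{w₃} P G (n + 1)) := by
  induction n generalizing G with
  | zero =>
    obtain ⟨I, Q, f, g, w, hS, hI, hQ, hl⟩ := h G hG
    refine subsingleton_of_forall_eq 0 fun x => ?_
    have : Subsingleton (Ext P I (0 + 1)) := Ext.subsingleton_of_injective _ _ _
    obtain ⟨y, hy⟩ := Ext.covariant_sequence_exact₁ P hS x (Subsingleton.elim _ _) rfl
    obtain ⟨ψ, rfl⟩ := Ext.homEquiv₀.symm.surjective y
    -- The given class is the image of `ψ` under the connecting map, which kills it because `ψ`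
    -- lifts to `I`.
    obtain ⟨φ, rfl⟩ := hl ψ
    rw [← hy, Ext.homEquiv₀_symm_apply, ← Ext.mk₀_comp_mk₀,
      Ext.comp_assoc (a₁₂ := 0) (a₂₃ := 1) (h₁₂ := by simp) (h₂₃ := by simp) (h := by simp),
      hS.comp_extClass, Ext.comp_zero]
  | succ n ih =>
    obtain ⟨I, Q, f, g, w, hS, hI, hQ, hl⟩ := h G hG
    refine subsingleton_of_forall_eq 0 fun x => ?_
    have : Subsingleton (Ext P I (n + 1 + 1)) := Ext.subsingleton_of_injective _ _ _
    obtain ⟨y, hy⟩ := Ext.covariant_sequence_exact₁ P hS x (Subsingleton.elim _ _) rfl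
    have : Subsingleton (Ext P (ShortComplex.mk f g w).X₃ (n + 1)) := ih Q hQ
    rw [← hy, Subsingleton.elim y 0, Ext.zero_comp]

end Ext

/-! ### Local constancy along a map -/

section LocConstAlong

variable {Z Y : TopCat.{0}}

/-- Transport of stalks along an equality of points. -/
def castStk (F : Sh Y) {x y : Y} (h : x = y) : Stk F x ≃ₗ[ℂ] Stk F y := h ▸ LinearEquiv.refl _ _

lemma castStk_gm (F : Sh Y) {x y : Y} (h : x = y) {V : Opens Y} (hx : x ∈ V) (s : Sec F V) :
    castStk F h (gm F x hx s) = gm F y (h ▸ hx) s := by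
  subst h
  rfl

/-- The inverse image of `F` along `f` is locally constant, expressed by means of the germs
of sections of `F`. -/
def LocConstAlong (f : Z ⟶ Y) (F : Sh Y) : Prop :=
  ∀ z : Z, ∃ N : Opens Z, z ∈ N ∧ ∃ (A : ModuleCat.{0} ℂ) (θ : ∀ y, y ∈ N → A →ₗ[ℂ] Stk F (f y)),
    (∀ y hy, Function.Bijective (θ y hy)) ∧ ∀ (a : A), ∀ y ∈ N, ∃ (V : Opens Y) (_ : f y ∈ V)
      (s : Sec F V) (N' : Opens Z), y ∈ N' ∧ ∀ y' (_ : y' ∈ N') (h : y' ∈ N) (hV : f y' ∈ V),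
        θ y' h a = gm F (f y') hV s

/-- The stalks of the inverse image are those of `F`, and a family of germs is a section of the
inverse image if and only if it is locally given by sections of `F`. -/
lemma isLocallyConstantSheaf_pull_iff (f : Z ⟶ Y) (F : Sh Y) :
    IsLocallyConstantSheaf ((pull f).obj F) ↔ LocConstAlong f F := by
  constructor
  · intro h z
    obtain ⟨U, hz, A, φ, hφ⟩ := h z
    refine ⟨U, hz, A, fun y hy => (pstk f F y).symm.toLinearMap ∘ₗ gm _ y hy ∘ₗ φ.hom, ?_, ?_⟩
    · intro y hy
      have := hφ y hy
      exact (pstk f F y).symm.bijective.comp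
        (ConcreteCategory.bijective_of_isIso (φ ≫ ((pull f).obj F).presheaf.germ U y hy))
    · intro a y hy
      obtain ⟨V, -, hV, s, hs⟩ := exists_gm_eq F ((pstk f F y).symm (gm _ y hy (φ.hom a)))
        (V := ⊤) trivial
      have h₁ : gm ((pull f).obj F) y (V := (Opens.map f).obj V) hV (psec f F V s) =
          gm _ y hy (φ.hom a) := by
        rw [← pstk_gm, hs, LinearEquiv.apply_symm_apply]
      refine ⟨V, hV, s, ⟨_, isOpen_gm_eq _ (psec f F V s) (φ.hom a)⟩, ⟨hV, hy, h₁⟩, ?_⟩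
      rintro y' ⟨a₁, a₂, h'⟩ h₂ h₃
      change (pstk f F y').symm (gm _ y' h₂ (φ.hom a)) = _
      rw [LinearEquiv.symm_apply_eq, pstk_gm]
      exact h'.symm
  · intro h z
    obtain ⟨N, hz, A, θ, hθ, hθ'⟩ := h z
    have h₁ : ∀ a : A, ∃ t : Sec ((pull f).obj F) N, ∀ y hy, gm _ y hy t = pstk f F y (θ y hy a) := by
      intro a
      refine exists_gm_eq_of_local _ N _ fun y hy => ?_
      obtain ⟨V, hV, s, N', hy', h'⟩ := hθ' a y hy
      refine ⟨N' ⊓ (Opens.map f).obj V, ⟨hy', hV⟩, rs _ inf_le_right (psec f F V s), ?_⟩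
      intro x hx hx'
      rw [gm_rs, h' x hx.1 hx' hx.2]
      exact (pstk_gm f F x hx.2 s).symm
    choose t ht using h₁
    refine ⟨N, hz, A, ModuleCat.ofHom
      { toFun := t
        map_add' := fun a b => sec_ext _ fun y hy => by simp [ht]
        map_smul' := fun c a => sec_ext _ fun y hy => by simp [ht] }, fun y hy => ?_⟩
    refine (ConcreteCategory.isIso_iff_bijective _).2 ?_
    have : (fun a => gm ((pull f).obj F) y hy (t a)) = pstk f F y ∘ θ y hy := by
      funext a
      exact ht a y hy
    exact (this ▸ (pstk f F y).bijective.comp (hθ y hy) :)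

/-- Local constancy along `i` is inherited by maps that factor locally through `i`. -/
lemma LocConstAlong.of_factor {O : TopCat.{0}} {i : O ⟶ Y} {F : Sh Y} (h : LocConstAlong i F)
    (q : Z ⟶ Y) (ρ : Z → O) (z : Z) (N₀ : Opens Z) (hz : z ∈ N₀) (hρ : ContinuousOn ρ N₀)
    (hi : ∀ y ∈ N₀, i (ρ y) = q y) :
    ∃ N : Opens Z, z ∈ N ∧ ∃ (A : ModuleCat.{0} ℂ) (θ : ∀ y, y ∈ N → A →ₗ[ℂ] Stk F (q y)),
    (∀ y hy, Function.Bijective (θ y hy)) ∧ ∀ (a : A), ∀ y ∈ N, ∃ (V : Opens Y) (_ : q y ∈ V)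
      (s : Sec F V) (N' : Opens Z), y ∈ N' ∧ ∀ y' (_ : y' ∈ N') (h : y' ∈ N) (hV : q y' ∈ V),
        θ y' h a = gm F (q y') hV s := by
  obtain ⟨N, hzN, A, θ, hθ, hθ'⟩ := h (ρ z)
  refine ⟨⟨N₀ ∩ ρ ⁻¹' N, hρ.isOpen_inter_preimage N₀.2 N.2⟩, ⟨hz, hzN⟩, A,
    fun y hy => (castStk F (hi y hy.1)).toLinearMap ∘ₗ θ (ρ y) hy.2, fun y hy =>
      (castStk F (hi y hy.1)).bijective.comp (hθ _ _), fun a y hy => ?_⟩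
  obtain ⟨V, hV, s, N', hy', h'⟩ := hθ' a (ρ y) hy.2
  refine ⟨V, hi y hy.1 ▸ hV, s, ⟨N₀ ∩ ρ ⁻¹' N', hρ.isOpen_inter_preimage N₀.2 N'.2⟩,
    ⟨hy.1, hy'⟩, fun x hx hx' hxV => ?_⟩
  have hxV' : i (ρ x) ∈ V := by rw [hi x hx.1]; exact hxV
  have := h' (ρ x) hx.2 hx'.2 hxV'
  change castStk F _ (θ (ρ x) _ a) = _
  rw [this, castStk_gm]

/-- A criterion for local constancy along a subspace. -/
lemma locConstAlong_of_bijective {O : TopCat.{0}} (i : O ⟶ Y) (F : Sh Y)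
    (h : ∀ x : O, ∃ W : Opens Y, i x ∈ W ∧ ∀ y (hy : i y ∈ W), Function.Bijective (gm F (i y) hy)) :
    LocConstAlong i F := by
  intro x
  obtain ⟨W, hW, h⟩ := h x
  exact ⟨(Opens.map i).obj W, hW, F.presheaf.obj (.op W), fun y hy => gm F (i y) hy, h,
    fun a y hy => ⟨W, hy, a, ⊤, trivial, fun y' _ _ _ => rfl⟩⟩

/-- The stalk is a colimit over neighbourhoods, so a cofinal family with bijective restriction from
`W` is enough. -/
lemma gm_bijective_of_rs_bijective (F : Sh Y) {W : Opens Y} {z : Y} (hz : z ∈ W)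
    (h : ∀ U : Opens Y, z ∈ U → ∃ (W' : Opens Y) (_ : z ∈ W') (hW : W' ≤ W), W' ≤ U ∧
      Function.Bijective (rs F hW)) : Function.Bijective (gm F z hz) := by
  constructor
  · intro s t hst
    obtain ⟨U, hzU, h₁, h₂, hU⟩ := exists_rs_eq_of_gm_eq F hst
    obtain ⟨W', hz', hW, hWU, hb⟩ := h U hzU
    refine hb.1 ?_
    rw [← rs_rs F h₁ hWU, hU, rs_rs]
  · intro g
    obtain ⟨U, hU, hzU, s, rfl⟩ := exists_gm_eq F g hz
    obtain ⟨W', hz', hW, hWU, hb⟩ := h U hzU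
    obtain ⟨t, ht⟩ := hb.2 (rs F hWU s)
    exact ⟨t, by rw [← gm_rs F hW z hz', ht, gm_rs]⟩

end LocConstAlong

end

end Toric

namespace Toric

noncomputable section

/-! ### Cutting compact sets by coordinate hyperplanes -/

section Bisection

variable {X : Type*} [TopologicalSpace X] {κ : Type*} [Finite κ]

/-- If a compact set `K` is embedded in `ℝ^κ` by functions `φ`, a property of subsets of `K` that
holds locally and can be checked after cutting by coordinate hyperplanes holds for `K`. -/
lemma bisection (φ : κ → X → ℝ) {K : Set X} (hK : IsCompact K) (hφ : ∀ i, ContinuousOn (φ i) K)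
    (hinj : ∀ x ∈ K, ∀ y ∈ K, (∀ i, φ i x = φ i y) → x = y) (Q P : Set X → Prop)
    (hQ₁ : ∀ K' i c, Q K' → Q (K' ∩ {x | φ i x ≤ c}))
    (hQ₂ : ∀ K' i c, Q K' → Q (K' ∩ {x | c ≤ φ i x}))
    (hP₀ : P ∅)
    (hP₁ : ∀ x ∈ K, ∃ U, IsOpen U ∧ x ∈ U ∧ ∀ K', K' ⊆ K → K' ⊆ U → Q K' → P K')
    (hP₂ : ∀ K' i c, K' ⊆ K → Q K' → P (K' ∩ {x | φ i x ≤ c}) → P (K' ∩ {x | c ≤ φ i x}) → P K')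
    (hQ : Q K) : P K := by
  classical
  have := Fintype.ofFinite κ
  choose! U hU hxU hP₁ using hP₁
  let Φ : X → κ → ℝ := fun x i => φ i x
  have hΦ : ContinuousOn Φ K := continuousOn_pi.2 hφ
  -- A continuous injection of a compact space is an embedding, so the neighbourhoods in `K` are
  -- traces of open sets of `ℝ^κ`, and there is a Lebesgue number for them.
  have hemb : Topology.IsClosedEmbedding (K.domRestrict Φ) := by
    have := isCompact_iff_compactSpace.1 hK
    refine Continuous.isClosedEmbedding (continuousOn_iff_continuous_domRestrict.1 hΦ) ?_
    intro x y h
    exact Subtype.ext (hinj x x.2 y y.2 fun i => congrFun h i)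
  have h₁ : ∀ x : K, ∃ c : Set (κ → ℝ), IsOpen c ∧ ∀ y ∈ K, Φ y ∈ c ↔ y ∈ U x := by
    intro x
    obtain ⟨c, hc, h⟩ := hemb.isInducing.isOpen_iff.1
      ((hU x x.2).preimage (continuous_subtype_val (p := (· ∈ K))))
    exact ⟨c, hc, fun y hy => (Set.ext_iff.1 h ⟨y, hy⟩)⟩
  choose c hc hcU using h₁
  obtain ⟨δ, hδ, hleb⟩ := lebesgue_number_lemma_of_metric (hK.image_of_continuousOn hΦ) hc (by
    rintro _ ⟨x, hx, rfl⟩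
    exact Set.mem_iUnion.2 ⟨⟨x, hx⟩, (hcU ⟨x, hx⟩ x hx).2 (hxU x hx)⟩)
  -- `S` collects the coordinates that are not yet known to vary by less than `δ` on the piece; it
  -- is emptied one coordinate at a time.
  suffices H : ∀ (S : Finset κ) (K' : Set X), K' ⊆ K → Q K' →
      (∀ i ∉ S, ∀ x ∈ K', ∀ y ∈ K', |φ i x - φ i y| < δ) → P K' from
    H Finset.univ K subset_rfl hQ (fun i hi => absurd (Finset.mem_univ i) hi)
  intro S
  induction S using Finset.induction_on with
  | empty =>
    intro K' hK' hQ' h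
    rcases K'.eq_empty_or_nonempty with rfl | ⟨x, hx⟩
    · exact hP₀
    obtain ⟨⟨x', hx'⟩, hx''⟩ := hleb _ ⟨x, hK' hx, rfl⟩
    refine hP₁ x' hx' K' hK' (fun y hy => (hcU ⟨x', hx'⟩ y (hK' hy)).1 (hx'' ?_)) hQ'
    rw [Metric.mem_ball, dist_pi_lt_iff hδ]
    exact fun i => h i (by simp) y hy x hx
  | insert i S hi ih =>
    -- Slice along coordinate `i` into slabs of thickness `δ / 2`, peeling off the topmost one. The
    -- slabs are closed, and half of `δ` keeps the inequality strict.
    have key : ∀ (n : ℕ) (a : ℝ) (K' : Set X), K' ⊆ K → Q K' →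
        (∀ j ∉ insert i S, ∀ x ∈ K', ∀ y ∈ K', |φ j x - φ j y| < δ) →
        (∀ x ∈ K', a ≤ φ i x ∧ φ i x ≤ a + n * (δ / 2)) → P K' := by
      intro n
      induction n with
      | zero =>
        intro a K' hK' hQ' h h'
        refine ih K' hK' hQ' fun j hj x hx y hy => ?_
        by_cases hij : j = i
        · subst hij
          have h₁ := h' x hx
          have h₂ := h' y hy
          rw [abs_lt]
          constructor <;> (push_cast at h₁ h₂; linarith)
        · exact h j (by simp [hij, hj]) x hx y hy
      | succ n ihn =>
        intro a K' hK' hQ' h h'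
        refine hP₂ K' i (a + n * (δ / 2)) hK' hQ' ?_ ?_
        · refine ihn a _ (Set.inter_subset_left.trans hK') (hQ₁ _ _ _ hQ')
            (fun j hj x hx y hy => h j hj x hx.1 y hy.1) fun x hx => ⟨(h' x hx.1).1, hx.2⟩
        · refine ih _ (Set.inter_subset_left.trans hK') (hQ₂ _ _ _ hQ') fun j hj x hx y hy => ?_
          by_cases hij : j = i
          · subst hij
            have h₁ := (h' x hx.1).2
            have h₂ := (h' y hy.1).2
            have h₃ : a + n * (δ / 2) ≤ φ j x := hx.2
            have h₄ : a + n * (δ / 2) ≤ φ j y := hy.2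
            rw [abs_lt]
            constructor <;> (push_cast at h₁ h₂; linarith)
          · exact h j (by simp [hij, hj]) x hx.1 y hy.1
    intro K' hK' hQ' h
    obtain ⟨R, hR⟩ := hK.exists_bound_of_continuousOn (hφ i)
    obtain ⟨n, hn⟩ := exists_nat_ge (2 * R / (δ / 2))
    refine key n (-R) K' hK' hQ' h fun x hx => ?_
    have h₁ := abs_le.1 (hR x (hK' hx))
    rw [div_le_iff₀ (by positivity)] at hn
    exact ⟨h₁.1, by linarith⟩

end Bisection

/-! ### Lifting sections along compact sets and exhaustions -/

section Extension

variable {Y : TopCat.{0}}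

/-- All sections extend to larger open subsets. -/
def Flasque (J : Sh Y) : Prop := ∀ ⦃U V : Opens Y⦄ (h : V ≤ U), Function.Surjective (rs J h)

lemma flasque_of_injective (J : Sh Y) [Injective J] : Flasque J :=
  fun _ _ h => rs_surjective_of_injective J h

/-- Sections near `L` have the same germs along `L` as sections over `W`. -/
def ExtendsFrom (G : Sh Y) (W : Opens Y) (L : Set Y) : Prop :=
  ∀ (V : Opens Y) (s : Sec G V), L ⊆ V → ∃ s' : Sec G W, ∀ z (hV : z ∈ V) (hW : z ∈ W), z ∈ L →
    gm G z hW s' = gm G z hV s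

/-- Two sections that agree on the intersection of two opens glue. -/
lemma exists_glue₂ (F : Sh Y) {U V : Opens Y} (s : Sec F U) (t : Sec F V)
    (h : ∀ z (hU : z ∈ U) (hV : z ∈ V), gm F z hU s = gm F z hV t) :
    ∃ r : Sec F (U ⊔ V), (∀ z (h : z ∈ U ⊔ V) (hz : z ∈ U), gm F z h r = gm F z hz s) ∧
      ∀ z (h : z ∈ U ⊔ V) (hz : z ∈ V), gm F z h r = gm F z hz t := by
  classical
  obtain ⟨r, hr⟩ := exists_gm_eq_of_local F (U ⊔ V)
    (fun z hz => if hU : z ∈ U then gm F z hU s else gm F z (Or.resolve_left hz hU) t) (by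
    rintro z (hz | hz)
    · exact ⟨U, hz, s, fun y hy _ => by simp [hy]⟩
    · refine ⟨V, hz, t, fun y hy _ => ?_⟩
      by_cases hU : y ∈ U
      · simp only [hU, dite_true]; exact (h y hU hy).symm
      · simp [hU])
  refine ⟨r, fun z _ hz => ?_, fun z _ hz => ?_⟩
  · rw [hr]; simp [hz]
  · rw [hr]
    by_cases hU : z ∈ U
    · simp only [hU, dite_true]; exact h z hU hz
    · simp [hU]

/-- Disjoint compact subsets of a Hausdorff open subspace can be separated. -/
lemma exists_separating_opens (W : Opens Y) [T2Space W] {A B : Set Y} (hA : IsCompact A)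
    (hB : IsCompact B) (hAW : A ⊆ W) (hBW : B ⊆ W) (h : Disjoint A B) :
    ∃ U V : Opens Y, A ⊆ U ∧ B ⊆ V ∧ Disjoint (U : Set Y) V ∧ U ≤ W ∧ V ≤ W := by
  have hA' : IsCompact ((Subtype.val : W → Y) ⁻¹' A) :=
    Topology.IsInducing.subtypeVal.isCompact_preimage_iff (by simpa using hAW) |>.2 hA
  have hB' : IsCompact ((Subtype.val : W → Y) ⁻¹' B) :=
    Topology.IsInducing.subtypeVal.isCompact_preimage_iff (by simpa using hBW) |>.2 hB
  obtain ⟨U, V, hU, hV, hAU, hBV, hd⟩ := SeparatedNhds.of_isCompact_isCompact hA' hB' (h.preimage _)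
  refine ⟨⟨_, W.2.isOpenMap_subtype_val U hU⟩, ⟨_, W.2.isOpenMap_subtype_val V hV⟩,
    fun x hx => ⟨⟨x, hAW hx⟩, hAU hx, rfl⟩, fun x hx => ⟨⟨x, hBW hx⟩, hBV hx, rfl⟩,
    (Set.disjoint_image_iff Subtype.val_injective).2 hd, ?_, ?_⟩
  · rintro _ ⟨x, -, rfl⟩; exact x.2
  · rintro _ ⟨x, -, rfl⟩; exact x.2

/-- Sections near two compact sets that agree on the intersection glue near the union. -/
lemma exists_glue_compact (F : Sh Y) (W : Opens Y) [T2Space W] {A B : Set Y} (hA : IsCompact A)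
    (hB : IsCompact B) (hAW : A ⊆ W) (hBW : B ⊆ W) {U V : Opens Y} (hAU : A ⊆ U) (hBV : B ⊆ V)
    (s : Sec F U) (t : Sec F V)
    (h : ∀ z (hU : z ∈ U) (hV : z ∈ V), z ∈ A → z ∈ B → gm F z hU s = gm F z hV t) :
    ∃ (V' : Opens Y) (r : Sec F V'), A ∪ B ⊆ V' ∧
      (∀ z (hz : z ∈ V') (hU : z ∈ U), z ∈ A → gm F z hz r = gm F z hU s) ∧
      ∀ z (hz : z ∈ V') (hV : z ∈ V), z ∈ B → gm F z hz r = gm F z hV t := by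
  -- `N` contains `A ∩ B`, so the parts of `A` and `B` outside `N` are disjoint compact sets. Near
  -- these, separated neighbourhoods leave nothing to match.
  let N : Opens Y := ⟨_, isOpen_gm_eq F s t⟩
  obtain ⟨U', V', hU', hV', hd, -, -⟩ := exists_separating_opens W (hA.diff N.2) (hB.diff N.2)
    (Set.sdiff_subset.trans hAW) (Set.sdiff_subset.trans hBW) (Set.disjoint_left.2 (by
      rintro z ⟨hzA, hzN⟩ ⟨hzB, -⟩
      exact hzN ⟨hAU hzA, hBV hzB, h z (hAU hzA) (hBV hzB) hzA hzB⟩))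
  have e₁ : U ⊓ (U' ⊔ N) ≤ U := inf_le_left
  have e₂ : V ⊓ (V' ⊔ N) ≤ V := inf_le_left
  obtain ⟨r, hr₁, hr₂⟩ := exists_glue₂ F (rs F e₁ s) (rs F e₂ t) (by
    intro z h₁ h₂
    rw [gm_rs, gm_rs]
    rcases h₁.2 with hz | hz
    · rcases h₂.2 with hz' | hz'
      · exact absurd hz' (Set.disjoint_left.1 hd hz)
      · exact hz'.2.2
    · exact hz.2.2)
  have a₁ : ∀ z ∈ A, z ∈ U ⊓ (U' ⊔ N) := fun z hz => ⟨hAU hz, by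
    by_cases hN : z ∈ N
    · exact Or.inr hN
    · exact Or.inl (hU' ⟨hz, hN⟩)⟩
  have a₂ : ∀ z ∈ B, z ∈ V ⊓ (V' ⊔ N) := fun z hz => ⟨hBV hz, by
    by_cases hN : z ∈ N
    · exact Or.inr hN
    · exact Or.inl (hV' ⟨hz, hN⟩)⟩
  refine ⟨_, r, ?_, fun z hz hU hA => ?_, fun z hz hV hB => ?_⟩
  · rintro z (hz | hz)
    · exact Or.inl (a₁ z hz)
    · exact Or.inr (a₂ z hz)
  · exact (hr₁ z _ (a₁ z hA)).trans (gm_rs F e₁ z _ s)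
  · exact (hr₂ z _ (a₂ z hB)).trans (gm_rs F e₂ z _ t)

variable {S : ShortComplex (Sh Y)}

/-- The gluing step for the construction of lifts of sections along compact sets. -/
lemma exists_lift_union (hS : S.ShortExact) (hJ : Flasque S.X₂) (W : Opens Y) [T2Space W]
    {A B : Set Y}
    (hA : IsCompact A) (hB : IsCompact B) (hAW : A ⊆ W) (hBW : B ⊆ W) {V : Opens Y}
    (s : Sec S.X₃ V) (hAV : A ⊆ V) (hBV : B ⊆ V)
    (hE : ExtendsFrom S.X₁ W (A ∩ B)) (a b : Sec S.X₂ W)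
    (ha : ∀ z (hV : z ∈ V) (hW : z ∈ W), z ∈ A → gm _ z hW (sm S.g W a) = gm _ z hV s)
    (hb : ∀ z (hV : z ∈ V) (hW : z ∈ W), z ∈ B → gm _ z hW (sm S.g W b) = gm _ z hV s) :
    ∃ r : Sec S.X₂ W, (∀ z (hV : z ∈ V) (hW : z ∈ W), z ∈ A ∪ B →
      gm _ z hW (sm S.g W r) = gm _ z hV s) ∧ ∀ z (hW : z ∈ W), z ∈ A → gm _ z hW r = gm _ z hW a := by
  have := hS.mono_f
  -- Over `N`, which contains `A ∩ B`, the difference of the two lifts comes from `S.X₁`. Its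
  -- extension to `W` given by `hE`, added to `b`, makes the lifts agree along `A ∩ B`.
  let N : Opens Y := ⟨_, isOpen_gm_eq S.X₃ (sm S.g W a) (sm S.g W b)⟩
  have hNW : N ≤ W := fun z hz => hz.1
  obtain ⟨g, hg⟩ := exists_sm_eq_of_exact hS.exact N (rs S.X₂ hNW (a - b)) (by
    rw [sm_rs]
    refine sec_ext _ fun z hz => ?_
    rw [gm_rs, map_sub, map_sub, map_zero, sub_eq_zero]
    exact hz.2.2)
  obtain ⟨g', hg'⟩ := hE N g (by
    rintro z ⟨hzA, hzB⟩
    exact ⟨hAW hzA, hAW hzA, by rw [ha z (hAV hzA) (hAW hzA) hzA, hb z (hBV hzB) (hAW hzA) hzB]⟩)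
  obtain ⟨V', r, hr, hr₁, hr₂⟩ := exists_glue_compact S.X₂ W hA hB hAW hBW hAW hBW a
    (b + sm S.f W g') (by
      intro z hz _ hzA hzB
      have hzN : z ∈ N := ⟨hAW hzA, hAW hzA, by
        rw [ha z (hAV hzA) (hAW hzA) hzA, hb z (hBV hzB) (hAW hzA) hzB]⟩
      rw [map_add, ← km_gm, hg' z hzN (hAW hzA) ⟨hzA, hzB⟩, km_gm, hg, gm_rs, map_sub]
      abel)
  -- The glued section lives only near `A ∪ B`; flasqueness spreads it over `W`.
  obtain ⟨r', hr'⟩ := hJ (inf_le_right : V' ⊓ W ≤ W) (rs _ inf_le_left r)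
  have hr'' : ∀ z (hV' : z ∈ V') (hW : z ∈ W), gm _ z hW r' = gm _ z hV' r := fun z hV' hW => by
    have hz : z ∈ V' ⊓ W := ⟨hV', hW⟩
    rw [← gm_rs S.X₂ (inf_le_right : V' ⊓ W ≤ W) z hz, hr', gm_rs]
  refine ⟨r', fun z hV hW hz => ?_, fun z hW hz => ?_⟩
  · rw [← km_gm, hr'' z (hr hz) hW]
    rcases hz with hz | hz
    · rw [hr₁ z (hr (Or.inl hz)) hW hz, km_gm, ha z hV hW hz]
    · rw [hr₂ z (hr (Or.inr hz)) hW hz, km_gm, map_add, map_add, hb z hV hW hz, ← sm_comp, S.zero,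
        sm_zero, map_zero, add_zero]
  · rw [hr'' z (hr (Or.inl hz)) hW, hr₁ z (hr (Or.inl hz)) hW hz]

/-- Sections lift along compact sets if the obstructions on hyperplane sections vanish. -/
lemma exists_lift_compact (hS : S.ShortExact) (hJ : Flasque S.X₂) (W : Opens Y) [T2Space W]
    {κ : Type*} [Finite κ]
    (φ : κ → Y → ℝ) (Q : Set Y → Prop) (hQc : ∀ K, Q K → IsCompact K) (hQW : ∀ K, Q K → K ⊆ W)
    (hφ : ∀ K, Q K → ∀ i, ContinuousOn (φ i) K)
    (hinj : ∀ K, Q K → ∀ x ∈ K, ∀ y ∈ K, (∀ i, φ i x = φ i y) → x = y)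
    (hQ₁ : ∀ K' i c, Q K' → Q (K' ∩ {x | φ i x ≤ c}))
    (hQ₂ : ∀ K' i c, Q K' → Q (K' ∩ {x | c ≤ φ i x}))
    (hE : ∀ K i c, Q K → K ⊆ {x | φ i x ≤ c} ∨ K ⊆ {x | c ≤ φ i x} ∨
      ExtendsFrom S.X₁ W (K ∩ {x | φ i x = c}))
    (K : Set Y) (hK : Q K) {V : Opens Y} (s : Sec S.X₃ V) (hKV : K ⊆ V) :
    ∃ a : Sec S.X₂ W, ∀ z (hV : z ∈ V) (hW : z ∈ W), z ∈ K →
      gm _ z hW (sm S.g W a) = gm _ z hV s := by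
  refine bisection φ (hQc K hK) (hφ K hK) (hinj K hK) Q
    (fun K => ∃ a : Sec S.X₂ W, ∀ z (hV : z ∈ V) (hW : z ∈ W), z ∈ K →
      gm _ z hW (sm S.g W a) = gm _ z hV s) hQ₁ hQ₂ ⟨0, by simp⟩ ?_ ?_ hK
  · intro x hx
    have := hS.epi_g
    -- Near a point a lift exists by surjectivity on stalks, and flasqueness extends it to `W`.
    obtain ⟨t, ht⟩ := km_surjective S.g x (gm _ x (hKV hx) s)
    obtain ⟨U, hUW, hxU, t, rfl⟩ := exists_gm_eq S.X₂ t (hQW K hK hx)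
    obtain ⟨t, rfl⟩ := hJ hUW t
    rw [km_gm, sm_rs, gm_rs] at ht
    refine ⟨_, isOpen_gm_eq S.X₃ (sm S.g W t) s, ⟨_, _, ht⟩, fun K' _ hK' _ => ⟨t, ?_⟩⟩
    intro z hV hW hz
    exact (hK' hz).2.2
  · rintro K' i c hK' hQ' ⟨a, ha⟩ ⟨b, hb⟩
    -- If the hyperplane does not separate `K'`, one of the two halves is already all of it.
    rcases hE K' i c hQ' with h | h | h
    · exact ⟨a, fun z hV hW hz => ha z hV hW ⟨hz, h hz⟩⟩
    · exact ⟨b, fun z hV hW hz => hb z hV hW ⟨hz, h hz⟩⟩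
    · obtain ⟨r, hr, -⟩ := exists_lift_union hS hJ W (hQc _ (hQ₁ K' i c hQ')) (hQc _ (hQ₂ K' i c hQ'))
        (hQW _ (hQ₁ K' i c hQ')) (hQW _ (hQ₂ K' i c hQ')) s
        (fun z hz => hKV (hK' hz.1)) (fun z hz => hKV (hK' hz.1)) (by
          convert h using 1
          ext z
          simp only [Set.mem_inter_iff, Set.mem_ofPred_eq]
          constructor
          · rintro ⟨⟨h₁, h₂⟩, -, h₃⟩; exact ⟨h₁, le_antisymm h₂ h₃⟩
          · rintro ⟨h₁, h₂⟩; exact ⟨⟨h₁, h₂.le⟩, h₁, h₂.ge⟩) a b ha hb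
      refine ⟨r, fun z hV hW hz => hr z hV hW ?_⟩
      rcases le_total (φ i z) c with h | h
      · exact Or.inl ⟨hz, h⟩
      · exact Or.inr ⟨hz, h⟩

/-- Sections lift over a space that is exhausted by compact sets along which the obstructions
vanish. -/
lemma exists_lift_exhaustion (hS : S.ShortExact) (W : Opens Y) (K : ℕ → Set Y) (hKW : ∀ n, K n ⊆ W)
    (hK : Monotone K) (hKi : ∀ z ∈ W, ∃ n, z ∈ interior (K n))
    (hE : ∀ n, ExtendsFrom S.X₁ W (K n)) (s : Sec S.X₃ W)
    (hl : ∀ n, ∃ a : Sec S.X₂ W, ∀ z (hW : z ∈ W), z ∈ K n →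
      gm _ z hW (sm S.g W a) = gm _ z hW s) : ∃ a : Sec S.X₂ W, sm S.g W a = s := by
  have := hS.mono_f
  let A : ℕ → Type := fun n => {a : Sec S.X₂ W // ∀ z (hW : z ∈ W), z ∈ K n →
      gm _ z hW (sm S.g W a) = gm _ z hW s}
  -- A Mittag-Leffler argument: a lift along `K (n + 1)` is corrected by a section of `S.X₁` so as
  -- to agree with the given lift along `K n`. The resulting sequence stabilises on each `K n` and
  -- glues.
  have step : ∀ n (a : A n), ∃ b : A (n + 1), ∀ z (hW : z ∈ W), z ∈ K n →
      gm _ z hW b.1 = gm _ z hW a.1 := by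
    intro n a
    obtain ⟨b, hb⟩ := hl (n + 1)
    let N : Opens Y := ⟨_, isOpen_gm_eq S.X₃ (sm S.g W a.1) (sm S.g W b)⟩
    have hNW : N ≤ W := fun z hz => hz.1
    obtain ⟨g, hg⟩ := exists_sm_eq_of_exact hS.exact N (rs S.X₂ hNW (a.1 - b)) (by
      rw [sm_rs]
      refine sec_ext _ fun z hz => ?_
      rw [gm_rs, map_sub, map_sub, map_zero, sub_eq_zero]
      exact hz.2.2)
    have hN : K n ⊆ N := fun z hz => ⟨hKW n hz, hKW n hz, by
      rw [a.2 z _ hz, hb z _ (hK n.le_succ hz)]⟩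
    obtain ⟨g', hg'⟩ := hE n N g hN
    refine ⟨⟨b + sm S.f W g', fun z hW hz => ?_⟩, fun z hW hz => ?_⟩
    · rw [map_add, map_add, hb z hW hz, ← sm_comp, S.zero, sm_zero, map_zero, add_zero]
    · rw [map_add, ← km_gm, hg' z (hN hz) hW hz, km_gm, hg, gm_rs, map_sub]
      abel
  choose f hf using step
  let a : ∀ n, A n := fun n => Nat.rec ⟨_, (hl 0).choose_spec⟩ (fun n a => f n a) n
  have ha : ∀ m n, m ≤ n → ∀ z (hW : z ∈ W), z ∈ K m → gm _ z hW (a n).1 = gm _ z hW (a m).1 := by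
    intro m n hmn
    induction n, hmn using Nat.le_induction with
    | base => exact fun _ _ _ => rfl
    | succ n hmn ih => exact fun z hW hz => (hf n (a n) z hW (hK hmn hz)).trans (ih z hW hz)
  choose! n hn using hKi
  have ha' : ∀ m m' z (hW : z ∈ W), z ∈ K m → z ∈ K m' →
      gm _ z hW (a m).1 = gm _ z hW (a m').1 := by
    intro m m' z hW h h'
    rcases le_total m m' with hm | hm
    · exact (ha m m' hm z hW h).symm
    · exact ha m' m hm z hW h'
  obtain ⟨t, ht⟩ := exists_gm_eq_of_local S.X₂ W (fun z hz => gm _ z hz (a (n z)).1) (by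
    intro z hz
    refine ⟨⟨interior (K (n z)), isOpen_interior⟩, hn z hz, rs _ (fun y hy => hKW _
      (interior_subset hy)) (a (n z)).1, fun y hy hy' => ?_⟩
    rw [gm_rs]
    exact ha' _ _ y hy' (interior_subset hy) (interior_subset (hn y hy')))
  refine ⟨t, sec_ext _ fun z hz => ?_⟩
  rw [← km_gm, ht, km_gm, (a (n z)).2 z hz (interior_subset (hn z hz))]

end Extension

end

end Toric

namespace Toric

noncomputable section

/-! ### Cohomological dimension of subspaces of Euclidean space -/

section Bound

variable {Y : TopCat.{0}}

variable (W : Opens Y) [T2Space W] {κ : Type*} [Fintype κ] (φ : κ → Y → ℝ)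

/-- The compact subsets of `W` on which all but `k` of the functions `φ` are constant. -/
def CompactOfDim (k : ℕ) (K : Set Y) : Prop :=
  IsCompact K ∧ K ⊆ W ∧ ∃ T : Finset κ, T.card ≤ k ∧ ∀ i ∉ T, ∀ x ∈ K, ∀ y ∈ K, φ i x = φ i y

variable {W φ}

lemma CompactOfDim.inter {k : ℕ} {K : Set Y} (h : CompactOfDim W φ k K)
    (hφ : ∀ i, ContinuousOn (φ i) W) (i : κ) {C : Set ℝ} (hC : IsClosed C) :
    CompactOfDim W φ k (K ∩ φ i ⁻¹' C) := by
  obtain ⟨h₁, h₂, T, hT, h⟩ := h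
  refine ⟨?_, Set.inter_subset_left.trans h₂, T, hT, fun i hi x hx y hy => h i hi x hx.1 y hy.1⟩
  have h₃ : ContinuousOn (φ i) K := (hφ i).mono h₂
  obtain ⟨u, hu, hu'⟩ := continuousOn_iff_isClosed.1 h₃ C hC
  rw [Set.inter_comm, hu', Set.inter_comm]
  exact h₁.inter_right hu

/-- Cutting by a coordinate that varies lowers the dimension by one, and the other coordinates do
not cut. So only the sets of dimension below `k` carry obstructions. -/
lemma exists_lift_of_compactOfDim {S : ShortComplex (Sh Y)} (hS : S.ShortExact)
    (hJ : Flasque S.X₂) (hφ : ∀ i, ContinuousOn (φ i) W)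
    (hinj : ∀ x ∈ W, ∀ y ∈ W, (∀ i, φ i x = φ i y) → x = y) (k : ℕ)
    (hE : ∀ l < k, ∀ K, CompactOfDim W φ l K → ExtendsFrom S.X₁ W K)
    (K : Set Y) (hK : CompactOfDim W φ k K) {V : Opens Y} (s : Sec S.X₃ V) (hKV : K ⊆ V) :
    ∃ a : Sec S.X₂ W, ∀ z (hV : z ∈ V) (hW : z ∈ W), z ∈ K →
      gm _ z hW (sm S.g W a) = gm _ z hV s := by
  classical
  refine exists_lift_compact hS hJ W φ (CompactOfDim W φ k) (fun K h => h.1) (fun K h => h.2.1)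
    (fun K h i => (hφ i).mono h.2.1) (fun K h x hx y hy => hinj x (h.2.1 hx) y (h.2.1 hy))
    (fun K' i c h => h.inter hφ i isClosed_Iic) (fun K' i c h => h.inter hφ i isClosed_Ici)
    (fun K' i c h => ?_) K hK s hKV
  have h₀ := h
  obtain ⟨h₁, h₂, T, hT, h⟩ := h
  by_cases hi : i ∈ T
  · right; right
    -- Since `T` contains `i`, it is nonempty, so `k` is positive and `k - 1 < k`.
    refine hE (k - 1) ?_ _ ⟨(h₀.inter hφ i (C := {c}) isClosed_singleton).1,
      Set.inter_subset_left.trans h₂, T.erase i, ?_, fun j hj x hx y hy => ?_⟩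
    · have := Finset.card_pos.2 ⟨i, hi⟩
      omega
    · rw [Finset.card_erase_of_mem hi]; omega
    · by_cases hij : j = i
      · subst hij
        exact Eq.trans hx.2 (Eq.symm hy.2)
      · exact h j (fun hT => hj (Finset.mem_erase.2 ⟨hij, hT⟩)) x hx.1 y hy.1
  · rcases K'.eq_empty_or_nonempty with rfl | ⟨x, hx⟩
    · exact Or.inl (Set.empty_subset _)
    · rcases le_total (φ i x) c with hc | hc
      · exact Or.inl fun y hy => (h i hi y hy x hx).trans_le hc
      · exact Or.inr (Or.inl fun y hy => hc.trans_eq (h i hi x hx y hy))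

/-- A cycle in degree `m` given near `K` is lifted to the flasque term in degree `m - 1` over `W`
and mapped back. The obstructions are cycles of degree `m - 1` along sets of smaller dimension, so
the induction loses one degree for each dimension and stays in the exact range because `b + k < m`.
-/
lemma extendsFrom_cycles (J : CochainComplex (Sh Y) ℤ) (hJ : ∀ n, Flasque (J.X n)) (b : ℤ)
    (hb : ∀ n > b, J.ExactAt n) (hφ : ∀ i, ContinuousOn (φ i) W)
    (hinj : ∀ x ∈ W, ∀ y ∈ W, (∀ i, φ i x = φ i y) → x = y) (k : ℕ) (m : ℤ) (hm : b + k < m)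
    (K : Set Y) (hK : CompactOfDim W φ k K) : ExtendsFrom (J.cycles m) W K := by
  induction k using Nat.strong_induction_on generalizing m K with
  | h k ih =>
    obtain ⟨m, rfl⟩ : ∃ m', m = m' + 1 := ⟨m - 1, by ring⟩
    intro V s hKV
    have hS := shortExact_cycles J m (hb _ (by omega))
    obtain ⟨a, ha⟩ := exists_lift_of_compactOfDim hS (hJ m) hφ hinj k
      (fun l hl K hK => ih l hl m (by omega) K hK) K hK s hKV
    exact ⟨sm (J.toCycles m (m + 1)) W a, ha⟩

/-- Every compact subset of `W` has dimension at most `Fintype.card κ`, so both hypotheses of the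
exhaustion argument hold for any compact exhaustion. -/
lemma sm_surjective_of_extendsFrom [WeaklyLocallyCompactSpace W] [SigmaCompactSpace W]
    {S : ShortComplex (Sh Y)} (hS : S.ShortExact)
    (hJ : Flasque S.X₂) (hφ : ∀ i, ContinuousOn (φ i) W)
    (hinj : ∀ x ∈ W, ∀ y ∈ W, (∀ i, φ i x = φ i y) → x = y)
    (hE : ∀ l ≤ Fintype.card κ, ∀ K, CompactOfDim W φ l K → ExtendsFrom S.X₁ W K) :
    Function.Surjective (sm S.g W) := by
  intro s
  let C := CompactExhaustion.choice W
  have hC : ∀ n, CompactOfDim W φ (Fintype.card κ) (Subtype.val '' C n) := fun n =>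
    ⟨(C.isCompact n).image continuous_subtype_val, by rintro _ ⟨x, -, rfl⟩; exact x.2,
      Finset.univ, le_rfl, fun i hi => absurd (Finset.mem_univ i) hi⟩
  refine exists_lift_exhaustion hS W (fun n => Subtype.val '' C n)
    (fun n => (hC n).2.1) (fun m n h => Set.image_mono (C.subset h)) (fun z hz => ?_)
    (fun n => hE _ le_rfl _ (hC n)) s (fun n => ?_)
  · obtain ⟨n, hn⟩ := C.exists_mem_nhds ⟨z, hz⟩
    exact ⟨n, mem_interior.2 ⟨Subtype.val '' interior (C n), Set.image_mono interior_subset,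
      W.2.isOpenMap_subtype_val _ isOpen_interior, ⟨z, hz⟩, mem_interior_iff_mem_nhds.2 hn, rfl⟩⟩
  · obtain ⟨a, ha⟩ := exists_lift_of_compactOfDim hS hJ hφ hinj _
      (fun l hl => hE l hl.le) _ (hC n) s (hC n).2.1
    exact ⟨a, fun z hW => ha z hW hW⟩

/-- The complex of sections of a complex of flasque sheaves that is exact in high degrees is exact
in high degrees if the space can be embedded in a Euclidean space. -/
lemma exists_d_eq_of_embedding [WeaklyLocallyCompactSpace W] [SigmaCompactSpace W]
    (J : CochainComplex (Sh Y) ℤ) (hJ : ∀ n, Flasque (J.X n)) (b : ℤ)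
    (hb : ∀ n > b, J.ExactAt n) (hφ : ∀ i, ContinuousOn (φ i) W)
    (hinj : ∀ x ∈ W, ∀ y ∈ W, (∀ i, φ i x = φ i y) → x = y) (m : ℤ)
    (hm : b + Fintype.card κ < m) (s : Sec (J.X (m + 1)) W)
    (hs : sm (J.d (m + 1) (m + 2)) W s = 0) : ∃ t, sm (J.d m (m + 1)) W t = s := by
  have hS := shortExact_cycles J m (hb _ (by omega))
  have hK := J.cyclesIsKernel (m + 1) (m + 2) (by simp; ring)
  have hT := ShortComplex.exact_of_f_is_kernel (ShortComplex.mk (J.iCycles (m + 1))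
    (J.d (m + 1) (m + 2)) (by simp)) hK
  have hi : Mono (J.iCycles (m + 1)) := inferInstance
  obtain ⟨s', hs'⟩ := exists_sm_eq_of_exact hT W s hs
  obtain ⟨a, ha⟩ := sm_surjective_of_extendsFrom hS (hJ m) hφ hinj (fun l hl K hK =>
        extendsFrom_cycles J hJ b hb hφ hinj l m (by omega) K hK) s'
  refine ⟨a, ?_⟩
  rw [← hs', ← ha]
  exact congrArg (fun f => sm f W a) (J.toCycles_i m (m + 1)).symm

end Bound

/-! ### The identity principle for locally constant sheaves -/

section LocallyConstant

variable {Y : TopCat.{0}} {G : Sh Y}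

/-- Sections of locally constant sheaves agree on connected sets if they agree at one point. -/
lemma IsLocallyConstantSheaf.gm_eq_of_isPreconnected (hG : IsLocallyConstantSheaf G)
    {A : Set Y} (hA : IsPreconnected A) {U V : Opens Y} (hAU : A ⊆ U) (hAV : A ⊆ V)
    (s : Sec G U) (t : Sec G V) {x : Y} (hx : x ∈ A)
    (hst : gm G x (hAU hx) s = gm G x (hAV hx) t) {y : Y} (hy : y ∈ A) :
    gm G y (hAU hy) s = gm G y (hAV hy) t := by
  have h := hA.subset_left_of_subset_union (u := {z | ∃ (hU : z ∈ U) (hV : z ∈ V),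
    gm G z hU s = gm G z hV t}) (v := {z | ∃ (hU : z ∈ U) (hV : z ∈ V),
    gm G z hU s ≠ gm G z hV t}) (isOpen_gm_eq G s t) ?_ ?_ ?_ ⟨x, hx, _, _, hst⟩
  · exact (h hy).2.2
  · rw [isOpen_iff_forall_mem_open]
    rintro z ⟨hU, hV, h⟩
    obtain ⟨N, hz, A, φ, hφ⟩ := hG z
    have hb : ∀ y (hy : y ∈ N), Function.Bijective fun a : A => gm G y hy (φ.hom a) :=
      fun y hy => by
        have := hφ y hy
        exact ConcreteCategory.bijective_of_isIso (φ ≫ G.presheaf.germ N y hy)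
    -- Near `z` both sections are given by vectors of the fibre. If their germs differ at `z` then
    -- the vectors differ, hence so do the germs at all nearby points.
    obtain ⟨a, ha⟩ := (hb z hz).2 (gm G z hU s)
    obtain ⟨b, hb'⟩ := (hb z hz).2 (gm G z hV t)
    refine ⟨_, ?_, (isOpen_gm_eq G (φ.hom a) s).inter (isOpen_gm_eq G (φ.hom b) t),
      ⟨hz, hU, ha⟩, hz, hV, hb'⟩
    rintro y ⟨⟨hN, hU', h₁⟩, _, hV', h₂⟩
    refine ⟨hU', hV', fun h' => h ?_⟩
    rw [← h₁, ← h₂] at h'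
    rw [← ha, ← hb', (hb y hN).1 h']
  · rw [Set.disjoint_left]
    rintro z ⟨_, _, h⟩ ⟨_, _, h'⟩
    exact h' h
  · intro z hz
    by_cases h : gm G z (hAU hz) s = gm G z (hAV hz) t
    · exact Or.inl ⟨_, _, h⟩
    · exact Or.inr ⟨_, _, h⟩

end LocallyConstant

end

end Toric

namespace Toric

noncomputable section

/-! ### Sheaves on disjoint unions of vector spaces -/

section Sheets

variable (U : Type) (E : Type) [NormedAddCommGroup E]

/-- A disjoint union of copies of a vector space, indexed by `U`. -/
abbrev Sheets : TopCat.{0} := TopCat.of (Σ _ : U, E)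

variable {U E}

instance : T2Space (⊤ : Opens (Sheets U E)) :=
  inferInstanceAs (T2Space {x : (Σ _ : U, E) // x ∈ (⊤ : Opens (Sheets U E))})

/-- The inclusion of a sheet. -/
def smk (a : U) : E → Sheets U E := Sigma.mk (β := fun _ : U => E) a

lemma continuous_smk (a : U) : Continuous (smk (E := E) a) :=
  continuous_sigmaMk (σ := fun _ : U => E)

lemma isOpenMap_smk (a : U) : IsOpenMap (smk (E := E) a) :=
  isOpenMap_sigmaMk (σ := fun _ : U => E)

/-- The open subset of a sheet given by an open subset of the vector space. -/
def sheetOpen (a : U) (D : Set E) (hD : IsOpen D) : Opens (Sheets U E) :=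
  ⟨smk a '' D, isOpenMap_smk a D hD⟩

/-- A sheet. -/
def sheet (a : U) : Opens (Sheets U E) := sheetOpen a Set.univ isOpen_univ

lemma mem_sheet (a : U) (x : E) : (⟨a, x⟩ : Sheets U E) ∈ sheet (E := E) a := ⟨x, trivial, rfl⟩

lemma mem_sheetOpen {a : U} {D : Set E} {hD : IsOpen D} {x : E} :
    (⟨a, x⟩ : Sheets U E) ∈ sheetOpen a D hD ↔ x ∈ D :=
  ⟨by rintro ⟨y, hy, h⟩; cases h; exact hy, fun h => ⟨x, h, rfl⟩⟩

lemma eq_of_mem_sheetOpen {a b : U} {D : Set E} {hD : IsOpen D} {x : E}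
    (h : (⟨b, x⟩ : Sheets U E) ∈ sheetOpen a D hD) : b = a := by
  obtain ⟨y, -, h⟩ := h
  exact (congrArg Sigma.fst h).symm

lemma sheetOpen_le_sheet {a : U} {D : Set E} (hD : IsOpen D) :
    sheetOpen a D hD ≤ sheet a := by
  rintro _ ⟨x, -, rfl⟩
  exact mem_sheet a x

/-- Every point of an open set has a neighbourhood that is a ball. -/
lemma exists_ball_le (V : Opens (Sheets U E)) (a : U) (x : E) (hx : (⟨a, x⟩ : Sheets U E) ∈ V) :
    ∃ r > 0, sheetOpen a (Metric.ball x r) Metric.isOpen_ball ≤ V := by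
  have : IsOpen (smk a ⁻¹' (V : Set (Sheets U E)) : Set E) :=
    V.2.preimage (continuous_smk a)
  obtain ⟨r, hr, h⟩ := Metric.isOpen_iff.1 this x hx
  refine ⟨r, hr, ?_⟩
  rintro _ ⟨y, hy, rfl⟩
  exact h hy

variable [NormedSpace ℝ E]

/-- A nonempty convex open subset of a sheet. -/
def IsCell (C : Opens (Sheets U E)) : Prop :=
  ∃ (a : U) (D : Set E) (hD : IsOpen D), Convex ℝ D ∧ D.Nonempty ∧ C = sheetOpen a D hD

lemma isCell_sheet (a : U) : IsCell (sheet (E := E) a) :=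
  ⟨a, _, isOpen_univ, convex_univ, ⟨0, trivial⟩, rfl⟩

lemma IsCell.isPreconnected {C : Opens (Sheets U E)} (h : IsCell C) :
    IsPreconnected (C : Set (Sheets U E)) := by
  obtain ⟨a, D, hD, hc, -, rfl⟩ := h
  exact hc.isPreconnected.image _ (continuous_smk a).continuousOn

/-- A compact convex subset of a sheet. -/
def IsConvexCompact (K : Set (Sheets U E)) : Prop :=
  ∃ (a : U) (D : Set E), IsCompact D ∧ Convex ℝ D ∧ K = smk a '' D

lemma IsConvexCompact.isCompact {K : Set (Sheets U E)} (h : IsConvexCompact K) : IsCompact K := by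
  obtain ⟨a, D, hD, hc, rfl⟩ := h
  exact hD.image (continuous_smk a)

lemma IsConvexCompact.isPreconnected {K : Set (Sheets U E)} (h : IsConvexCompact K) :
    IsPreconnected K := by
  obtain ⟨a, D, hD, hc, rfl⟩ := h
  exact hc.isPreconnected.image _ (continuous_smk a).continuousOn

variable [FiniteDimensional ℝ E]

variable (U E) in
/-- The coordinates on the sheets. -/
def sheetCoord (i : Fin (Module.finrank ℝ E)) (x : Sheets U E) : ℝ :=
  (Module.finBasis ℝ E).coord i x.2

lemma continuous_sheetCoord (i : Fin (Module.finrank ℝ E)) : Continuous (sheetCoord U E i) :=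
  continuous_sigma fun _ => LinearMap.continuous_of_finiteDimensional _

lemma IsConvexCompact.inter {K : Set (Sheets U E)} (h : IsConvexCompact K)
    (i : Fin (Module.finrank ℝ E)) {C : Set ℝ} (hC : IsClosed C) (hC' : Convex ℝ C) :
    IsConvexCompact (K ∩ sheetCoord U E i ⁻¹' C) := by
  obtain ⟨a, D, hD, hc, rfl⟩ := h
  refine ⟨a, D ∩ (Module.finBasis ℝ E).coord i ⁻¹' C, hD.inter_right
    (hC.preimage (LinearMap.continuous_of_finiteDimensional _)),
    hc.inter (hC'.linear_preimage _), ?_⟩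
  ext z
  constructor
  · rintro ⟨⟨x, hx, rfl⟩, h⟩; exact ⟨x, ⟨hx, h⟩, rfl⟩
  · rintro ⟨x, ⟨hx, h⟩, rfl⟩; exact ⟨⟨x, hx, rfl⟩, h⟩

lemma IsConvexCompact.eq_of_sheetCoord {K : Set (Sheets U E)} (h : IsConvexCompact K)
    (x : Sheets U E) (hx : x ∈ K) (y : Sheets U E) (hy : y ∈ K)
    (hxy : ∀ i, sheetCoord U E i x = sheetCoord U E i y) : x = y := by
  obtain ⟨a, D, hD, hc, rfl⟩ := h
  obtain ⟨x, hx, rfl⟩ := hx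
  obtain ⟨y, hy, rfl⟩ := hy
  exact congrArg _ ((Module.finBasis ℝ E).ext_elem hxy)

/-- Sections near compact convex sets extend to global sections. -/
def ConvexExtends (G : Sh (Sheets U E)) : Prop := ∀ K, IsConvexCompact K → ExtendsFrom G ⊤ K

/-- Hyperplane sections of convex compact sets are convex compact, so the hypothesis on `S.X₁`
removes every obstruction met by the bisection. -/
lemma exists_lift_convexCompact {S : ShortComplex (Sh (Sheets U E))} (hS : S.ShortExact)
    (hJ : Flasque S.X₂) (hG : ConvexExtends S.X₁) (K : Set (Sheets U E)) (hK : IsConvexCompact K)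
    {V : Opens (Sheets U E)} (s : Sec S.X₃ V) (hKV : K ⊆ V) :
    ∃ a : Sec S.X₂ ⊤, ∀ z (hV : z ∈ V) (hW : z ∈ (⊤ : Opens (Sheets U E))), z ∈ K →
      gm _ z hW (sm S.g ⊤ a) = gm _ z hV s :=
  exists_lift_compact hS hJ ⊤ (sheetCoord U E) IsConvexCompact (fun K h => h.isCompact)
    (fun K h => fun _ _ => trivial) (fun K h i => (continuous_sheetCoord i).continuousOn)
    (fun K h => h.eq_of_sheetCoord) (fun K' i c h => h.inter i isClosed_Iic (convex_Iic c))
    (fun K' i c h => h.inter i isClosed_Ici (convex_Ici c)) (fun K' i c h =>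
      Or.inr (Or.inr (hG _ (h.inter i isClosed_singleton (convex_singleton c))))) K hK s hKV

/-- Stability under cosyzygies: it lets `ConvexExtends` play the role of vanishing cohomology on
convex sets in dimension shifting. -/
lemma ConvexExtends.of_shortExact {S : ShortComplex (Sh (Sheets U E))} (hS : S.ShortExact)
    (hJ : Flasque S.X₂) (hG : ConvexExtends S.X₁) : ConvexExtends S.X₃ := by
  intro K hK V s hKV
  obtain ⟨a, ha⟩ := exists_lift_convexCompact hS hJ hG K hK s hKV
  exact ⟨sm S.g ⊤ a, ha⟩

/-- Sections over cells lift. -/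
lemma sm_surjective_of_isCell {S : ShortComplex (Sh (Sheets U E))} (hS : S.ShortExact)
    (hJ : Flasque S.X₂) (hG : ConvexExtends S.X₁) {C : Opens (Sheets U E)} (hC : IsCell C) :
    Function.Surjective (sm S.g C) := by
  intro s
  obtain ⟨a, D, hD, hc, -, rfl⟩ := hC
  -- A convex compact exhaustion of `D`: the points of norm at most `n` at distance at least `1 / (n
  -- + 1)` from the complement.
  let D' : ℕ → Set E := fun n =>
    Metric.closedBall 0 n ∩ {x | Metric.ball x (1 / (n + 1)) ⊆ D}
  have hD'D : ∀ n, D' n ⊆ D := fun n x hx => hx.2 (Metric.mem_ball_self (by positivity))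
  have hcl : ∀ n : ℕ, IsClosed {x : E | Metric.ball x (1 / (n + 1)) ⊆ D} := by
    intro n
    have : {x : E | Metric.ball x (1 / (n + 1)) ⊆ D} =
        ⋂ y : (Dᶜ : Set E), {x : E | (1 / (n + 1) : ℝ) ≤ dist y.1 x} := by
      ext x
      simp only [Set.mem_iInter, Set.mem_ofPred_eq, Subtype.forall]
      constructor
      · intro h y hy
        by_contra hlt
        exact hy (h (Metric.mem_ball.2 (not_le.1 hlt)))
      · intro h y hy
        by_contra hy'
        exact absurd (Metric.mem_ball.1 hy) (not_lt.2 (h y hy'))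
    rw [this]
    exact isClosed_iInter fun y => isClosed_le continuous_const (continuous_const.dist continuous_id)
  have hcv : ∀ n : ℕ, Convex ℝ {x : E | Metric.ball x (1 / (n + 1)) ⊆ D} := by
    intro n x hx y hy α β hα hβ hαβ z hz
    rw [mem_ball_iff_norm] at hz
    -- Translate both endpoints by the vector that carries their convex combination to `z`.
    have h₁ : x + (z - (α • x + β • y)) ∈ D := hx (by simpa [mem_ball_iff_norm] using hz)
    have h₂ : y + (z - (α • x + β • y)) ∈ D := hy (by simpa [mem_ball_iff_norm] using hz)
    have h₃ := hc h₁ h₂ hα hβ hαβ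
    convert h₃ using 1
    have : z - (α • x + β • y) = (α + β) • (z - (α • x + β • y)) := by rw [hαβ, one_smul]
    rw [smul_add, smul_add, add_add_add_comm, ← add_smul, ← this]
    abel
  have hK : ∀ n, IsConvexCompact (smk a '' D' n : Set (Sheets U E)) := fun n =>
    ⟨a, D' n, (isCompact_closedBall _ _).inter_right (hcl n), (convex_closedBall _ _).inter (hcv n),
      rfl⟩
  have hKC : ∀ n, (smk a '' D' n : Set (Sheets U E)) ⊆ sheetOpen a D hD := fun n =>
    Set.image_mono (hD'D n)
  refine exists_lift_exhaustion hS _ (fun n => smk a '' D' n) hKC ?_ ?_ ?_ s ?_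
  · intro m n hmn
    have hmn' : (m : ℝ) ≤ n := by exact_mod_cast hmn
    refine Set.image_mono (Set.inter_subset_inter (Metric.closedBall_subset_closedBall hmn') ?_)
    intro x hx
    refine (Metric.ball_subset_ball ?_).trans hx
    exact one_div_le_one_div_of_le (by positivity) (by linarith)
  · rintro _ ⟨x, hx, rfl⟩
    obtain ⟨r, hr, hxr⟩ := Metric.isOpen_iff.1 hD x hx
    obtain ⟨n₁, hn₁⟩ := exists_nat_ge (‖x‖ + r / 2)
    obtain ⟨n₂, hn₂⟩ := exists_nat_one_div_lt (half_pos hr)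
    refine ⟨max n₁ n₂, mem_interior.2 ⟨smk a '' Metric.ball x (r / 2), Set.image_mono ?_,
      isOpenMap_smk a _ Metric.isOpen_ball, x, Metric.mem_ball_self (half_pos hr), rfl⟩⟩
    intro y hy
    have h₁ : (n₁ : ℝ) ≤ (max n₁ n₂ : ℕ) := by exact_mod_cast le_max_left _ _
    have h₂ : (n₂ : ℝ) ≤ (max n₁ n₂ : ℕ) := by exact_mod_cast le_max_right _ _
    have h₃ : (1 : ℝ) / ((max n₁ n₂ : ℕ) + 1) ≤ 1 / (n₂ + 1) :=
      one_div_le_one_div_of_le (by positivity) (by linarith)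
    rw [Metric.mem_ball] at hy
    constructor
    · rw [mem_closedBall_zero_iff]
      have := norm_le_norm_add_norm_sub' y x
      rw [← dist_eq_norm] at this
      linarith
    · intro z hz
      apply hxr
      rw [Metric.mem_ball] at hz ⊢
      have := dist_triangle z y x
      linarith
  · intro n V t hV
    obtain ⟨t', ht'⟩ := hG _ (hK n) V t hV
    exact ⟨rs _ le_top t', fun z hV hW hz => by rw [gm_rs]; exact ht' z hV trivial hz⟩
  · intro n
    obtain ⟨t, ht⟩ := exists_lift_convexCompact hS hJ hG _ (hK n) s (hKC n)
    exact ⟨rs _ le_top t, fun z hW hz => by rw [sm_rs, gm_rs]; exact ht z hW trivial hz⟩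

section LocallyConstant

variable {G : Sh (Sheets U E)}

/-- By bisection: the two halves of a convex set meet in a connected hyperplane section, so
extensions over the halves that agree at one point of it agree along it and glue. -/
lemma IsLocallyConstantSheaf.exists_near_convexCompact (hG : IsLocallyConstantSheaf G)
    {K : Set (Sheets U E)} (hK : IsConvexCompact K) (z : Sheets U E) (hz : z ∈ K) (g : Stk G z) :
    ∃ (V : Opens (Sheets U E)) (hV : K ⊆ V) (s : Sec G V), gm G z (hV hz) s = g := by
  revert z
  have glue : ∀ A B : Set (Sheets U E), IsConvexCompact A → IsConvexCompact B →
      IsConvexCompact (A ∩ B) →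
      (∀ (z) (hz : z ∈ A) (g : Stk G z), ∃ (V : Opens (Sheets U E)) (hV : A ⊆ V) (s : Sec G V),
        gm G z (hV hz) s = g) →
      (∀ (z) (hz : z ∈ B) (g : Stk G z), ∃ (V : Opens (Sheets U E)) (hV : B ⊆ V) (s : Sec G V),
        gm G z (hV hz) s = g) → (A ∩ B).Nonempty →
      ∀ (z) (hz : z ∈ A) (g : Stk G z), ∃ (V : Opens (Sheets U E)) (hV : A ∪ B ⊆ V) (s : Sec G V),
        gm G z (hV (Or.inl hz)) s = g := by
    rintro A B hA hB hAB iA iB ⟨w, hw⟩ z hz g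
    obtain ⟨V, hV, s, hs⟩ := iA z hz g
    obtain ⟨V', hV', s', hs'⟩ := iB w hw.2 (gm G w (hV hw.1) s)
    obtain ⟨V'', r, hr, hr₁, -⟩ := exists_glue_compact G ⊤ hA.isCompact hB.isCompact
      (fun _ _ => trivial) (fun _ _ => trivial) hV hV' s s' (fun y _ _ h₁ h₂ =>
        hG.gm_eq_of_isPreconnected hAB.isPreconnected (fun x hx => hV hx.1) (fun x hx => hV' hx.2)
          s s' hw hs'.symm ⟨h₁, h₂⟩)
    exact ⟨V'', hr, r, (hr₁ z _ (hV hz) hz).trans hs⟩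
  refine bisection (sheetCoord U E) hK.isCompact (fun i => (continuous_sheetCoord i).continuousOn)
    hK.eq_of_sheetCoord IsConvexCompact (fun K => ∀ (z) (hz : z ∈ K) (g : Stk G z),
      ∃ (V : Opens (Sheets U E)) (hV : K ⊆ V) (s : Sec G V), gm G z (hV hz) s = g)
    (fun K' i c h => h.inter i isClosed_Iic (convex_Iic c))
    (fun K' i c h => h.inter i isClosed_Ici (convex_Ici c)) (fun z hz => absurd hz id) ?_ ?_ hK
  · intro x hx
    obtain ⟨N, hN, A, φ, hφ⟩ := hG x
    refine ⟨N, N.2, hN, fun K' _ hK' _ z hz g => ?_⟩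
    have := hφ z (hK' hz)
    obtain ⟨a, ha⟩ := (ConcreteCategory.bijective_of_isIso (φ ≫ G.presheaf.germ N z (hK' hz))).2 g
    exact ⟨N, hK', φ.hom a, ha⟩
  · intro K' i c hK' hQ h₁ h₂ z hz g
    have q₁ := hQ.inter i isClosed_Iic (convex_Iic c)
    have q₂ := hQ.inter i isClosed_Ici (convex_Ici c)
    have q₁₂ : (K' ∩ sheetCoord U E i ⁻¹' Set.Iic c) ∩ (K' ∩ sheetCoord U E i ⁻¹' Set.Ici c) =
        K' ∩ sheetCoord U E i ⁻¹' {c} := by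
      ext y
      simp only [Set.mem_inter_iff, Set.mem_preimage, Set.mem_Iic, Set.mem_Ici,
        Set.mem_singleton_iff]
      constructor
      · rintro ⟨⟨a, b⟩, -, d⟩; exact ⟨a, le_antisymm b d⟩
      · rintro ⟨a, b⟩; exact ⟨⟨a, b.le⟩, a, b.ge⟩
    have q₃ := hQ.inter i isClosed_singleton (convex_singleton c)
    -- If both halves are nonempty, the hyperplane meets `K'` by the intermediate value theorem.
    -- Otherwise one half is all of `K'`.
    have hc : ∀ x ∈ K', ∀ y ∈ K', sheetCoord U E i x ≤ c → c ≤ sheetCoord U E i y →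
        (K' ∩ sheetCoord U E i ⁻¹' {c}).Nonempty := by
      intro x hx y hy hxc hyc
      obtain ⟨w, hw, hwc⟩ := hQ.isPreconnected.intermediate_value hx hy
        (continuous_sheetCoord i).continuousOn ⟨hxc, hyc⟩
      exact ⟨w, hw, hwc⟩
    have hun : K' ⊆ (K' ∩ sheetCoord U E i ⁻¹' Set.Iic c) ∪
        (K' ∩ sheetCoord U E i ⁻¹' Set.Ici c) := fun y hy =>
      (le_total (sheetCoord U E i y) c).imp (fun h => ⟨hy, h⟩) fun h => ⟨hy, h⟩
    rcases hun hz with hz' | hz'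
    · by_cases hne : (K' ∩ sheetCoord U E i ⁻¹' Set.Ici c).Nonempty
      · obtain ⟨y, hy, hyc⟩ := hne
        obtain ⟨V, hV, s, hs⟩ := glue _ _ q₁ q₂ (q₁₂ ▸ q₃) h₁ h₂
          (q₁₂ ▸ hc z hz y hy hz'.2 hyc) z hz' g
        exact ⟨V, hun.trans hV, s, hs⟩
      · obtain ⟨V, hV, s, hs⟩ := h₁ z hz' g
        refine ⟨V, fun y hy => ?_, s, hs⟩
        rcases hun hy with h | h
        · exact hV h
        · exact absurd ⟨y, h⟩ hne
    · by_cases hne : (K' ∩ sheetCoord U E i ⁻¹' Set.Iic c).Nonempty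
      · obtain ⟨y, hy, hyc⟩ := hne
        obtain ⟨V, hV, s, hs⟩ := glue _ _ q₂ q₁ (by rw [Set.inter_comm, q₁₂]; exact q₃) h₂ h₁
          (by rw [Set.inter_comm, q₁₂]; exact hc y hy z hz hyc hz'.2) z hz' g
        exact ⟨V, hun.trans ((Set.union_comm _ _).subset.trans hV), s, hs⟩
      · obtain ⟨V, hV, s, hs⟩ := h₂ z hz' g
        refine ⟨V, fun y hy => ?_, s, hs⟩
        rcases hun hy with h | h
        · exact absurd ⟨y, h⟩ hne
        · exact hV h

/-- Germs of locally constant sheaves on the sheets extend to the sheets. -/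
lemma IsLocallyConstantSheaf.exists_sheet (hG : IsLocallyConstantSheaf G) (a : U) (x : E)
    (g : Stk G (⟨a, x⟩ : Sheets U E)) :
    ∃ s : Sec G (sheet a), gm G (⟨a, x⟩ : Sheets U E) (mem_sheet a x) s = g := by
  -- The germ extends near each of these balls. Two extensions agree on the smaller ball, which is
  -- connected, so they glue over the whole sheet.
  let K : ℕ → Set (Sheets U E) := fun n => smk a '' Metric.closedBall x n
  have hK : ∀ n, IsConvexCompact (K n) := fun n =>
    ⟨a, _, isCompact_closedBall _ _, convex_closedBall _ _, rfl⟩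
  have hxK : ∀ n, (⟨a, x⟩ : Sheets U E) ∈ K n := fun n =>
    ⟨x, Metric.mem_closedBall_self (by positivity), rfl⟩
  have hmono : Monotone K := fun m n h =>
    Set.image_mono (Metric.closedBall_subset_closedBall (by exact_mod_cast h))
  choose V hV s hs using fun n => hG.exists_near_convexCompact (hK n) _ (hxK n) g
  have hst : ∀ m n y (h₁ : y ∈ K m) (h₂ : y ∈ K n), gm G y (hV m h₁) (s m) =
      gm G y (hV n h₂) (s n) := by
    have : ∀ m n, m ≤ n → ∀ y (h₁ : y ∈ K m) (h₂ : y ∈ K n), gm G y (hV m h₁) (s m) =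
      gm G y (hV n h₂) (s n) := fun m n hmn y h₁ h₂ =>
        hG.gm_eq_of_isPreconnected (hK m).isPreconnected (hV m) ((hmono hmn).trans (hV n)) _ _
          (hxK m) ((hs m).trans (hs n).symm) h₁
    intro m n y h₁ h₂
    rcases le_total m n with h | h
    · exact this m n h y h₁ h₂
    · exact (this n m h y h₂ h₁).symm
  have hex : ∀ y, y ∈ sheet (E := E) a → ∃ n, ∃ W : Opens (Sheets U E), y ∈ W ∧
      (W : Set (Sheets U E)) ⊆ K n := by
    rintro _ ⟨y, -, rfl⟩
    obtain ⟨n, hn⟩ := exists_nat_gt (dist y x)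
    exact ⟨n, sheetOpen a (Metric.ball x n) Metric.isOpen_ball, ⟨y, hn, rfl⟩,
      Set.image_mono Metric.ball_subset_closedBall⟩
  choose n W hyW hWK using hex
  obtain ⟨t, ht⟩ := exists_gm_eq_of_local G (sheet a)
    (fun y hy => gm G y (hV _ (hWK y hy (hyW y hy))) (s (n y hy))) (by
    intro y hy
    refine ⟨W y hy, hyW y hy, rs G (fun z hz => hV _ (hWK y hy hz)) (s (n y hy)),
      fun z hz hz' => ?_⟩
    rw [gm_rs]
    exact hst _ _ z (hWK y hy hz) (hWK z hz' (hyW z hz')))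
  refine ⟨t, ?_⟩
  rw [ht]
  exact (hst _ 0 _ (hWK _ _ (hyW _ (mem_sheet a x))) (hxK 0)).trans (hs 0)

/-- Injectivity is the identity principle on a connected set; surjectivity holds because germs
extend to the whole sheet. -/
lemma IsLocallyConstantSheaf.gm_bijective (hG : IsLocallyConstantSheaf G)
    {C : Opens (Sheets U E)} (hC : IsCell C) (z : Sheets U E) (hz : z ∈ C) :
    Function.Bijective (gm G z hz) := by
  constructor
  · intro s t hst
    exact sec_ext _ fun y hy => hG.gm_eq_of_isPreconnected hC.isPreconnected subset_rfl subset_rfl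
      s t hz hst hy
  · intro g
    obtain ⟨a, D, hD, -, -, rfl⟩ := hC
    obtain ⟨x, hx, rfl⟩ := id hz
    obtain ⟨s, hs⟩ := hG.exists_sheet a x g
    exact ⟨rs G (sheetOpen_le_sheet hD) s, by rw [gm_rs]; exact hs⟩

lemma IsLocallyConstantSheaf.rs_bijective (hG : IsLocallyConstantSheaf G)
    {C C' : Opens (Sheets U E)} (hC : IsCell C) (hC' : IsCell C') (h : C' ≤ C) :
    Function.Bijective (rs G h) := by
  have hz : ∃ z, z ∈ C' := by
    obtain ⟨a, D, hD, -, ⟨x, hx⟩, rfl⟩ := hC'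
    exact ⟨_, x, hx, rfl⟩
  obtain ⟨z, hz⟩ := hz
  have h₁ := hG.gm_bijective hC' z hz
  have h₂ := hG.gm_bijective hC z (h hz)
  refine (Function.Bijective.of_comp_iff' h₁ _).1 ?_
  convert h₂ using 1
  funext s
  exact gm_rs G h z hz s

/-- Extend over the sheet containing `K`, and by zero over the other sheets. -/
lemma IsLocallyConstantSheaf.convexExtends (hG : IsLocallyConstantSheaf G) : ConvexExtends G := by
  classical
  intro K hK V s hKV
  rcases K.eq_empty_or_nonempty with rfl | ⟨z, hz⟩
  · exact ⟨0, fun z _ _ h => absurd h id⟩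
  have hK' := hK
  obtain ⟨a, D, -, -, rfl⟩ := hK'
  obtain ⟨x, hx, rfl⟩ := hz
  obtain ⟨t, ht⟩ := hG.exists_sheet a x (gm G _ (hKV ⟨x, hx, rfl⟩) s)
  obtain ⟨t', ht'⟩ := exists_gm_eq_of_local G ⊤
    (fun y _ => if hy : y ∈ sheet (E := E) a then gm G y hy t else 0) (by
      rintro ⟨b, y⟩ -
      by_cases hb : b = a
      · subst hb
        exact ⟨sheet b, mem_sheet b y, t, fun z hz _ => by rw [dif_pos hz]⟩
      · refine ⟨sheet b, mem_sheet b y, 0, fun z hz _ => ?_⟩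
        rw [map_zero, dif_neg]
        rintro ⟨z, -, rfl⟩
        obtain ⟨z', -, h⟩ := hz
        exact hb (congrArg Sigma.fst h))
  refine ⟨t', ?_⟩
  rintro y hV hW ⟨y, hy, rfl⟩
  refine (ht' _ _).trans ((dif_pos (mem_sheet a y)).trans ?_)
  exact hG.gm_eq_of_isPreconnected hK.isPreconnected
    (U := sheet a) (by rintro _ ⟨y, -, rfl⟩; exact mem_sheet a y) hKV t s ⟨x, hx, rfl⟩ ht
    ⟨y, hy, rfl⟩

/-- Morphisms from a locally constant sheaf are given by linear maps of sections over the
sheets. -/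
lemma IsLocallyConstantSheaf.exists_hom_of_sheets (hG : IsLocallyConstantSheaf G)
    (H : Sh (Sheets U E)) (l : ∀ a, Sec G (sheet a) →ₗ[ℂ] Sec H (sheet a)) :
    ∃ f : G ⟶ H, ∀ a s, sm f (sheet a) s = l a s := by
  let e : ∀ z : Sheets U E, Sec G (sheet z.1) ≃ₗ[ℂ] Stk G z := fun z =>
    LinearEquiv.ofBijective (gm G z (mem_sheet z.1 z.2))
      (hG.gm_bijective (isCell_sheet z.1) z (mem_sheet z.1 z.2))
  have he : ∀ z : Sheets U E, ∀ s, e z s = gm G z (mem_sheet z.1 z.2) s := fun z s => rfl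
  obtain ⟨f, hf⟩ := exists_hom_of_stalks (F := G) (G := H)
    (fun z => gm H z (mem_sheet z.1 z.2) ∘ₗ l z.1 ∘ₗ (e z).symm.toLinearMap) (by
    rintro V s ⟨a, x⟩ hz
    obtain ⟨t, ht⟩ := hG.exists_sheet a x (gm G _ hz s)
    obtain ⟨r, hr, hrV⟩ := exists_ball_le V a x hz
    refine ⟨sheetOpen a (Metric.ball x r) Metric.isOpen_ball, ⟨x, Metric.mem_ball_self hr, rfl⟩,
      rs H (sheetOpen_le_sheet _) (l a t), ?_⟩
    rintro ⟨b, y⟩ hy hyV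
    obtain rfl := eq_of_mem_sheetOpen hy
    rw [gm_rs]
    change _ = gm H _ _ (l b ((e ⟨b, y⟩).symm _))
    congr 2
    rw [LinearEquiv.eq_symm_apply, he]
    exact hG.gm_eq_of_isPreconnected
      (A := (sheetOpen b (Metric.ball x r) Metric.isOpen_ball : Opens (Sheets U E)))
      (IsCell.isPreconnected ⟨b, _, _, convex_ball _ _, ⟨x, Metric.mem_ball_self hr⟩, rfl⟩)
      (sheetOpen_le_sheet _) hrV t s ⟨x, Metric.mem_ball_self hr, rfl⟩ ht hy)
  refine ⟨f, fun a s => sec_ext H ?_⟩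
  rintro ⟨b, x⟩ hx
  obtain rfl := eq_of_mem_sheetOpen hx
  rw [← km_gm, hf]
  change gm H _ _ (l b ((e ⟨b, x⟩).symm _)) = _
  congr 2
  rw [LinearEquiv.symm_apply_eq, he]

lemma IsLocallyConstantSheaf.hom_ext (hG : IsLocallyConstantSheaf G)
    {H : Sh (Sheets U E)} {f g : G ⟶ H} (h : ∀ a s, sm f (sheet a) s = sm g (sheet a) s) :
    f = g := by
  refine km_hom_ext ?_
  rintro ⟨a, x⟩ t
  obtain ⟨s, rfl⟩ := hG.exists_sheet a x t
  rw [km_gm, km_gm, h]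

/-- Morphisms to a locally constant sheaf on the sheets extend along monomorphisms of locally
constant sheaves. -/
lemma IsLocallyConstantSheaf.exists_extension {A B : Sh (Sheets U E)}
    (hA : IsLocallyConstantSheaf A) (hB : IsLocallyConstantSheaf B) (H : Sh (Sheets U E))
    (i : A ⟶ B) [Mono i] (f : A ⟶ H) : ∃ g : B ⟶ H, i ≫ g = f := by
  -- Sheet by sheet this is a question about vector spaces, where monomorphisms split.
  choose r hr using fun a => (sm i (sheet a)).exists_leftInverse_of_injective
    (LinearMap.ker_eq_bot.2 (sm_injective i (sheet a)))
  obtain ⟨g, hg⟩ := hB.exists_hom_of_sheets H fun a => sm f (sheet a) ∘ₗ r a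
  refine ⟨g, hA.hom_ext fun a s => ?_⟩
  rw [sm_comp, hg]
  exact congrArg (sm f (sheet a)) (LinearMap.congr_fun (hr a) s)

/-- Morphisms from a locally constant sheaf on the sheets lift. -/
lemma IsLocallyConstantSheaf.exists_lift (hG : IsLocallyConstantSheaf G)
    {S : ShortComplex (Sh (Sheets U E))} (hS : S.ShortExact)
    (hJ : Flasque S.X₂) (hX : ConvexExtends S.X₁) (f : G ⟶ S.X₃) : ∃ g : G ⟶ S.X₂, g ≫ S.g = f := by
  -- A whole sheet is a cell, so sections over it lift; vector spaces being projective, the lift can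
  -- be chosen linearly.
  choose r hr using fun a => Module.projective_lifting_property (sm S.g (sheet a))
    (sm f (sheet a)) (sm_surjective_of_isCell hS hJ hX (isCell_sheet a))
  obtain ⟨g, hg⟩ := hG.exists_hom_of_sheets S.X₂ r
  refine ⟨g, hG.hom_ext fun a s => ?_⟩
  rw [sm_comp, hg]
  exact LinearMap.congr_fun (hr a) s

end LocallyConstant

end Sheets

end

end Toric

namespace Toric

noncomputable section

/-! ### Disjoint unions of cells -/

section GoodPair

variable {U : Type} {E : Type} [NormedAddCommGroup E] [NormedSpace ℝ E]

/-- `D` is a disjoint union of cells, and `D'` is the union of smaller cells, one in each of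
those. -/
def GoodPair (D' D : Opens (Sheets U E)) : Prop :=
  ∃ (I : Type) (C C' : I → Opens (Sheets U E)), (∀ k, IsCell (C k)) ∧ (∀ k, IsCell (C' k)) ∧
    (∀ k, C' k ≤ C k) ∧ Pairwise (fun k l => Disjoint (C k : Set (Sheets U E)) (C l)) ∧
    D = ⨆ k, C k ∧ D' = ⨆ k, C' k

lemma GoodPair.le {D' D : Opens (Sheets U E)} (h : GoodPair D' D) : D' ≤ D := by
  obtain ⟨I, C, C', -, -, h, -, rfl, rfl⟩ := h
  exact iSup_mono h

lemma GoodPair.left {D' D : Opens (Sheets U E)} (h : GoodPair D' D) : GoodPair D' D' := by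
  obtain ⟨I, C, C', -, h₁, h, hd, rfl, rfl⟩ := h
  exact ⟨I, C', C', h₁, h₁, fun _ => le_rfl, fun k l hkl => (hd hkl).mono (h k) (h l), rfl, rfl⟩

/-- Sections over a disjoint union. -/
lemma exists_sec_iSup {Y : TopCat.{0}} (F : Sh Y) {I : Type} (C : I → Opens Y)
    (hC : Pairwise fun k l => Disjoint (C k : Set Y) (C l)) (s : ∀ k, Sec F (C k)) :
    ∃ t : Sec F (⨆ k, C k), ∀ k, rs F (le_iSup C k) t = s k := by
  have hk : ∀ z, z ∈ ⨆ k, C k → ∃ k, z ∈ C k := fun z hz => Opens.mem_iSup.1 hz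
  choose k hk using hk
  have hu : ∀ z (hz : z ∈ ⨆ k, C k) l (hl : z ∈ C l), gm F z (hk z hz) (s (k z hz)) =
      gm F z hl (s l) := by
    intro z hz l hl
    have hkl : k z hz = l := by
      by_contra h
      exact Set.disjoint_left.1 (hC h) (hk z hz) hl
    subst hkl
    rfl
  obtain ⟨t, ht⟩ := exists_gm_eq_of_local F (⨆ k, C k) (fun z hz => gm F z (hk z hz) (s (k z hz)))
    (fun z hz => ⟨C (k z hz), hk z hz, s (k z hz), fun y hy hy' => (hu y hy' _ hy).symm⟩)
  refine ⟨t, fun l => sec_ext F fun z hz => ?_⟩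
  rw [gm_rs, ht, hu z _ l hz]

lemma sec_iSup_ext {Y : TopCat.{0}} (F : Sh Y) {I : Type} (C : I → Opens Y)
    {s t : Sec F (⨆ k, C k)} (h : ∀ k, rs F (le_iSup C k) s = rs F (le_iSup C k) t) : s = t := by
  refine sec_ext F fun z hz => ?_
  obtain ⟨k, hk⟩ := Opens.mem_iSup.1 hz
  rw [← gm_rs F (le_iSup C k) z hk, h, gm_rs]

lemma IsCell.le_or_disjoint {C : Opens (Sheets U E)} (h : IsCell C) (P : Set U) :
    (∀ z ∈ C, z.1 ∈ P) ∨ ∀ z ∈ C, z.1 ∉ P := by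
  obtain ⟨a, D, hD, -, -, rfl⟩ := h
  by_cases ha : a ∈ P
  · left; rintro ⟨b, y⟩ hb; rwa [eq_of_mem_sheetOpen hb]
  · right; rintro ⟨b, y⟩ hb; rwa [eq_of_mem_sheetOpen hb]

/-- Good pairs can be restricted to some of the sheets. -/
lemma GoodPair.restrict {D' D : Opens (Sheets U E)} (h : GoodPair D' D) (P : Set U)
    {D₁' D₁ : Opens (Sheets U E)} (h' : ∀ z, z ∈ D₁' ↔ z ∈ D' ∧ z.1 ∈ P)
    (h₁ : ∀ z, z ∈ D₁ ↔ z ∈ D ∧ z.1 ∈ P) : GoodPair D₁' D₁ := by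
  obtain ⟨I, C, C', hC, hC', h, hd, rfl, rfl⟩ := h
  refine ⟨{k : I // ∀ z ∈ C k, z.1 ∈ P}, fun k => C k.1, fun k => C' k.1, fun k => hC _,
    fun k => hC' _, fun k => h _, fun k l hkl => hd fun h => hkl (Subtype.ext h), ?_, ?_⟩
  · ext z
    simp only [SetLike.mem_coe, h₁, Opens.mem_iSup]
    constructor
    · rintro ⟨⟨k, hk⟩, hz⟩
      rcases (hC k).le_or_disjoint P with h | h
      · exact ⟨⟨k, h⟩, hk⟩
      · exact absurd hz (h z hk)
    · rintro ⟨⟨k, hk⟩, hz⟩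
      exact ⟨⟨k, hz⟩, hk z hz⟩
  · ext z
    simp only [SetLike.mem_coe, h', Opens.mem_iSup]
    constructor
    · rintro ⟨⟨k, hk⟩, hz⟩
      rcases (hC k).le_or_disjoint P with h' | h'
      · exact ⟨⟨k, h'⟩, hk⟩
      · exact absurd hz (h' z (h k hk))
    · rintro ⟨⟨k, hk⟩, hz⟩
      exact ⟨⟨k, hz⟩, hk z (h k hz)⟩

variable [FiniteDimensional ℝ E]

lemma GoodPair.sm_surjective {D' D : Opens (Sheets U E)} (h : GoodPair D' D)
    {S : ShortComplex (Sh (Sheets U E))} (hS : S.ShortExact)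
    (hJ : Flasque S.X₂) (hG : ConvexExtends S.X₁) : Function.Surjective (sm S.g D) := by
  obtain ⟨I, C, C', hC, -, -, hd, rfl, -⟩ := h
  intro s
  choose t ht using fun k => sm_surjective_of_isCell hS hJ hG (hC k) (rs _ (le_iSup C k) s)
  obtain ⟨t', ht'⟩ := exists_sec_iSup S.X₂ C hd t
  exact ⟨t', sec_iSup_ext _ C fun k => by rw [← sm_rs, ht', ht]⟩

/-- On each component this is restriction from a cell to a smaller one. It is essential that no cell
of `D` is missed by `D'`. -/
lemma GoodPair.rs_bijective {D' D : Opens (Sheets U E)} (h : GoodPair D' D)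
    {G : Sh (Sheets U E)} (hG : IsLocallyConstantSheaf G) : Function.Bijective (rs G h.le) := by
  have hle := h.le
  change Function.Bijective (rs G hle)
  obtain ⟨I, C, C', hC, hC', h, hd, rfl, rfl⟩ := h
  constructor
  · intro s t hst
    refine sec_iSup_ext _ C fun k => (hG.rs_bijective (hC k) (hC' k) (h k)).1 ?_
    rw [rs_rs, rs_rs, ← rs_rs G hle (le_iSup C' k), hst, rs_rs]
  · intro s
    choose t ht using fun k => (hG.rs_bijective (hC k) (hC' k) (h k)).2 (rs _ (le_iSup C' k) s)
    obtain ⟨t', ht'⟩ := exists_sec_iSup G C hd t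
    refine ⟨t', sec_iSup_ext _ C' fun k => ?_⟩
    rw [← ht k, ← ht' k, rs_rs, rs_rs]

end GoodPair

/-! ### Coverings by sheets: injectives of LC and the equivalence -/

section Cover

variable {U : Type} {E : Type} [NormedAddCommGroup E] [NormedSpace ℝ E]

/-- Neighbourhoods of the points of `O` in `Y` whose inverse images in the sheets decompose into
cells. -/
def NiceAlong {Y O : TopCat.{0}} (q : Sheets U E ⟶ Y) (i : O ⟶ Y) : Prop :=
  ∀ x : O, ∃ W : Opens Y, i x ∈ W ∧ ∀ y : O, i y ∈ W → ∀ V : Opens Y, i y ∈ V →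
    ∃ W' : Opens Y, i y ∈ W' ∧ W' ≤ W ∧ W' ≤ V ∧
      GoodPair ((Opens.map q).obj W') ((Opens.map q).obj W)

/-- An open set whose inverse image in the sheets is a disjoint union of cells. -/
def GoodOpen {Y : TopCat.{0}} (q : Sheets U E ⟶ Y) (W : Opens Y) : Prop :=
  GoodPair ((Opens.map q).obj W) ((Opens.map q).obj W)

lemma NiceAlong.exists_goodOpen {Y O : TopCat.{0}} {q : Sheets U E ⟶ Y} {i : O ⟶ Y}
    (h : NiceAlong q i) (x : O) (V : Opens Y) (hV : i x ∈ V) :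
    ∃ W : Opens Y, i x ∈ W ∧ W ≤ V ∧ GoodOpen q W := by
  obtain ⟨W, hx, hW⟩ := h x
  obtain ⟨W', hx', -, hV', hg⟩ := hW x hx V hV
  exact ⟨W', hx', hV', hg.left⟩

/-- The open sets of `Y` are traces of open sets of `X`, and a trace has the same inverse image on
the sheets. This transfers the local structure from X to its invariant subspaces. -/
lemma NiceAlong.of_comp {Y X O : TopCat.{0}} {q : Sheets U E ⟶ Y} {i : O ⟶ Y} {j : Y ⟶ X}
    (hj : Topology.IsInducing j) (h : NiceAlong (q ≫ j) (i ≫ j)) : NiceAlong q i := by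
  intro x
  obtain ⟨W, hx, hW⟩ := h x
  refine ⟨(Opens.map j).obj W, hx, fun y hy V hV => ?_⟩
  obtain ⟨V', hV', hVV⟩ := hj.isOpen_iff.1 V.2
  obtain ⟨W', h₁, h₂, h₃, h₄⟩ := hW y hy ⟨V', hV'⟩ (by
    have : i y ∈ j ⁻¹' V' := by rw [hVV]; exact hV
    exact this)
  refine ⟨(Opens.map j).obj W', h₁, fun z hz => h₂ hz, fun z hz => ?_, h₄⟩
  have : z ∈ j ⁻¹' V' := h₃ hz
  rw [hVV] at this
  exact this

variable [FiniteDimensional ℝ E]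

/-- Direct images of locally constant sheaves on the sheets are locally constant along the
orbits. -/
lemma NiceAlong.isLocallyConstantSheaf_push {Y O : TopCat.{0}} {q : Sheets U E ⟶ Y} {i : O ⟶ Y}
    (h : NiceAlong q i) {G : Sh (Sheets U E)} (hG : IsLocallyConstantSheaf G) :
    IsLocallyConstantSheaf ((pull i).obj ((push q).obj G)) := by
  rw [isLocallyConstantSheaf_pull_iff]
  refine locConstAlong_of_bijective i _ fun x => ?_
  obtain ⟨W, hx, hW⟩ := h x
  refine ⟨W, hx, fun y hy => gm_bijective_of_rs_bijective _ hy fun V hV => ?_⟩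
  obtain ⟨W', h₁, h₂, h₃, h₄⟩ := hW y hy V hV
  exact ⟨W', h₁, h₂, h₃, h₄.rs_bijective hG⟩

/-- The inverse image on the sheets is locally constant if the sheets map to orbits. -/
lemma isLocallyConstantSheaf_pull_sheets {Y : TopCat.{0}} {A : Type} {O : A → TopCat.{0}}
    {i : ∀ a, O a ⟶ Y} (q : Sheets U E ⟶ Y)
    (hq : ∀ u : U, ∃ (a : A) (ρ : E → O a), Continuous ρ ∧ ∀ x, i a (ρ x) = q ⟨u, x⟩)
    (F : Sh Y) (hF : locConstOn i F) : IsLocallyConstantSheaf ((pull q).obj F) := by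
  rw [isLocallyConstantSheaf_pull_iff]
  rintro ⟨u, x⟩
  obtain ⟨a, ρ, hρ, h⟩ := hq u
  refine LocConstAlong.of_factor ((isLocallyConstantSheaf_pull_iff (i a) F).1 (hF a)) q
    (fun z => ρ z.2) ⟨u, x⟩ (sheet u) (mem_sheet u x) ?_ ?_
  · exact (continuous_sigma fun _ => hρ : Continuous fun z : Σ _ : U, E => ρ z.2).continuousOn
  · rintro ⟨b, y⟩ hb
    obtain rfl := eq_of_mem_sheetOpen hb
    exact h y

/-- Inverse image is an isomorphism on stalks, so a section with zero inverse image has zero germs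
at all points in the image of `q`. -/
lemma mono_pullUnit {Z Y : TopCat.{0}} (q : Z ⟶ Y) (hq : Function.Surjective q) (F : Sh Y) :
    Mono (pullUnit q F) := by
  refine mono_of_km_injective _ fun y => ?_
  rw [injective_iff_map_eq_zero]
  intro t ht
  obtain ⟨V, -, hz, s, rfl⟩ := exists_gm_eq F t (V := ⊤) trivial
  rw [km_gm] at ht
  have h0 : gm ((push q).obj ((pull q).obj F)) y hz (sm (pullUnit q F) V s) =
    gm ((push q).obj ((pull q).obj F)) y hz 0 := by rw [ht, map_zero]
  obtain ⟨W, hW, h₁, h₂, h⟩ := exists_rs_eq_of_gm_eq _ h0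
  have h' : psec q F W (rs F h₁ s) = 0 := by
    rw [map_zero, ← sm_rs] at h
    exact h
  rw [← gm_rs F h₁ y hW]
  obtain ⟨z, rfl⟩ := hq y
  refine (pstk q F z).injective ?_
  rw [pstk_gm, h', map_zero, map_zero]

variable {Y : TopCat.{0}} {A : Type} {O : A → TopCat.{0}} (i : ∀ a, O a ⟶ Y)

/-- A covering of `Y` by sheets adapted to the orbits. -/
structure OrbitCover (q : Sheets U E ⟶ Y) : Prop where
  surjective : Function.Surjective q
  factor : ∀ u : U, ∃ (a : A) (ρ : E → O a), Continuous ρ ∧ ∀ x, i a (ρ x) = q ⟨u, x⟩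
  nice : ∀ a, NiceAlong q (i a)

variable {i} {q : Sheets U E ⟶ Y}

lemma OrbitCover.exists_goodOpen (hq : OrbitCover i q) (y : Y) (V : Opens Y) (hV : y ∈ V) :
    ∃ W : Opens Y, y ∈ W ∧ W ≤ V ∧ GoodOpen q W := by
  obtain ⟨⟨u, x⟩, rfl⟩ := hq.surjective y
  obtain ⟨a, ρ, -, h⟩ := hq.factor u
  rw [← h] at hV ⊢
  exact (hq.nice a).exists_goodOpen (ρ x) V hV

lemma OrbitCover.locConstOn_push (hq : OrbitCover i q) {G : Sh (Sheets U E)}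
    (hG : IsLocallyConstantSheaf G) : locConstOn i ((push q).obj G) :=
  fun a => (hq.nice a).isLocallyConstantSheaf_push hG

lemma OrbitCover.pull (hq : OrbitCover i q) {F : Sh Y} (hF : locConstOn i F) :
    IsLocallyConstantSheaf ((pull q).obj F) :=
  isLocallyConstantSheaf_pull_sheets q hq.factor F hF

/-- The adjunction between inverse and direct images. -/
abbrev pullPushAdj {Z Y : TopCat.{0}} (q : Z ⟶ Y) : pull q ⊣ push q :=
  TopCat.Sheaf.pullbackPushforwardAdjunction (ModuleCat.{0} ℂ) q

instance {Z Y : TopCat.{0}} (q : Z ⟶ Y) : PreservesFiniteLimits (push q) :=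
  ⟨fun J _ _ => (pullPushAdj q).rightAdjoint_preservesLimits.preservesLimitsOfShape⟩

/-- Right exactness is local, and over good open sets it is the lifting of sections over disjoint
unions of cells. -/
lemma shortExact_push
    (h : ∀ (y : Y) (V : Opens Y), y ∈ V → ∃ W : Opens Y, y ∈ W ∧ W ≤ V ∧ GoodOpen q W)
    {S : ShortComplex (Sh (Sheets U E))} (hS : S.ShortExact)
    (hJ : Flasque S.X₂) (hG : ConvexExtends S.X₁) : (S.map (push q)).ShortExact where
  mono_f := by
    have := hS.mono_f
    exact inferInstanceAs (Mono ((push q).map S.f))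
  epi_g := by
    refine epi_of_locally_surjective _ fun z V hz => ?_
    obtain ⟨W, hz, hW, hg⟩ := h z V hz
    exact ⟨W, hz, hW, hg.sm_surjective hS hJ hG⟩
  exact := by
    have := hS.mono_f
    exact hS.exact.map_of_mono_of_preservesKernel (push q) inferInstance inferInstance

open Abelian in
-- Dimension shifting along an injective embedding on the sheets: its direct image is again an
-- injective embedding, the cokernel still satisfies `ConvexExtends`, and `hP` kills the obstruction
-- in degree one.
lemma subsingleton_ext_push [HasExt.{0} (Sh Y)]
    (h : ∀ (y : Y) (V : Opens Y), y ∈ V → ∃ W : Opens Y, y ∈ W ∧ W ≤ V ∧ GoodOpen q W)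
    (P : Sh Y) (hP : ∀ S : ShortComplex (Sh (Sheets U E)), S.ShortExact → Flasque S.X₂ →
      ConvexExtends S.X₁ → ∀ ψ : P ⟶ (push q).obj S.X₃, ∃ φ, φ ≫ (push q).map S.g = ψ)
    (G : Sh (Sheets U E)) (hG : ConvexExtends G) (n : ℕ) :
    Subsingleton (Ext.{0} P ((push q).obj G) (n + 1)) := by
  refine ext_subsingleton_of_cosyzygies P (fun Q => ∃ G, ConvexExtends G ∧ Q = (push q).obj G)
    ?_ _ ⟨G, hG, rfl⟩ n
  rintro _ ⟨G, hG, rfl⟩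
  let S : ShortComplex (Sh (Sheets U E)) :=
    ShortComplex.mk (Injective.ι G) (cokernel.π (Injective.ι G)) (cokernel.condition _)
  have hS : S.ShortExact :=
    { exact := ShortComplex.exact_of_g_is_cokernel _ (cokernelIsCokernel _)
      mono_f := inferInstanceAs (Mono (Injective.ι G))
      epi_g := inferInstanceAs (Epi (cokernel.π (Injective.ι G))) }
  have hJ : Flasque S.X₂ := flasque_of_injective (Injective.under G)
  refine ⟨_, _, (push q).map S.f, (push q).map S.g, _, shortExact_push h hS hJ hG,
    Injective.injective_of_adjoint (pullPushAdj q) (Injective.under G),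
    ⟨_, hG.of_shortExact hS hJ, rfl⟩, hP S hS hJ hG⟩

/-- By adjunction the lifting problem moves to the sheets, where its source is locally constant. So
sheaves in LC are admissible test objects. -/
lemma exists_lift_push_of_locConst {F : Sh Y} (hF : IsLocallyConstantSheaf ((pull q).obj F))
    (S : ShortComplex (Sh (Sheets U E))) (hS : S.ShortExact) (hJ : Flasque S.X₂)
    (hG : ConvexExtends S.X₁) (ψ : F ⟶ (push q).obj S.X₃) : ∃ φ, φ ≫ (push q).map S.g = ψ := by
  obtain ⟨g, hg⟩ := hF.exists_lift hS hJ hG (((pullPushAdj q).homEquiv _ _).symm ψ)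
  refine ⟨(pullPushAdj q).homEquiv _ _ g, ?_⟩
  rw [← Adjunction.homEquiv_naturality_right, hg, Equiv.apply_symm_apply]

variable [∀ a, LocallyConnectedSpace (O a)]

/-- The direct image of a locally constant sheaf on the sheets, as an object of `LC`. -/
abbrev OrbitCover.pushObj (hq : OrbitCover i q) {G : Sh (Sheets U E)}
    (hG : IsLocallyConstantSheaf G) : LCOn i := ⟨(push q).obj G, hq.locConstOn_push hG⟩

/-- By adjunction and exactness of the inverse image, this becomes the extension of morphisms
between locally constant sheaves on the sheets, a problem on families of vector spaces. -/
lemma OrbitCover.injective_pushObj (hq : OrbitCover i q) {G : Sh (Sheets U E)}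
    (hG : IsLocallyConstantSheaf G) : Injective (hq.pushObj hG) where
  factors {A B} g f _ := by
    have : Mono f.hom := inferInstanceAs (Mono ((locConstOn i).ι.map f))
    have : Mono ((Toric.pull q).map f.hom) := inferInstance
    obtain ⟨h, hh⟩ := IsLocallyConstantSheaf.exists_extension (hq.pull A.property)
      (hq.pull B.property) G ((Toric.pull q).map f.hom)
      (((pullPushAdj q).homEquiv _ _).symm g.hom)
    refine ⟨ObjectProperty.homMk ((pullPushAdj q).homEquiv _ _ h), ?_⟩
    apply (locConstOn i).hom_ext
    change f.hom ≫ (pullPushAdj q).homEquiv _ _ h = g.hom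
    rw [← Adjunction.homEquiv_naturality_left, hh, Equiv.apply_symm_apply]

/-- The embedding of a sheaf in the direct image of its inverse image on the sheets. -/
abbrev OrbitCover.unit (hq : OrbitCover i q) (F : LCOn i) : F ⟶ hq.pushObj (hq.pull F.property) :=
  ObjectProperty.homMk (pullUnit q F.obj)

instance OrbitCover.mono_unit (hq : OrbitCover i q) (F : LCOn i) : Mono (hq.unit F) := by
  have : Mono ((locConstOn i).ι.map (hq.unit F)) := mono_pullUnit q hq.surjective F.obj
  exact (locConstOn i).ι.mono_of_mono_map this

lemma OrbitCover.enoughInjectives (hq : OrbitCover i q) : EnoughInjectives (LCOn i) :=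
  ⟨fun F => ⟨{ J := hq.pushObj (hq.pull F.property)
               injective := hq.injective_pushObj _
               f := hq.unit F }⟩⟩

/-- Injective objects of `LC` are direct summands of direct images from the sheets. -/
lemma OrbitCover.exists_retract (hq : OrbitCover i q) (I : LCOn i) [Injective I] :
    Nonempty (Retract I.obj ((push q).obj ((Toric.pull q).obj I.obj))) := by
  refine ⟨Retract.map { i := hq.unit I, r := Injective.factorThru (𝟙 I) (hq.unit I) }
    (locConstOn i).ι⟩

open Abelian in
-- Used with three kinds of test objects: the sheaves in LC for the equivalence, `freeSh` for direct
-- images and `suppSh` for sections with support. Each only has to satisfy the lifting property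
-- `hP`.
lemma OrbitCover.extAcyclic (hq : OrbitCover i q) [HasExt.{0} (Sh Y)] {κ : Type} (P : κ → Sh Y)
    (hP : ∀ k, ∀ S : ShortComplex (Sh (Sheets U E)), S.ShortExact → Flasque S.X₂ →
      ConvexExtends S.X₁ → ∀ ψ : P k ⟶ (push q).obj S.X₃, ∃ φ, φ ≫ (push q).map S.g = ψ)
    (I : LCOn i) [Injective I] : ExtAcyclic P I.obj := by
  obtain ⟨r⟩ := hq.exists_retract I
  refine ExtAcyclic.of_retract (X₁ := (push q).obj ((Toric.pull q).obj I.obj)) (fun k n => ?_) r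
  exact subsingleton_ext_push hq.exists_goodOpen (P k) (hP k) _
    (hq.pull I.property).convexExtends n

theorem OrbitCover.isEquivalence (hq : OrbitCover i q) [HasDerivedCategory.{w} (LCOn i)]
    [HasDerivedCategory.{w} (Sh Y)] : (naturalFunctor i).IsEquivalence := by
  have := hq.enoughInjectives
  have : HasExt.{0} (Sh Y) := hasExt_of_enoughInjectives _
  refine naturalFunctor_isEquivalence i fun F I _ n => ?_
  exact hq.extAcyclic (fun _ : Unit => F.obj)
    (fun _ => exists_lift_push_of_locConst (hq.pull F.property)) I () n

end Cover

end

end Toric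

namespace Toric

noncomputable section

/-! ### Exactness of complexes tested on sections -/

section

variable {Y : TopCat.{0}}

/-- A complex of sheaves is exact if the complexes of sections over a basis are. -/
lemma exactAt_of_sections (K : CochainComplex (Sh Y) ℤ) (n : ℤ)
    (h : ∀ (z : Y) (U : Opens Y), z ∈ U → ∃ V : Opens Y, z ∈ V ∧ V ≤ U ∧
      ∀ s : Sec (K.X (n + 1)) V, sm (K.d (n + 1) (n + 2)) V s = 0 →
        ∃ t, sm (K.d n (n + 1)) V t = s) : K.ExactAt (n + 1) := by
  rw [K.exactAt_iff' n (n + 1) (n + 2) (by simp) (by simp; ring)]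
  refine exact_of_stalks fun z t ht => ?_
  change Stk (K.X (n + 1)) z at t
  obtain ⟨U, -, hz, s, rfl⟩ := exists_gm_eq (K.X (n + 1)) t (V := ⊤) trivial
  have h0 : gm (K.X (n + 2)) z hz (sm (K.d (n + 1) (n + 2)) U s) = gm (K.X (n + 2)) z hz 0 := by
    rw [← km_gm, map_zero]
    exact ht
  obtain ⟨W, hzW, h₁, h₂, hW⟩ := exists_rs_eq_of_gm_eq _ h0
  obtain ⟨V, hzV, hVW, hV⟩ := h z W hzW
  obtain ⟨r, hr⟩ := hV (rs _ (hVW.trans h₁) s) (by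
    rw [sm_rs, ← rs_rs _ h₁ hVW, hW, map_zero, map_zero])
  refine ⟨gm (K.X n) z hzV r, ?_⟩
  refine (km_gm (K.d n (n + 1)) z hzV r).trans ?_
  rw [hr, gm_rs]

/-- `W` is a locally compact, σ-compact Hausdorff space with an injective continuous map
to `ℝ^d`. -/
def Embeddable (d : ℕ) (W : Opens Y) : Prop :=
  T2Space W ∧ WeaklyLocallyCompactSpace W ∧ SigmaCompactSpace W ∧ ∃ φ : Fin d → Y → ℝ,
    (∀ i, ContinuousOn (φ i) W) ∧ ∀ x ∈ W, ∀ y ∈ W, (∀ i, φ i x = φ i y) → x = y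

lemma Embeddable.exists_d_eq {d : ℕ} {W : Opens Y} (h : Embeddable d W)
    (J : CochainComplex (Sh Y) ℤ) (hJ : ∀ n, Injective (J.X n)) (b : ℤ)
    (hb : ∀ n > b, J.ExactAt n) (m : ℤ) (hm : b + d < m) (s : Sec (J.X (m + 1)) W)
    (hs : sm (J.d (m + 1) (m + 2)) W s = 0) : ∃ t, sm (J.d m (m + 1)) W t = s := by
  obtain ⟨_, _, _, φ, hφ, hi⟩ := h
  exact exists_d_eq_of_embedding J (fun n => flasque_of_injective _) b hb hφ hi m (by simpa) s hs

end

/-! ### Direct images -/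

section LeftExact

variable {U : Type} {E : Type} [NormedAddCommGroup E] [NormedSpace ℝ E] [FiniteDimensional ℝ E]
  {Y Z : TopCat.{0}} {A B : Type} {O : A → TopCat.{0}} {O' : B → TopCat.{0}}
  {i : ∀ a, O a ⟶ Y} {i' : ∀ b, O' b ⟶ Z} [∀ a, LocallyConnectedSpace (O a)]
  [∀ b, LocallyConnectedSpace (O' b)] {q : Sheets U E ⟶ Y}

/-- Left exact functors preserve local constancy on orbits if they do so for direct images from the
sheets. -/
lemma OrbitCover.locConstOn_obj (hq : OrbitCover i q) (G : Sh Y ⥤ Sh Z) [G.Additive]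
    [PreservesFiniteLimits G] (hG : ∀ H : Sh (Sheets U E), IsLocallyConstantSheaf H →
      locConstOn i' (G.obj ((push q).obj H))) (F : Sh Y) (hF : locConstOn i F) :
    locConstOn i' (G.obj F) := by
  -- Two steps of the resolution by direct images present `F` as the kernel of a morphism between
  -- direct images from the sheets, and `G` preserves this kernel.
  let f := pullUnit q F
  have : Mono f := mono_pullUnit q hq.surjective F
  have hC : locConstOn i (cokernel f) := (locConstOn i).prop_cokernel f hF
    (hq.locConstOn_push (hq.pull hF))
  let g := pullUnit q (cokernel f)
  have : Mono g := mono_pullUnit q hq.surjective _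
  have hk := isKernelCompMono (Abelian.monoIsKernelOfCokernel _ (cokernelIsCokernel f)) g rfl
  let e : kernel (cokernel.π f ≫ g) ≅ F := IsLimit.conePointUniqueUpToIso (kernelIsKernel _) hk
  exact (locConstOn i').prop_of_iso ((PreservesKernel.iso G (cokernel.π f ≫ g)).symm ≪≫ G.mapIso e)
    ((locConstOn i').prop_kernel _ (hG _ (hq.pull hF)) (hG _ (hq.pull hC)))

/-- A morphism from `freeSh P` to a direct image is a section over the inverse image of `P`, a
disjoint union of cells, where sections lift. -/
lemma exists_lift_freeSh {P : Opens Y} (hP : GoodOpen q P) (S : ShortComplex (Sh (Sheets U E)))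
    (hS : S.ShortExact) (hJ : Flasque S.X₂) (hG : ConvexExtends S.X₁)
    (ψ : freeSh P ⟶ (push q).obj S.X₃) : ∃ φ, φ ≫ (push q).map S.g = ψ := by
  obtain ⟨t, ht⟩ := GoodPair.sm_surjective hP hS hJ hG (sm ψ P (freeGen P))
  obtain ⟨φ, hφ⟩ := (freeHom_bijective P ((push q).obj S.X₂)).2 t
  refine ⟨φ, (freeHom_bijective P _).1 ?_⟩
  refine Eq.trans ?_ ht
  exact congrArg (sm S.g _) hφ

open Abelian in
-- Sections over `P k` are morphisms from `freeSh (P k)`, and the obstruction to lifting them lies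
-- in a vanishing Ext group.
lemma surjective_of_extAcyclic_freeSh [HasExt.{0} (Sh Y)] {κ : Type} (P : κ → Opens Y)
    {S : ShortComplex (Sh Y)} (hS : S.ShortExact) (h : ExtAcyclic (fun k => freeSh (P k)) S.X₁)
    (k : κ) : Function.Surjective (sm S.g (P k)) := by
  intro s
  obtain ⟨ψ, rfl⟩ := (freeHom_bijective (P k) S.X₃).2 s
  have := h k 0
  obtain ⟨φ, rfl⟩ := exists_lift_of_ext_subsingleton hS ψ
  exact ⟨sm φ _ (freeGen _), rfl⟩

variable [HasDerivedCategory.{w} (LCOn i)] [HasDerivedCategory.{w} (Sh Y)]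
  [HasDerivedCategory.{w} (LCOn i')] [HasDerivedCategory.{w} (Sh Z)]

lemma OrbitCover.locConstOn_push_comp (hq : OrbitCover i q) (j : Y ⟶ Z)
    (hj : ∀ b, NiceAlong (q ≫ j) (i' b)) (F : Sh Y) (hF : locConstOn i F) :
    locConstOn i' ((push j).obj F) :=
  hq.locConstOn_obj (push j) (fun _ hH b => (hj b).isLocallyConstantSheaf_push hH) F hF

open DerivedCategory.TStructure in
/-- The comparison of the derived functors of direct images. -/
theorem OrbitCover.exists_push_iso (hq : OrbitCover i q) (j : Y ⟶ Z)
    (hj : ∀ b, NiceAlong (q ≫ j) (i' b)) (hi' : ∀ z, ∃ b x, i' b x = z) (d : ℕ)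
    (hd : ∀ (z : Z) (V : Opens Z), z ∈ V → ∃ W : Opens Z, z ∈ W ∧ W ≤ V ∧
      Embeddable d ((Opens.map j).obj W))
    (h : ∀ F, locConstOn i F → locConstOn i' ((push j).obj F)) [EnoughInjectives (LCOn i)] :
    ∃ (h₁ : RightDerivedMapsTo (liftLC i i' (push j) h) bounded_le_plus t.bounded)
      (h₂ : RightDerivedMapsTo (push j) (boundedWith_le_plus (locConstOn i))
        (boundedWith (locConstOn i'))),
      Nonempty (rightDerivedOn _ _ h₁ ⋙ naturalFunctor i' ≅
        naturalFunctor i ⋙ rightDerivedOn _ _ h₂) := by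
  have := hq.isEquivalence
  have : HasExt.{0} (Sh Y) := hasExt_of_enoughInjectives _
  -- The test objects represent sections of direct images over those `V` whose inverse images in the
  -- sheets are disjoint unions of cells.
  let P : {V : Opens Z // GoodOpen q ((Opens.map j).obj V)} → Opens Y := fun V =>
    (Opens.map j).obj V.1
  refine exists_rightDerivedOn_iso i i' (fun V => freeSh (P V)) (push j) ?_ ?_ ?_ h
  · intro S hS hX
    refine epi_of_locally_surjective _ fun z V hz => ?_
    obtain ⟨b, x, rfl⟩ := hi' z
    obtain ⟨W, hx, hWV, hW⟩ := (hj b).exists_goodOpen x V hz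
    exact ⟨W, hx, hWV, surjective_of_extAcyclic_freeSh P hS hX ⟨W, hW⟩⟩
  · intro I _
    exact hq.extAcyclic _ (fun V => exists_lift_freeSh V.2) I
  · intro J hJ b hb
    -- The extra one turns a condition on the degree `n + 1` into `b + d < n`.
    refine ⟨b + d + 1, fun n hn => ?_⟩
    obtain ⟨n, rfl⟩ : ∃ m, n = m + 1 := ⟨n - 1, by ring⟩
    refine exactAt_of_sections _ n fun z V hz => ?_
    obtain ⟨W, hz, hWV, hW⟩ := hd z V hz
    exact ⟨W, hz, hWV, fun s hs => hW.exists_d_eq J hJ b hb n (by omega) s hs⟩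

end LeftExact

end

end Toric

namespace Toric

noncomputable section

/-! ### Left exactness of sections with support -/

section Support

variable {Y : TopCat.{0}}

/-- The intersection of open subsets `V` and `U`, as the image in `Y` of the inverse image of `V`
in `U`. -/
def interOpen (U V : Opens Y) : Opens Y :=
  U.isOpenEmbedding.isOpenMap.functor.obj ((Opens.map U.inclusion').obj V)

lemma mem_interOpen {U V : Opens Y} {z : Y} : z ∈ interOpen U V ↔ z ∈ V ∧ z ∈ U :=
  ⟨by rintro ⟨x, hx, rfl⟩; exact ⟨hx, x.2⟩, fun h => ⟨⟨z, h.2⟩, h.1, rfl⟩⟩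

lemma interOpen_mono (U : Opens Y) {V V' : Opens Y} (h : V' ≤ V) :
    interOpen U V' ≤ interOpen U V :=
  fun _ hz => mem_interOpen.2 ⟨h (mem_interOpen.1 hz).1, (mem_interOpen.1 hz).2⟩

variable {S : Set Y} (hS : IsLocallyClosed S)

/-- The largest open subset in which `S` is closed. -/
def closedIn : Opens Y := ⟨coborder S, hS.isOpen_coborder⟩

variable (S) in
/-- The complement of the closure of `S`. -/
def closureCompl : Opens Y := ⟨(closure S)ᶜ, isClosed_closure.isOpen_compl⟩

lemma closureCompl_le_closedIn : closureCompl S ≤ closedIn hS := fun _ hz hz' => hz hz'.1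

lemma interOpen_closureCompl_le (V : Opens Y) :
    interOpen (closureCompl S) V ≤ interOpen (closedIn hS) V :=
  fun _ hz => mem_interOpen.2 ⟨(mem_interOpen.1 hz).1,
    closureCompl_le_closedIn hS (mem_interOpen.1 hz).2⟩

/-- The section of `F` over `V ∩ U` underlying a section of `Γ_S F` over `V`. -/
def gsec (F : Sh Y) (V : Opens Y) :
    Sec ((sectionsWithSupport S hS).obj F) V →ₗ[ℂ] Sec F (interOpen (closedIn hS) V) :=
  sm (kernel.ι ((openSectionsRes (closureCompl_le_closedIn hS)).app F)) V

lemma gsec_injective (F : Sh Y) (V : Opens Y) : Function.Injective (gsec hS F V) :=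
  sm_injective (kernel.ι ((openSectionsRes (closureCompl_le_closedIn hS)).app F)) V

lemma rs_gsec (F : Sh Y) (V : Opens Y) (s : Sec ((sectionsWithSupport S hS).obj F) V) :
    rs F (interOpen_closureCompl_le hS V) (gsec hS F V s) = 0 := by
  have h := kernel.condition ((openSectionsRes (closureCompl_le_closedIn hS)).app F)
  exact congrArg (fun f => sm f V s) h

lemma exists_gsec_eq (F : Sh Y) (V : Opens Y) (s : Sec F (interOpen (closedIn hS) V))
    (h : rs F (interOpen_closureCompl_le hS V) s = 0) : ∃ t, gsec hS F V t = s := by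
  let T := ShortComplex.mk (kernel.ι ((openSectionsRes (closureCompl_le_closedIn hS)).app F))
    ((openSectionsRes (closureCompl_le_closedIn hS)).app F) (kernel.condition _)
  have hT : T.Exact := ShortComplex.exact_of_f_is_kernel _ (kernelIsKernel _)
  have : Mono T.f := inferInstanceAs (Mono (kernel.ι _))
  exact exists_sm_eq_of_exact hT V s h

lemma gsec_rs (F : Sh Y) {V V' : Opens Y} (h : V' ≤ V)
    (s : Sec ((sectionsWithSupport S hS).obj F) V) :
    gsec hS F V' (rs _ h s) = rs F (interOpen_mono _ h) (gsec hS F V s) :=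
  sm_rs (kernel.ι ((openSectionsRes (closureCompl_le_closedIn hS)).app F)) h s

lemma gsec_map {F G : Sh Y} (f : F ⟶ G) (V : Opens Y)
    (s : Sec ((sectionsWithSupport S hS).obj F) V) :
    gsec hS G V (sm ((sectionsWithSupport S hS).map f) V s) = sm f _ (gsec hS F V s) := by
  have h : (sectionsWithSupport S hS).map f ≫
      kernel.ι ((openSectionsRes (closureCompl_le_closedIn hS)).app G) =
      kernel.ι ((openSectionsRes (closureCompl_le_closedIn hS)).app F) ≫
        (openSections (closedIn hS)).map f := kernel.lift_ι _ _ _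
  exact congrArg (fun f => sm f V s) h

lemma sectionsWithSupport_exact {T : ShortComplex (Sh Y)} (hT : T.Exact) [Mono T.f] :
    (T.map (sectionsWithSupport S hS)).Exact := by
  refine exact_of_stalks fun z t ht => ?_
  change Stk ((sectionsWithSupport S hS).obj T.X₂) z at t
  obtain ⟨U, -, hz, s, rfl⟩ := exists_gm_eq ((sectionsWithSupport S hS).obj T.X₂) t (V := ⊤) trivial
  have h0 : gm _ z hz (sm ((sectionsWithSupport S hS).map T.g) U s) =
      gm ((sectionsWithSupport S hS).obj T.X₃) z hz 0 := by
    rw [← km_gm, map_zero]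
    exact ht
  obtain ⟨V, hzV, h₁, h₂, hV⟩ := exists_rs_eq_of_gm_eq _ h0
  rw [map_zero, ← sm_rs] at hV
  have hV' := congrArg (gsec hS T.X₃ V) hV
  rw [gsec_map, map_zero] at hV'
  obtain ⟨r, hr⟩ := exists_sm_eq_of_exact hT _ _ hV'
  -- The preimage inherits the support condition because `T.f` is injective on sections.
  obtain ⟨r', hr'⟩ := exists_gsec_eq hS T.X₁ V r (sm_injective T.f _ (by
    rw [sm_rs, hr, map_zero, rs_gsec]))
  refine ⟨gm ((sectionsWithSupport S hS).obj T.X₁) z hzV r', ?_⟩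
  refine (km_gm ((sectionsWithSupport S hS).map T.f) z hzV r').trans ?_
  rw [← gm_rs _ h₁ z hzV]
  congr 1
  refine gsec_injective hS _ _ ?_
  rw [gsec_map, hr', hr]

lemma sectionsWithSupport_mono {F G : Sh Y} (f : F ⟶ G) [Mono f] :
    Mono ((sectionsWithSupport S hS).map f) := by
  refine mono_of_km_injective _ fun z => ?_
  rw [injective_iff_map_eq_zero]
  intro t ht
  obtain ⟨U, -, hz, s, rfl⟩ := exists_gm_eq ((sectionsWithSupport S hS).obj F) t (V := ⊤) trivial
  have h0 : gm _ z hz (sm ((sectionsWithSupport S hS).map f) U s) =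
      gm ((sectionsWithSupport S hS).obj G) z hz 0 := by
    rw [← km_gm, map_zero]
    exact ht
  obtain ⟨V, hzV, h₁, h₂, hV⟩ := exists_rs_eq_of_gm_eq _ h0
  rw [map_zero, ← sm_rs] at hV
  have hV' := congrArg (gsec hS G V) hV
  rw [gsec_map, map_zero] at hV'
  have hs : rs _ h₁ s = 0 := by
    refine gsec_injective hS _ _ (sm_injective f _ ?_)
    rw [hV', map_zero, map_zero]
  rw [← gm_rs _ h₁ z hzV, hs, map_zero]

instance : PreservesFiniteLimits (sectionsWithSupport S hS) := by
  refine ((sectionsWithSupport S hS).preservesFiniteLimits_tfae.out 1 3).1 ?_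
  intro T hT
  have := hT.2
  exact ⟨sectionsWithSupport_exact hS hT.1, sectionsWithSupport_mono hS _⟩

end Support

/-! ### Derived functors of sections with support -/

section SupportObj

variable {Y : TopCat.{0}} {S : Set Y} (hS : IsLocallyClosed S)

/-- The sheaf that represents the sections over `V` of `Γ_S F`. -/
abbrev suppSh (V : Opens Y) : Sh Y := cokernel (freeMap (interOpen_closureCompl_le hS V))

/-- Morphisms from the cokernel are the sections over `interOpen (closedIn hS) V` that restrict to
zero outside the closure of `S`. -/
lemma suppHom_bijective (V : Opens Y) (F : Sh Y) :
    Function.Injective (fun φ : suppSh hS V ⟶ F => sm (cokernel.π (freeMap _) ≫ φ) _ (freeGen _)) ∧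
    ∀ s : Sec F (interOpen (closedIn hS) V), rs F (interOpen_closureCompl_le hS V) s = 0 ↔
      ∃ φ : suppSh hS V ⟶ F,
        sm (cokernel.π (freeMap (interOpen_closureCompl_le hS V)) ≫ φ) _ (freeGen _) = s := by
  refine ⟨fun φ φ' h => ?_, fun s => ⟨fun h => ?_, ?_⟩⟩
  · exact (cancel_epi (cokernel.π (freeMap (interOpen_closureCompl_le hS V)))).1
      ((freeHom_bijective _ F).1 h)
  · obtain ⟨φ, rfl⟩ := (freeHom_bijective _ F).2 s
    refine ⟨cokernel.desc _ φ ((freeHom_bijective _ F).1 ?_), ?_⟩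
    · change sm φ _ (sm (freeMap _) _ (freeGen _)) = 0
      rw [freeMap_gen, sm_rs]
      exact h
    · rw [cokernel.π_desc]
  · rintro ⟨φ, rfl⟩
    rw [← sm_rs, ← freeMap_gen, ← sm_comp, cokernel.condition_assoc, zero_comp, sm_zero]

open Abelian in
-- Sections with support are morphisms from `suppSh`, so the obstruction to lifting them lies in a
-- vanishing Ext group.
lemma sm_sectionsWithSupport_surjective [HasExt.{0} (Sh Y)] {κ : Type} (P : κ → Opens Y)
    {T : ShortComplex (Sh Y)} (hT : T.ShortExact) (h : ExtAcyclic (fun k => suppSh hS (P k)) T.X₁)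
    (k : κ) : Function.Surjective (sm ((sectionsWithSupport S hS).map T.g) (P k)) := by
  intro s
  obtain ⟨ψ, hψ⟩ := ((suppHom_bijective hS (P k) T.X₃).2 _).1 (rs_gsec hS T.X₃ (P k) s)
  have := h k 0
  obtain ⟨φ, rfl⟩ := exists_lift_of_ext_subsingleton hT ψ
  obtain ⟨t, ht⟩ := exists_gsec_eq hS T.X₂ (P k) _
    (((suppHom_bijective hS (P k) T.X₂).2 _).2 ⟨φ, rfl⟩)
  refine ⟨t, gsec_injective hS _ _ ?_⟩
  rw [gsec_map, ht, ← hψ]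
  rfl

variable {U : Type} {E : Type} [NormedAddCommGroup E] [NormedSpace ℝ E] [FiniteDimensional ℝ E]
  {q : Sheets U E ⟶ Y}

/-- Each sheet maps into `V` or into the complement of `V`. -/
def SheetInvariant (q : Sheets U E ⟶ Y) (V : Set Y) : Prop :=
  ∀ (u : U) (x y : E), q ⟨u, x⟩ ∈ V → q ⟨u, y⟩ ∈ V

/-- Whether a point lies over `P` depends only on its sheet, so intersecting with `P` discards whole
sheets and keeps the cells of the others. -/
lemma GoodPair.interOpen {V V' P : Opens Y} (hP : SheetInvariant q P)
    (h : GoodPair ((Opens.map q).obj V') ((Opens.map q).obj V)) :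
    GoodPair ((Opens.map q).obj (interOpen P V')) ((Opens.map q).obj (interOpen P V)) := by
  refine h.restrict {u | q ⟨u, 0⟩ ∈ P} ?_ ?_ <;>
  · rintro ⟨u, x⟩
    change q ⟨u, x⟩ ∈ Toric.interOpen _ _ ↔ _
    rw [mem_interOpen]
    exact and_congr_right fun _ => ⟨hP u x 0, hP u 0 x⟩

/-- A section over the disjoint union of cells `D` that vanishes on `D₀` first lifts without regard
to support. As `D₀` consists of the parts of `D` in certain sheets, the lift may be reset to zero
there. -/
lemma exists_lift_suppSh (h₁ : SheetInvariant q (closedIn hS : Opens Y))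
    (h₂ : SheetInvariant q (closureCompl S : Opens Y)) {P : Opens Y} (hP : GoodOpen q P)
    (T : ShortComplex (Sh (Sheets U E)))
    (hT : T.ShortExact) (hJ : Flasque T.X₂) (hG : ConvexExtends T.X₁)
    (ψ : suppSh hS P ⟶ (push q).obj T.X₃) : ∃ φ, φ ≫ (push q).map T.g = ψ := by
  classical
  let D := (Opens.map q).obj (interOpen (closedIn hS) P)
  let D₀ := (Opens.map q).obj (interOpen (closureCompl S) P)
  have hD₀ : D₀ ≤ D := (Opens.map q).monotone (interOpen_closureCompl_le hS P)
  obtain ⟨s, hs⟩ : ∃ s : Sec T.X₃ D, s = sm (cokernel.π (freeMap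
      (interOpen_closureCompl_le hS P)) ≫ ψ) _ (freeGen _) := ⟨_, rfl⟩
  have hs₀ : rs T.X₃ hD₀ s = 0 := by
    subst hs
    exact ((suppHom_bijective hS P ((push q).obj T.X₃)).2 _).2 ⟨ψ, rfl⟩
  obtain ⟨t, ht⟩ := (GoodPair.interOpen h₁ hP).sm_surjective hT hJ hG s
  have hmem : ∀ z ∈ D, (z ∈ D₀ ↔ q ⟨z.1, 0⟩ ∈ closureCompl S) := by
    rintro ⟨u, x⟩ hz
    change q ⟨u, x⟩ ∈ interOpen _ _ ↔ _
    rw [mem_interOpen]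
    exact ⟨fun h => h₂ u x 0 h.2, fun h => ⟨(mem_interOpen.1 hz).1, h₂ u 0 x h⟩⟩
  -- `D₀` is open and closed in `D`: on each sheet, all or none of the points of `D` belong to it.
  -- So this definition by cases is locally a section.
  obtain ⟨t', ht'⟩ := exists_gm_eq_of_local T.X₂ D
    (fun z hz => if z ∈ D₀ then 0 else gm _ z hz t) (by
      rintro ⟨u, x⟩ hz
      have hsh : ∀ y ∈ D ⊓ sheet u, y ∈ D₀ ↔ q ⟨u, 0⟩ ∈ closureCompl S := by
        rintro ⟨b, y⟩ hy
        obtain rfl := eq_of_mem_sheetOpen hy.2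
        exact hmem _ hy.1
      by_cases h0 : q ⟨u, 0⟩ ∈ closureCompl S
      · refine ⟨D ⊓ sheet u, ⟨hz, mem_sheet u x⟩, 0, fun y hy hy' => ?_⟩
        rw [map_zero, if_pos ((hsh y hy).2 h0)]
      · refine ⟨D ⊓ sheet u, ⟨hz, mem_sheet u x⟩, rs _ inf_le_left t, fun y hy hy' => ?_⟩
        rw [gm_rs, if_neg fun h => h0 ((hsh y hy).1 h)])
  have ht₀ : rs T.X₂ hD₀ t' = 0 := sec_ext _ fun z hz => by
    rw [gm_rs, ht', if_pos hz, map_zero]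
  have hts : sm T.g D t' = s := sec_ext _ fun z hz => by
    rw [← km_gm, ht']
    by_cases hz₀ : z ∈ D₀
    · rw [if_pos hz₀, map_zero, ← gm_rs _ hD₀ z hz₀, hs₀, map_zero]
    · rw [if_neg hz₀, km_gm]
      exact congrArg _ ht
  obtain ⟨φ, hφ⟩ := ((suppHom_bijective hS P ((push q).obj T.X₂)).2 t').1 ht₀
  refine ⟨φ, (suppHom_bijective hS P _).1 ?_⟩
  refine Eq.trans ?_ (hts.trans hs)
  exact congrArg (sm T.g _) hφ

variable {A : Type} {O : A → TopCat.{0}} {i : ∀ a, O a ⟶ Y} [∀ a, LocallyConnectedSpace (O a)]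

/-- For direct images from the sheets, restriction between good neighbourhoods is bijective on the
sections over the open set where `S` is closed and on those outside the closure of `S`, hence on the
kernel of the map between them. -/
lemma OrbitCover.locConstOn_sectionsWithSupport (hq : OrbitCover i q)
    (h₁ : SheetInvariant q (closedIn hS : Opens Y))
    (h₂ : SheetInvariant q (closureCompl S : Opens Y)) (F : Sh Y) (hF : locConstOn i F) :
    locConstOn i ((sectionsWithSupport S hS).obj F) := by
  refine hq.locConstOn_obj (sectionsWithSupport S hS) (fun H hH a => ?_) F hF
  rw [isLocallyConstantSheaf_pull_iff]
  refine locConstAlong_of_bijective (i a) _ fun x => ?_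
  obtain ⟨W, hx, hW⟩ := hq.nice a x
  refine ⟨W, hx, fun y hy => gm_bijective_of_rs_bijective _ hy fun V hV => ?_⟩
  obtain ⟨W', hy', hW', hWV, hg⟩ := hW y hy V hV
  refine ⟨W', hy', hW', hWV, ?_⟩
  have b₁ : Function.Bijective (rs ((push q).obj H) (interOpen_mono (closedIn hS) hW')) :=
    (GoodPair.interOpen h₁ hg).rs_bijective hH
  have b₂ : Function.Bijective (rs ((push q).obj H) (interOpen_mono (closureCompl S) hW')) :=
    (GoodPair.interOpen h₂ hg).rs_bijective hH
  constructor
  · intro s t hst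
    refine gsec_injective hS _ _ (b₁.1 ?_)
    rw [← gsec_rs hS _ hW' s, hst, gsec_rs]
  · intro s
    obtain ⟨t, ht⟩ := b₁.2 (gsec hS _ _ s)
    obtain ⟨r, hr⟩ := exists_gsec_eq hS ((push q).obj H) W t (b₂.1 (by
      rw [map_zero, rs_rs, ← rs_gsec hS _ _ s, ← ht, rs_rs]))
    refine ⟨r, gsec_injective hS _ _ ?_⟩
    rw [gsec_rs, hr, ht]

open DerivedCategory.TStructure in
/-- The comparison of the derived functors of sections with support. -/
theorem OrbitCover.exists_sectionsWithSupport_iso (hq : OrbitCover i q)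
    [HasDerivedCategory.{w} (LCOn i)] [HasDerivedCategory.{w} (Sh Y)]
    (h₁ : SheetInvariant q (closedIn hS : Opens Y))
    (h₂ : SheetInvariant q (closureCompl S : Opens Y)) (d : ℕ)
    (hd : ∀ (z : Y) (V : Opens Y), z ∈ V → ∃ W : Opens Y, z ∈ W ∧ W ≤ V ∧
      ∀ P : Opens Y, Embeddable d (interOpen P W))
    (h : ∀ F, locConstOn i F → locConstOn i ((sectionsWithSupport S hS).obj F))
    [EnoughInjectives (LCOn i)] :
    ∃ (h₁ : RightDerivedMapsTo (liftLC i i (sectionsWithSupport S hS) h) bounded_le_plus t.bounded)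
      (h₂ : RightDerivedMapsTo (sectionsWithSupport S hS) (boundedWith_le_plus (locConstOn i))
        (boundedWith (locConstOn i))),
      Nonempty (rightDerivedOn _ _ h₁ ⋙ naturalFunctor i ≅
        naturalFunctor i ⋙ rightDerivedOn _ _ h₂) := by
  have := hq.isEquivalence
  have : HasExt.{0} (Sh Y) := hasExt_of_enoughInjectives _
  let P : {V : Opens Y // GoodOpen q V} → Opens Y := fun V => V.1
  refine exists_rightDerivedOn_iso i i (fun V => suppSh hS (P V)) (sectionsWithSupport S hS)
    ?_ ?_ ?_ h
  · intro T hT hX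
    refine epi_of_locally_surjective _ fun z V hz => ?_
    obtain ⟨W, hx, hWV, hW⟩ := hq.exists_goodOpen z V hz
    exact ⟨W, hx, hWV, sm_sectionsWithSupport_surjective hS P hT hX ⟨W, hW⟩⟩
  · intro I _
    exact hq.extAcyclic _ (fun V => exists_lift_suppSh hS h₁ h₂ V.2) I
  · intro J hJ b hb
    -- Two degrees are needed: one for a primitive `y` of the cocycle, one for a primitive `x` of
    -- `y` outside the closure of `S`.
    refine ⟨b + d + 2, fun n hn => ?_⟩
    obtain ⟨n, rfl⟩ : ∃ m, n = m + 1 + 1 := ⟨n - 2, by ring⟩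
    refine exactAt_of_sections _ (n + 1) fun z V hz => ?_
    obtain ⟨W, hz, hWV, hW⟩ := hd z V hz
    refine ⟨W, hz, hWV, fun s hs => ?_⟩
    change Sec ((sectionsWithSupport S hS).obj (J.X (n + 1 + 1))) W at s
    have hs' : sm (J.d (n + 1 + 1) (n + 1 + 2)) _ (gsec hS (J.X (n + 1 + 1)) W s) = 0 := by
      rw [← gsec_map]
      exact (congrArg (gsec hS _ W) hs).trans (map_zero _)
    obtain ⟨y, hy⟩ := (hW (closedIn hS)).exists_d_eq J hJ b hb (n + 1) (by omega) _ hs'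
    let hle := interOpen_closureCompl_le hS W
    obtain ⟨x, hx⟩ := (hW (closureCompl S)).exists_d_eq J hJ b hb n (by omega)
      (rs _ hle y) (by
        have e : n + 2 = n + 1 + 1 := by ring
        rw [e, sm_rs, hy, rs_gsec])
    -- Extended by flasqueness, `x` corrects `y` to a primitive supported in `S`.
    obtain ⟨x, rfl⟩ := flasque_of_injective (J.X n) hle x
    obtain ⟨t, ht⟩ := exists_gsec_eq hS (J.X (n + 1)) W (y - sm (J.d n (n + 1)) _ x) (by
      rw [map_sub, ← sm_rs, hx, sub_self])
    refine ⟨t, gsec_injective hS _ _ ?_⟩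
    refine (gsec_map hS (J.d (n + 1) (n + 1 + 1)) W t).trans ?_
    rw [ht, map_sub, hy, ← sm_comp, J.d_comp_d, sm_zero, sub_zero]

end SupportObj

end

end Toric

namespace Toric

noncomputable section

/-! ### Finite generation of the semigroups of cones -/

section Gordan

variable {N : Type} [AddCommGroup N]

lemma pairing_tmul (m : CharLattice N) (n : N) : pairing m (1 ⊗ₜ[ℤ] n) = m n := by
  simp [pairing]

lemma mem_dualMonoid_iff {σ : PointedCone ℝ (ℝ ⊗[ℤ] N)} {s : Finset N}
    (hs : σ = PointedCone.hull ℝ ((fun n : N => 1 ⊗ₜ[ℤ] n) '' s)) (m : CharLattice N) :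
    m ∈ dualMonoid σ ↔ ∀ n ∈ s, 0 ≤ m n := by
  constructor
  · intro h n hn
    have := h (1 ⊗ₜ[ℤ] n) (by rw [hs]; exact Submodule.subset_span ⟨n, hn, rfl⟩)
    rw [pairing_tmul] at this
    exact_mod_cast this
  · intro h v hv
    rw [hs] at hv
    induction hv using Submodule.span_induction with
    | mem v hv =>
      obtain ⟨n, hn, rfl⟩ := hv
      change 0 ≤ pairing m (1 ⊗ₜ[ℤ] n)
      rw [pairing_tmul]
      exact_mod_cast h n hn
    | zero => simp
    | add v w _ _ hv hw => rw [map_add]; exact add_nonneg hv hw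
    | smul c v _ hv =>
      have : c • v = (c : ℝ) • v := rfl
      rw [this, map_smul]
      exact mul_nonneg c.2 hv

variable [Module.Free ℤ N] [Module.Finite ℤ N]

/-- Gordan's lemma. -/
lemma exists_finset_closure_eq_top {σ : PointedCone ℝ (ℝ ⊗[ℤ] N)} {s : Finset N}
    (hs : σ = PointedCone.hull ℝ ((fun n : N => 1 ⊗ₜ[ℤ] n) '' s)) :
    ∃ A : Finset (dualMonoid σ), AddSubmonoid.closure (A : Set (dualMonoid σ)) = ⊤ := by
  let I := Module.Free.ChooseBasisIndex ℤ (CharLattice N)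
  let b := Module.Free.chooseBasis ℤ (CharLattice N)
  -- Coordinates for a character: positive and negative parts in a basis, and its values on the
  -- generators of `σ`. The dual monoid is the image of the compatible triples, which form the
  -- equalizer of `f` and `g`.
  let T := (I → ℕ) × (I → ℕ) × (s → ℕ)
  let ev : (I → ℕ) →+ CharLattice N :=
    { toFun := fun a => ∑ i, a i • b i
      map_zero' := by simp
      map_add' := fun a a' => by simp [add_smul, Finset.sum_add_distrib] }
  let f : T →+ (s → ℤ) :=
    { toFun := fun t n => ev t.1 n
      map_zero' := by ext; simp
      map_add' := fun t t' => by
        ext n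
        change ev (t.1 + t'.1) n = ev t.1 n + ev t'.1 n
        rw [map_add, LinearMap.add_apply] }
  let g : T →+ (s → ℤ) :=
    { toFun := fun t n => ev t.2.1 n + t.2.2 n
      map_zero' := by ext; simp
      map_add' := fun t t' => by
        ext n
        change ev (t.2.1 + t'.2.1) n + ((t.2.2 n + t'.2.2 n : ℕ) : ℤ) =
          ev t.2.1 n + t.2.2 n + (ev t'.2.1 n + t'.2.2 n)
        rw [map_add, LinearMap.add_apply]
        push_cast
        ring }
  -- Solutions of a homogeneous linear system in natural numbers are closed under those subtractions
  -- that are possible, which forces finite generation.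
  obtain ⟨B, hB⟩ : (f.eqLocusM g).FG := AddSubmonoid.fg_of_subtractive (by
    intro x hx y hxy
    have hx' : f x = g x := hx
    have hxy' : f (x + y) = g (x + y) := hxy
    rw [map_add, map_add, hx'] at hxy'
    exact add_left_cancel hxy')
  have hmem : ∀ t ∈ f.eqLocusM g, ev t.1 - ev t.2.1 ∈ dualMonoid σ := by
    intro t ht
    rw [mem_dualMonoid_iff hs]
    intro n hn
    have : ev t.1 n = ev t.2.1 n + t.2.2 ⟨n, hn⟩ := congrFun (ht : f t = g t) ⟨n, hn⟩
    rw [LinearMap.sub_apply, this]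
    simp
  let π : f.eqLocusM g →+ dualMonoid σ :=
    { toFun := fun t => ⟨_, hmem t.1 t.2⟩
      map_zero' := Subtype.ext (by simp)
      map_add' := fun t t' => Subtype.ext (by
        change ev (t.1.1 + t'.1.1) - ev (t.1.2.1 + t'.1.2.1) =
          ev t.1.1 - ev t.1.2.1 + (ev t'.1.1 - ev t'.1.2.1)
        rw [map_add, map_add]
        abel) }
  have hπ : Function.Surjective π := by
    rintro ⟨m, hm⟩
    have hm' := (mem_dualMonoid_iff hs m).1 hm
    let t : T := (fun i => (b.repr m i).toNat, fun i => (-b.repr m i).toNat,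
      fun n => (m n).toNat)
    have h₁ : ev t.1 - ev t.2.1 = m := by
      change ∑ i, (b.repr m i).toNat • b i - ∑ i, (-b.repr m i).toNat • b i = m
      rw [← Finset.sum_sub_distrib]
      conv_rhs => rw [← b.sum_repr m]
      refine Finset.sum_congr rfl fun i _ => ?_
      rw [← natCast_zsmul, ← natCast_zsmul, ← sub_smul]
      congr 1
      omega
    have h₂ : t ∈ f.eqLocusM g := by
      change f t = g t
      funext n
      change ev t.1 n = ev t.2.1 n + ((m n).toNat : ℤ)
      rw [Int.toNat_of_nonneg (hm' n n.2), ← sub_eq_iff_eq_add', ← LinearMap.sub_apply, h₁]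
    exact ⟨⟨t, h₂⟩, Subtype.ext h₁⟩
  have hfg : AddMonoid.FG (f.eqLocusM g) := (AddMonoid.fg_iff_addSubmonoid_fg _).2 ⟨B, hB⟩
  obtain ⟨A, hA⟩ := (AddMonoid.fg_of_surjective π hπ).fg_top
  exact ⟨A, hA⟩

end Gordan

/-! ### The topology of affine charts -/

section ChartTopology

variable {N : Type} [AddCommGroup N] {σ : PointedCone ℝ (ℝ ⊗[ℤ] N)} {A : Finset (dualMonoid σ)}
  (hA : AddSubmonoid.closure (A : Set (dualMonoid σ)) = ⊤)

/-- Induction on the elements of `S_σ`. -/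
lemma dualMonoid_induction (hA : AddSubmonoid.closure (A : Set (dualMonoid σ)) = ⊤)
    {p : dualMonoid σ → Prop} (h₀ : p 0) (h₁ : ∀ a ∈ A, p a) (h₂ : ∀ a b, p a → p b → p (a + b))
    (m : dualMonoid σ) : p m := by
  have hm : m ∈ AddSubmonoid.closure (A : Set (dualMonoid σ)) := by rw [hA]; trivial
  induction hm using AddSubmonoid.closure_induction with
  | mem x hx => exact h₁ x hx
  | zero => exact h₀
  | add x y _ _ hx hy => exact h₂ x y hx hy

lemma Chart.isInducing_coe : Topology.IsInducing (fun x : Chart σ => (x : dualMonoid σ → ℂ)) :=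
  ⟨rfl⟩

/-- The topology of a chart is determined by the generators of the semigroup. -/
lemma Chart.isInducing_generators (hA : AddSubmonoid.closure (A : Set (dualMonoid σ)) = ⊤) :
    Topology.IsInducing (fun (x : Chart σ) (a : A) => x a) := by
  refine ⟨le_antisymm (continuous_pi fun a => Chart.continuous_eval _).le_induced ?_⟩
  let t0 : TopologicalSpace (Chart σ) :=
    TopologicalSpace.induced (fun (x : Chart σ) (a : A) => x a) inferInstance
  have h0 : Continuous[t0, _] (fun (x : Chart σ) (a : A) => x a) := continuous_induced_dom
  have key : ∀ m, Continuous[t0, _] fun x : Chart σ => x m := by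
    refine dualMonoid_induction hA ?_ ?_ ?_
    · simp only [Chart.map_zero]
      exact continuous_const
    · intro a ha
      exact (continuous_apply (⟨a, ha⟩ : A)).comp h0
    · intro a b h h'
      simp only [Chart.map_add]
      exact h.mul h'
  have : Continuous[t0, _] (fun x : Chart σ => (x : dualMonoid σ → ℂ)) := continuous_pi key
  exact continuous_iff_le_induced.1 this

lemma Chart.eq_of_generators (hA : AddSubmonoid.closure (A : Set (dualMonoid σ)) = ⊤)
    {x y : Chart σ} (h : ∀ a ∈ A, x a = y a) : x = y := by
  refine Chart.ext (dualMonoid_induction hA ?_ h ?_)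
  · rw [Chart.map_zero, Chart.map_zero]
  · intro a b ha hb
    rw [Chart.map_add, Chart.map_add, ha, hb]

instance : T2Space (Chart σ) :=
  T2Space.of_injective_continuous (f := fun x : Chart σ => (x : dualMonoid σ → ℂ))
    DFunLike.coe_injective continuous_induced_dom

lemma Chart.isClosed_range : IsClosed (Set.range fun x : Chart σ => (x : dualMonoid σ → ℂ)) := by
  have : (Set.range fun x : Chart σ => (x : dualMonoid σ → ℂ)) =
      {f | f 0 = 1} ∩ ⋂ a, ⋂ b, {f | f (a + b) = f a * f b} := by
    ext f
    simp only [Set.mem_range, Set.mem_inter_iff, Set.mem_iInter, Set.mem_ofPred_eq]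
    constructor
    · rintro ⟨x, rfl⟩
      exact ⟨x.map_zero, x.map_add⟩
    · rintro ⟨h₀, h⟩
      exact ⟨(show AddChar (dualMonoid σ) ℂ from ⟨f, h₀, h⟩), rfl⟩
  rw [this]
  refine (isClosed_eq (continuous_apply _) continuous_const).inter
    (isClosed_iInter fun a => isClosed_iInter fun b => ?_)
  exact isClosed_eq (continuous_apply _) ((continuous_apply a).mul (continuous_apply b))

/-- Bounds on generators bound every character, so the set is closed in a product of closed discs.
-/
lemma Chart.isCompact_bounded (hA : AddSubmonoid.closure (A : Set (dualMonoid σ)) = ⊤) (R : ℝ) :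
    IsCompact {x : Chart σ | ∀ a ∈ A, ‖x a‖ ≤ R} := by
  have hB : ∀ m, ∃ B : ℝ, ∀ x : Chart σ, (∀ a ∈ A, ‖x a‖ ≤ R) → ‖x m‖ ≤ B := by
    refine dualMonoid_induction hA ⟨1, fun x _ => ?_⟩ (fun a ha => ⟨R, fun x hx => hx a ha⟩) ?_
    · rw [Chart.map_zero, norm_one]
    · rintro a b ⟨B, hB⟩ ⟨B', hB'⟩
      refine ⟨B * B', fun x hx => ?_⟩
      rw [Chart.map_add, norm_mul]
      exact mul_le_mul (hB x hx) (hB' x hx) (norm_nonneg _) ((norm_nonneg _).trans (hB x hx))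
  choose B hB using hB
  rw [Chart.isInducing_coe.isCompact_iff]
  refine (isCompact_univ_pi fun m => isCompact_closedBall (0 : ℂ) (B m)).of_isClosed_subset ?_ ?_
  · have : (fun x : Chart σ => (x : dualMonoid σ → ℂ)) '' {x : Chart σ | ∀ a ∈ A, ‖x a‖ ≤ R} =
        (Set.range fun x : Chart σ => (x : dualMonoid σ → ℂ)) ∩
          ⋂ a ∈ A, {f | ‖f a‖ ≤ R} := by
      ext f
      simp only [Set.mem_image, Set.mem_range, Set.mem_inter_iff, Set.mem_iInter,
        Set.mem_ofPred_eq]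
      constructor
      · rintro ⟨x, hx, rfl⟩; exact ⟨⟨x, rfl⟩, hx⟩
      · rintro ⟨⟨x, rfl⟩, hx⟩; exact ⟨x, hx, rfl⟩
    rw [this]
    exact Chart.isClosed_range.inter (isClosed_biInter fun a _ =>
      isClosed_le (continuous_apply a).norm continuous_const)
  · rintro _ ⟨x, hx, rfl⟩ m -
    rw [mem_closedBall_zero_iff]
    exact hB m x hx

lemma Chart.locallyCompactSpace (hA : AddSubmonoid.closure (A : Set (dualMonoid σ)) = ⊤) :
    LocallyCompactSpace (Chart σ) := by
  have : WeaklyLocallyCompactSpace (Chart σ) := by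
    refine ⟨fun x => ?_⟩
    obtain ⟨R, hR⟩ : ∃ R : ℝ, ∀ a ∈ A, ‖x a‖ < R := by
      refine ⟨∑ a ∈ A, ‖x a‖ + 1, fun a ha => ?_⟩
      have := Finset.single_le_sum (f := fun a => ‖x a‖) (fun a _ => norm_nonneg _) ha
      linarith
    refine ⟨_, Chart.isCompact_bounded hA R, ?_⟩
    have ho : IsOpen (⋂ a ∈ A, {x : Chart σ | ‖x a‖ < R}) :=
      isOpen_biInter_finset fun a _ => isOpen_lt (Chart.continuous_eval a).norm continuous_const
    refine Filter.mem_of_superset (ho.mem_nhds (by simpa using hR)) fun y hy a ha => ?_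
    simp only [Set.mem_iInter] at hy
    exact le_of_lt (hy a ha)
  infer_instance

lemma Chart.secondCountableTopology (hA : AddSubmonoid.closure (A : Set (dualMonoid σ)) = ⊤) :
    SecondCountableTopology (Chart σ) :=
  (Chart.isInducing_generators hA).secondCountableTopology

end ChartTopology

end

end Toric

namespace Toric

noncomputable section

/-! ### The exponential map of the torus -/

section Exponential

variable (N : Type) [AddCommGroup N] [Module.Free ℤ N] [Module.Finite ℤ N]

/-- The Lie algebra of the torus. -/
abbrev LieAlg : Type := Module.Free.ChooseBasisIndex ℤ N → ℂ

variable {N}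

/-- The differential of a character. -/
def lin (m : CharLattice N) : LieAlg N →ₗ[ℂ] ℂ :=
  ∑ i, ((m (Module.Free.chooseBasis ℤ N i) : ℤ) : ℂ) • LinearMap.proj i

lemma lin_apply (m : CharLattice N) (l : LieAlg N) :
    lin m l = ∑ i, ((m (Module.Free.chooseBasis ℤ N i) : ℤ) : ℂ) * l i := by
  simp [lin]

lemma lin_zero_left : lin (0 : CharLattice N) = 0 := by simp [lin]

lemma lin_add_left (m m' : CharLattice N) : lin (m + m') = lin m + lin m' := by
  simp [lin, add_smul, Finset.sum_add_distrib]

/-- The differential of characters, as a homomorphism. -/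
def linHom (l : LieAlg N) : CharLattice N →+ ℂ where
  toFun m := lin m l
  map_zero' := by simp [lin_zero_left]
  map_add' m m' := by simp [lin_add_left]

lemma linHom_apply (l : LieAlg N) (m : CharLattice N) : linHom l m = lin m l := rfl

lemma lin_sub_left (m m' : CharLattice N) (l : LieAlg N) : lin (m - m') l = lin m l - lin m' l :=
  map_sub (linHom l) m m'

lemma lin_sum_zsmul {J : Type} (s : Finset J) (c : J → ℤ) (b : J → CharLattice N) (l : LieAlg N) :
    lin (∑ j ∈ s, c j • b j) l = ∑ j ∈ s, (c j : ℂ) * lin (b j) l := by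
  rw [← linHom_apply, map_sum]
  refine Finset.sum_congr rfl fun j _ => ?_
  rw [map_zsmul, zsmul_eq_mul, linHom_apply]

lemma continuous_lin (m : CharLattice N) : Continuous (lin m) :=
  LinearMap.continuous_of_finiteDimensional _

/-- The exponential map of the torus. -/
def expT (l : LieAlg N) : Torus N where
  toFun m := Complex.exp (lin m l)
  map_zero_eq_one' := by simp [lin_zero_left]
  map_add_eq_mul' m m' := by simp [lin_add_left, Complex.exp_add]

lemma expT_apply (l : LieAlg N) (m : CharLattice N) : expT l m = Complex.exp (lin m l) := rfl

lemma expT_zero : expT (0 : LieAlg N) = 1 := by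
  ext m
  simp [expT_apply]

lemma exists_lin_eq (f : CharLattice N →+ ℂ) : ∃ l : LieAlg N, ∀ m, lin m l = f m := by
  classical
  let b := Module.Free.chooseBasis ℤ N
  refine ⟨fun i => f (b.coord i), fun m => ?_⟩
  rw [lin_apply]
  conv_rhs => rw [← b.sum_dual_apply_smul_coord m, map_sum]
  refine Finset.sum_congr rfl fun i _ => ?_
  rw [map_zsmul, zsmul_eq_mul]

lemma Torus.ne_zero (t : Torus N) (m : CharLattice N) : t m ≠ 0 := by
  intro h
  have h1 := AddChar.map_add_eq_mul t m (-m)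
  rw [h, zero_mul, add_neg_cancel, AddChar.map_zero_eq_one] at h1
  exact one_ne_zero h1

/-- The vector of the Lie algebra given by a cocharacter. -/
lemma exists_lin_eq_apply (n : N) : ∃ l : LieAlg N, ∀ m, lin m l = ((m n : ℤ) : ℂ) :=
  exists_lin_eq
    { toFun := fun m => ((m n : ℤ) : ℂ)
      map_zero' := by simp
      map_add' := fun m m' => by simp }

end Exponential

/-! ### Conical neighbourhoods and their cells -/

section Face

variable {N : Type} [AddCommGroup N] {σ : PointedCone ℝ (ℝ ⊗[ℤ] N)}

/-- A cocharacter in the relative interior of the face that corresponds to the orbit of `ξ`. -/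
lemma exists_face_vector {s : Finset N}
    (hs : σ = PointedCone.hull ℝ ((fun n : N => 1 ⊗ₜ[ℤ] n) '' s)) (ξ : Chart σ) :
    ∃ n : N, ∀ m : dualMonoid σ, (ξ m ≠ 0 → m.1 n = 0) ∧ (ξ m = 0 → 0 < m.1 n) := by
  classical
  -- The generators of the face of `σ` on which all characters that do not vanish at `ξ` are zero.
  -- Their sum is the required cocharacter.
  let s₀ := s.filter fun n => ∀ m : dualMonoid σ, ξ m ≠ 0 → m.1 n = 0
  have hs₀ : ∀ n ∈ s₀, ∀ m : dualMonoid σ, ξ m ≠ 0 → m.1 n = 0 := fun n hn =>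
    (Finset.mem_filter.1 hn).2
  refine ⟨∑ n ∈ s₀, n, fun m => ⟨fun hm => ?_, fun hm => ?_⟩⟩
  · rw [map_sum]
    exact Finset.sum_eq_zero fun n hn => hs₀ n hn m hm
  have hnn : ∀ (m : dualMonoid σ), ∀ n ∈ s, 0 ≤ m.1 n := fun m => (mem_dualMonoid_iff hs m.1).1 m.2
  rw [map_sum]
  refine lt_of_le_of_ne (Finset.sum_nonneg fun n hn => hnn m n (Finset.mem_filter.1 hn).1) ?_
  intro h0
  have hz := (Finset.sum_eq_zero_iff_of_nonneg fun n hn =>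
    hnn m n (Finset.mem_filter.1 hn).1).1 h0.symm
  -- The sum `p` of these `f n` does not vanish at `ξ` and is positive on every generator outside
  -- the face.
  have hex : ∀ n ∈ s \ s₀, ∃ f : dualMonoid σ, ξ f ≠ 0 ∧ 0 < f.1 n := by
    intro n hn
    obtain ⟨hn, hn'⟩ := Finset.mem_sdiff.1 hn
    have : ¬ ∀ m : dualMonoid σ, ξ m ≠ 0 → m.1 n = 0 := fun h => hn' (Finset.mem_filter.2 ⟨hn, h⟩)
    push Not at this
    obtain ⟨f, hf, hfn⟩ := this
    exact ⟨f, hf, lt_of_le_of_ne (hnn f n hn) hfn.symm⟩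
  choose! f hf hfn using hex
  let p : dualMonoid σ := ∑ n ∈ s \ s₀, f n
  have hp : ξ p ≠ 0 := by
    have : ∀ t ⊆ s \ s₀, ξ (∑ n ∈ t, f n) ≠ 0 := by
      intro t
      induction t using Finset.induction_on with
      | empty => intro _; rw [Finset.sum_empty, Chart.map_zero]; exact one_ne_zero
      | insert n t hn ih =>
        intro ht
        rw [Finset.sum_insert hn, Chart.map_add]
        exact mul_ne_zero (hf n (ht (Finset.mem_insert_self _ _)))
          (ih ((Finset.subset_insert _ _).trans ht))
    exact this _ subset_rfl
  have hpn : ∀ n ∈ s \ s₀, 0 < p.1 n := by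
    intro n hn
    refine (hfn n hn).trans_le ?_
    have h₁ : p.1 n = ∑ n' ∈ s \ s₀, (f n').1 n := by
      have : (p : CharLattice N) = ∑ n' ∈ s \ s₀, (f n').1 := AddSubmonoidClass.coe_finsetSum _ _
      rw [this, LinearMap.sum_apply]
    rw [h₁]
    exact Finset.single_le_sum (f := fun n' => (f n').1 n)
      (fun n' _ => hnn (f n') n (Finset.mem_sdiff.1 hn).1) hn
  -- Large enough for `k • p - m` to lie in the dual monoid. Then `ξ m` divides a power of `ξ p`,
  -- which contradicts `ξ m = 0`.
  let k : ℕ := ∑ n ∈ s, (m.1 n).toNat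
  have hk : k • p.1 - m.1 ∈ dualMonoid σ := by
    rw [mem_dualMonoid_iff hs]
    intro n hn
    rw [LinearMap.sub_apply, LinearMap.smul_apply, nsmul_eq_mul]
    by_cases hn₀ : n ∈ s₀
    · rw [hs₀ n hn₀ p hp, hz n hn₀]
      simp
    · have h₁ := hpn n (Finset.mem_sdiff.2 ⟨hn, hn₀⟩)
      have h₂ : (m.1 n).toNat ≤ k :=
        Finset.single_le_sum (f := fun n => (m.1 n).toNat) (fun _ _ => Nat.zero_le _) hn
      have h₃ : m.1 n ≤ k := by omega
      nlinarith
  have hsum : (⟨_, hk⟩ : dualMonoid σ) + m = k • p := Subtype.ext (by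
    change k • p.1 - m.1 + m.1 = ((k • p : dualMonoid σ) : CharLattice N)
    rw [sub_add_cancel, AddSubmonoidClass.coe_nsmul])
  have := congrArg ξ hsum
  rw [Chart.map_add, hm, mul_zero, Chart.map_nsmul] at this
  exact pow_ne_zero k hp this.symm

variable [Module.Free ℤ N] [Module.Finite ℤ N]

/-- A basis of the group generated by the characters that do not vanish at `ξ`. -/
structure FaceBasis (ξ : Chart σ) where
  /-- the index set -/
  J : Type
  [fintype : Fintype J]
  /-- the basis vectors -/
  b : J → CharLattice N
  /-- their positive parts -/
  p : J → dualMonoid σ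
  /-- their negative parts -/
  r : J → dualMonoid σ
  hp : ∀ j, ξ (p j) ≠ 0
  hr : ∀ j, ξ (r j) ≠ 0
  hb : ∀ j, b j = (p j : CharLattice N) - r j
  span : ∀ m : dualMonoid σ, ξ m ≠ 0 → ∃ c : J → ℤ, (m : CharLattice N) = ∑ j, c j • b j
  ext : ∀ g : J → ℂ, ∃ l : LieAlg N, ∀ j, lin (b j) l = g j

attribute [instance] FaceBasis.fintype

/-- The characters that do not vanish at `ξ` are closed under addition, so the elements of the group
`L` they generate are differences of two of them; `L` is free as a subgroup of the character
lattice. -/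
lemma nonempty_faceBasis (ξ : Chart σ) : Nonempty (FaceBasis ξ) := by
  let F : Set (CharLattice N) := {m | ∃ h : m ∈ dualMonoid σ, ξ ⟨m, h⟩ ≠ 0}
  let L : Submodule ℤ (CharLattice N) := Submodule.span ℤ F
  let b := Module.Free.chooseBasis ℤ L
  have hL : ∀ l ∈ L, ∃ p r : dualMonoid σ, ξ p ≠ 0 ∧ ξ r ≠ 0 ∧ l = (p : CharLattice N) - r := by
    intro l hl
    have hl' : l ∈ AddSubgroup.closure F := by
      rw [← Submodule.span_int_eq_addSubgroupClosure]
      exact hl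
    induction hl' using AddSubgroup.closure_induction with
    | mem x hx =>
      obtain ⟨hx, hx'⟩ := hx
      exact ⟨⟨x, hx⟩, 0, hx', by rw [Chart.map_zero]; exact one_ne_zero, by simp⟩
    | zero =>
      exact ⟨0, 0, by rw [Chart.map_zero]; exact one_ne_zero,
        by rw [Chart.map_zero]; exact one_ne_zero, by simp⟩
    | add x y hx hy ihx ihy =>
      obtain ⟨p, r, hp, hr, h⟩ := ihx (by
        change x ∈ Submodule.span ℤ F
        rw [← Submodule.mem_toAddSubgroup, Submodule.span_int_eq_addSubgroupClosure]; exact hx)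
      obtain ⟨p', r', hp', hr', h'⟩ := ihy (by
        change y ∈ Submodule.span ℤ F
        rw [← Submodule.mem_toAddSubgroup, Submodule.span_int_eq_addSubgroupClosure]; exact hy)
      refine ⟨p + p', r + r', by rw [Chart.map_add]; exact mul_ne_zero hp hp',
        by rw [Chart.map_add]; exact mul_ne_zero hr hr', ?_⟩
      rw [h, h', AddSubmonoid.coe_add, AddSubmonoid.coe_add]
      abel
    | neg x hx ihx =>
      obtain ⟨p, r, hp, hr, h⟩ := ihx (by
        change x ∈ Submodule.span ℤ F
        rw [← Submodule.mem_toAddSubgroup, Submodule.span_int_eq_addSubgroupClosure]; exact hx)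
      exact ⟨r, p, hr, hp, by rw [h, neg_sub]⟩
  choose p r hp hr hpr using fun j => hL (b j) (b j).2
  refine ⟨{ J := _, b := fun j => b j, p := p, r := r, hp := hp, hr := hr, hb := hpr,
            span := fun m hm => ?_, ext := fun g => ?_ }⟩
  · have hmL : (m : CharLattice N) ∈ L := Submodule.subset_span ⟨m.2, hm⟩
    refine ⟨fun j => b.repr ⟨m, hmL⟩ j, ?_⟩
    have := congrArg (Subtype.val : L → CharLattice N) (b.sum_repr ⟨m, hmL⟩)
    exact this.symm.trans (AddSubmonoidClass.coe_finsetSum _ _)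
  · let f : L →+ ℂ := (b.constr ℤ g).toAddMonoidHom
    -- `L` need not be a direct summand a priori, but `ℂ` is divisible, so homomorphisms to it
    -- extend.
    obtain ⟨f', hf'⟩ := (Module.Baer.of_divisible ℂ).extension_property_addMonoidHom
      L.subtype.toAddMonoidHom Subtype.val_injective f
    obtain ⟨l, hl⟩ := exists_lin_eq f'
    refine ⟨l, fun j => (hl _).trans ((DFunLike.congr_fun hf' (b j)).trans ?_)⟩
    exact b.constr_basis ℤ g j

namespace FaceBasis

variable {ξ : Chart σ} (B : FaceBasis ξ)

/-- The value at `y / ξ` of a basis vector. -/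
def ratio (j : B.J) (y : Chart σ) : ℂ := y (B.p j) * ξ (B.r j) / (y (B.r j) * ξ (B.p j))

/-- The quotient of `y` by `ξ` is multiplicative on the group generated by the nonvanishing
characters. `Q x a` says, for a representation of `x` as a difference, that the quotient takes the
value `exp a` at `x`; this is propagated through sums and integer multiples. -/
lemma eq_exp_of_ratio {y : Chart σ} (hy : ∀ m, ξ m ≠ 0 → y m ≠ 0) {h : B.J → ℂ}
    (hh : ∀ j, B.ratio j y = Complex.exp (h j)) {m : dualMonoid σ} (hm : ξ m ≠ 0) {c : B.J → ℤ}
    (hc : (m : CharLattice N) = ∑ j, c j • B.b j) :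
    y m = Complex.exp (∑ j, (c j : ℂ) * h j) * ξ m := by
  let Q : CharLattice N → ℂ → Prop := fun x a => ∃ p r : dualMonoid σ, ξ p ≠ 0 ∧ ξ r ≠ 0 ∧
    x = (p : CharLattice N) - r ∧ y p * ξ r = Complex.exp a * (y r * ξ p)
  have Q_zero : Q 0 0 := ⟨0, 0, by rw [Chart.map_zero]; exact one_ne_zero,
    by rw [Chart.map_zero]; exact one_ne_zero, by simp, by simp⟩
  have Q_add : ∀ x x' a a', Q x a → Q x' a' → Q (x + x') (a + a') := by
    rintro x x' a a' ⟨p, r, hp, hr, h, e⟩ ⟨p', r', hp', hr', h', e'⟩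
    refine ⟨p + p', r + r', by rw [Chart.map_add]; exact mul_ne_zero hp hp',
        by rw [Chart.map_add]; exact mul_ne_zero hr hr', ?_, ?_⟩
    · rw [h, h', AddSubmonoid.coe_add, AddSubmonoid.coe_add]
      abel
    · simp only [Chart.map_add, Complex.exp_add]
      linear_combination y p' * ξ r' * e + Complex.exp a * (y r * ξ p) * e'
  have Q_neg : ∀ x a, Q x a → Q (-x) (-a) := by
    rintro x a ⟨p, r, hp, hr, h, e⟩
    refine ⟨r, p, hr, hp, by rw [h, neg_sub], ?_⟩
    rw [Complex.exp_neg, e, inv_mul_cancel_left₀ (Complex.exp_ne_zero a)]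
  have Q_nsmul : ∀ x a, Q x a → ∀ k : ℕ, Q (k • x) (k * a) := by
    intro x a hx k
    induction k with
    | zero => simpa using Q_zero
    | succ k ih =>
      rw [succ_nsmul]
      push_cast
      rw [add_mul, one_mul]
      exact Q_add _ _ _ _ ih hx
  have Q_zsmul : ∀ x a, Q x a → ∀ k : ℤ, Q (k • x) (k * a) := by
    intro x a hx k
    obtain ⟨k, rfl | rfl⟩ := k.eq_nat_or_neg
    · simpa using Q_nsmul x a hx k
    · have := Q_neg _ _ (Q_nsmul x a hx k)
      simpa using this
  have Q_sum : ∀ s : Finset B.J, Q (∑ j ∈ s, c j • B.b j) (∑ j ∈ s, (c j : ℂ) * h j) := by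
    classical
    intro s
    induction s using Finset.induction_on with
    | empty => simpa using Q_zero
    | insert j s hj ih =>
      rw [Finset.sum_insert hj, Finset.sum_insert hj]
      refine Q_add _ _ _ _ (Q_zsmul _ _ ⟨B.p j, B.r j, B.hp j, B.hr j, B.hb j, ?_⟩ _) ih
      rw [← hh j, ratio, div_mul_cancel₀ _ (mul_ne_zero (hy _ (B.hr j)) (B.hp j))]
  obtain ⟨p, r, hp, hr, e₁, e₂⟩ := Q_sum Finset.univ
  rw [← hc] at e₁
  have e₃ : m + r = p := Subtype.ext (by
    rw [AddSubmonoid.coe_add, e₁, sub_add_cancel])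
  rw [← e₃, Chart.map_add, Chart.map_add] at e₂
  refine mul_right_cancel₀ (mul_ne_zero (hy r hr) hr) ?_
  linear_combination e₂

/-- Characters that do not vanish where `ξ` does not are translates of `ξ` there. -/
lemma exists_eq_exp_lin (B : FaceBasis ξ) {y : Chart σ} (hy : ∀ m, ξ m ≠ 0 → y m ≠ 0) :
    ∃ g : LieAlg N, ∀ m, ξ m ≠ 0 → y m = Complex.exp (lin (m : CharLattice N) g) * ξ m := by
  have hne : ∀ j, B.ratio j y ≠ 0 := fun j => div_ne_zero
    (mul_ne_zero (hy _ (B.hp j)) (B.hr j)) (mul_ne_zero (hy _ (B.hr j)) (B.hp j))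
  obtain ⟨g, hg⟩ := B.ext fun j => Complex.log (B.ratio j y)
  refine ⟨g, fun m hm => ?_⟩
  obtain ⟨c, hc⟩ := B.span m hm
  rw [B.eq_exp_of_ratio hy (h := fun j => lin (B.b j) g)
    (fun j => by rw [hg, Complex.exp_log (hne j)]) hm hc, hc, lin_sum_zsmul]

lemma ratio_eq_exp {y : Chart σ} {g : LieAlg N}
    (hg : ∀ m, ξ m ≠ 0 → y m = Complex.exp (lin (m : CharLattice N) g) * ξ m) (j : B.J) :
    B.ratio j y = Complex.exp (lin (B.b j) g) := by
  rw [ratio, hg _ (B.hp j), hg _ (B.hr j), B.hb, lin_sub_left, Complex.exp_sub]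
  have h₁ := B.hp j
  have h₂ := B.hr j
  have h₃ := Complex.exp_ne_zero (lin (B.r j : CharLattice N) g)
  field_simp

variable (A : Finset (dualMonoid σ))

/-- Basic neighbourhoods of the points of the orbit of `ξ`. -/
def nbhd (h₀ : B.J → ℂ) (ε R : ℝ) : Set (Chart σ) :=
  {y | (∀ a ∈ A, ξ a ≠ 0 → y a ≠ 0) ∧
    (∀ j, (y (B.p j) ≠ 0 ∧ y (B.r j) ≠ 0) ∧
      B.ratio j y ∈ Complex.exp '' Metric.ball (h₀ j) ε) ∧ ∀ a ∈ A, ξ a = 0 → ‖y a‖ < R}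

lemma isOpen_nbhd (h₀ : B.J → ℂ) (ε R : ℝ) : IsOpen (B.nbhd A h₀ ε R) := by
  have ho : ∀ m, IsOpen {y : Chart σ | y m ≠ 0} := fun m =>
    isOpen_ne.preimage (Chart.continuous_eval m)
  refine IsOpen.inter ?_ (IsOpen.inter ?_ ?_)
  · have : {y : Chart σ | ∀ a ∈ A, ξ a ≠ 0 → y a ≠ 0} =
        ⋂ a ∈ A, {y : Chart σ | ξ a ≠ 0 → y a ≠ 0} := by ext; simp
    change IsOpen {y : Chart σ | ∀ a ∈ A, ξ a ≠ 0 → y a ≠ 0}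
    rw [this]
    refine isOpen_biInter_finset fun a _ => ?_
    by_cases h : ξ a = 0
    · simp [h]
    · simpa [h] using ho a
  · have : {y : Chart σ | ∀ j, (y (B.p j) ≠ 0 ∧ y (B.r j) ≠ 0) ∧
        B.ratio j y ∈ Complex.exp '' Metric.ball (h₀ j) ε} =
        ⋂ j, {y : Chart σ | (y (B.p j) ≠ 0 ∧ y (B.r j) ≠ 0) ∧
        B.ratio j y ∈ Complex.exp '' Metric.ball (h₀ j) ε} := by ext; simp
    change IsOpen {y : Chart σ | ∀ j, (y (B.p j) ≠ 0 ∧ y (B.r j) ≠ 0) ∧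
        B.ratio j y ∈ Complex.exp '' Metric.ball (h₀ j) ε}
    rw [this]
    refine isOpen_iInter_of_finite fun j => ?_
    refine ContinuousOn.isOpen_inter_preimage (f := B.ratio j) ?_ ((ho _).inter (ho _))
      (Complex.isOpenMap_exp _ Metric.isOpen_ball)
    refine ContinuousOn.div ?_ ?_ fun y hy => mul_ne_zero hy.2 (B.hp j)
    · exact ((Chart.continuous_eval _).mul continuous_const).continuousOn
    · exact ((Chart.continuous_eval _).mul continuous_const).continuousOn
  · have : {y : Chart σ | ∀ a ∈ A, ξ a = 0 → ‖y a‖ < R} =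
        ⋂ a ∈ A, {y : Chart σ | ξ a = 0 → ‖y a‖ < R} := by ext; simp
    change IsOpen {y : Chart σ | ∀ a ∈ A, ξ a = 0 → ‖y a‖ < R}
    rw [this]
    refine isOpen_biInter_finset fun a _ => ?_
    by_cases h : ξ a = 0
    · simpa [h] using isOpen_lt (Chart.continuous_eval a).norm continuous_const
    · simp [h]

/-- The cells of which the inverse image of a basic neighbourhood consists. -/
def cell (υ : Chart σ) (g : LieAlg N) (h₀ : B.J → ℂ) (ε R : ℝ) (k : B.J → ℤ) : Set (LieAlg N) :=
  {l | (∀ j, lin (B.b j) l ∈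
      Metric.ball (h₀ j + k j * (2 * Real.pi * Complex.I) - lin (B.b j) g) ε) ∧
    ∀ a ∈ A, ξ a = 0 → ‖Complex.exp (lin (a : CharLattice N) l) * υ a‖ < R}

variable {A} in
-- The ratios at the translate are exponentials of linear functions of `l + g`. Lying in the
-- exponential of a ball means lying in the ball up to a multiple of `2πi`; these multiples number
-- the cells.
lemma smul_mem_nbhd_iff {υ : Chart σ} {g : LieAlg N}
    (hg : ∀ m, ξ m ≠ 0 → υ m = Complex.exp (lin (m : CharLattice N) g) * ξ m)
    (h₀ : B.J → ℂ) (ε R : ℝ) (l : LieAlg N) :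
    Chart.smul (expT l) υ ∈ B.nbhd A h₀ ε R ↔ ∃ k, l ∈ B.cell A υ g h₀ ε R k := by
  have hg' : ∀ m, ξ m ≠ 0 → Chart.smul (expT l) υ m =
      Complex.exp (lin (m : CharLattice N) (l + g)) * ξ m := by
    intro m hm
    rw [Chart.smul_apply, expT_apply, hg m hm, map_add, Complex.exp_add, mul_assoc]
  have hne : ∀ m, ξ m ≠ 0 → Chart.smul (expT l) υ m ≠ 0 := fun m hm => by
    rw [hg' m hm]
    exact mul_ne_zero (Complex.exp_ne_zero _) hm
  have hmem : ∀ j, B.ratio j (Chart.smul (expT l) υ) ∈ Complex.exp '' Metric.ball (h₀ j) ε ↔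
      ∃ k : ℤ, lin (B.b j) l ∈
        Metric.ball (h₀ j + k * (2 * Real.pi * Complex.I) - lin (B.b j) g) ε := by
    intro j
    rw [B.ratio_eq_exp hg']
    constructor
    · rintro ⟨h, hh, e⟩
      obtain ⟨k, hk⟩ := Complex.exp_eq_exp_iff_exists_int.1 e.symm
      refine ⟨k, ?_⟩
      rw [map_add] at hk
      rw [mem_ball_iff_norm] at hh ⊢
      convert hh using 2
      linear_combination hk
    · rintro ⟨k, hk⟩
      refine ⟨lin (B.b j) (l + g) - k * (2 * Real.pi * Complex.I), ?_, ?_⟩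
      · rw [mem_ball_iff_norm] at hk ⊢
        convert hk using 2
        rw [map_add]
        ring
      · exact Complex.exp_eq_exp_iff_exists_int.2 ⟨-k, by push_cast; ring⟩
  constructor
  · rintro ⟨-, h₂, h₃⟩
    choose k hk using fun j => (hmem j).1 (h₂ j).2
    exact ⟨k, hk, h₃⟩
  · rintro ⟨k, hk, h₃⟩
    exact ⟨fun a _ ha => hne a ha, fun j => ⟨⟨hne _ (B.hp j), hne _ (B.hr j)⟩,
      (hmem j).2 ⟨k j, hk j⟩⟩, h₃⟩

lemma isOpen_cell (υ : Chart σ) (g : LieAlg N) (h₀ : B.J → ℂ) (ε R : ℝ) (k : B.J → ℤ) :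
    IsOpen (B.cell A υ g h₀ ε R k) := by
  refine IsOpen.inter ?_ ?_
  · have : {l : LieAlg N | ∀ j, lin (B.b j) l ∈
        Metric.ball (h₀ j + k j * (2 * Real.pi * Complex.I) - lin (B.b j) g) ε} =
        ⋂ j, lin (B.b j) ⁻¹'
          Metric.ball (h₀ j + k j * (2 * Real.pi * Complex.I) - lin (B.b j) g) ε := by ext; simp
    change IsOpen {l : LieAlg N | ∀ j, lin (B.b j) l ∈
        Metric.ball (h₀ j + k j * (2 * Real.pi * Complex.I) - lin (B.b j) g) ε}
    rw [this]
    exact isOpen_iInter_of_finite fun j => Metric.isOpen_ball.preimage (continuous_lin _)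
  · have : {l : LieAlg N | ∀ a ∈ A, ξ a = 0 →
        ‖Complex.exp (lin (a : CharLattice N) l) * υ a‖ < R} = ⋂ a ∈ A, {l : LieAlg N | ξ a = 0 →
        ‖Complex.exp (lin (a : CharLattice N) l) * υ a‖ < R} := by ext; simp
    change IsOpen {l : LieAlg N | ∀ a ∈ A, ξ a = 0 →
        ‖Complex.exp (lin (a : CharLattice N) l) * υ a‖ < R}
    rw [this]
    refine isOpen_biInter_finset fun a _ => ?_
    by_cases h : ξ a = 0
    · have hc : Continuous fun l : LieAlg N => ‖Complex.exp (lin (a : CharLattice N) l) * υ a‖ :=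
        ((Complex.continuous_exp.comp (continuous_lin a.1)).mul
          (continuous_const (y := υ a))).norm
      simpa only [h, true_implies] using isOpen_lt hc continuous_const
    · simp [h]

/-- The first conditions are inverse images of balls under linear maps. The others bound the
exponential of a real linear function, so each is the inverse image of a lower set of reals. -/
lemma convex_cell (υ : Chart σ) (g : LieAlg N) (h₀ : B.J → ℂ) (ε R : ℝ) (k : B.J → ℤ) :
    Convex ℝ (B.cell A υ g h₀ ε R k) := by
  refine Convex.inter ?_ ?_
  · have : {l : LieAlg N | ∀ j, lin (B.b j) l ∈
        Metric.ball (h₀ j + k j * (2 * Real.pi * Complex.I) - lin (B.b j) g) ε} =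
        ⋂ j, (lin (B.b j)).restrictScalars ℝ ⁻¹'
          Metric.ball (h₀ j + k j * (2 * Real.pi * Complex.I) - lin (B.b j) g) ε := by ext; simp
    change Convex ℝ {l : LieAlg N | ∀ j, lin (B.b j) l ∈
        Metric.ball (h₀ j + k j * (2 * Real.pi * Complex.I) - lin (B.b j) g) ε}
    rw [this]
    exact convex_iInter fun j => (convex_ball _ _).linear_preimage _
  · have : {l : LieAlg N | ∀ a ∈ A, ξ a = 0 →
        ‖Complex.exp (lin (a : CharLattice N) l) * υ a‖ < R} = ⋂ a ∈ A, {l : LieAlg N | ξ a = 0 →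
        ‖Complex.exp (lin (a : CharLattice N) l) * υ a‖ < R} := by ext; simp
    change Convex ℝ {l : LieAlg N | ∀ a ∈ A, ξ a = 0 →
        ‖Complex.exp (lin (a : CharLattice N) l) * υ a‖ < R}
    rw [this]
    refine convex_iInter₂ fun a _ => ?_
    by_cases h : ξ a = 0
    · have h₁ : Convex ℝ {t : ℝ | Real.exp t * ‖υ a‖ < R} := by
        have : IsLowerSet {t : ℝ | Real.exp t * ‖υ a‖ < R} := fun t t' h ht =>
          lt_of_le_of_lt (mul_le_mul_of_nonneg_right (Real.exp_le_exp.2 h) (norm_nonneg _)) ht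
        exact this.ordConnected.convex
      have h₂ := h₁.linear_preimage (Complex.reLm ∘ₗ (lin (a : CharLattice N)).restrictScalars ℝ)
      have h₃ : {l : LieAlg N | ξ a = 0 → ‖Complex.exp (lin (a : CharLattice N) l) * υ a‖ < R} =
          (Complex.reLm ∘ₗ (lin (a : CharLattice N)).restrictScalars ℝ) ⁻¹'
            {t : ℝ | Real.exp t * ‖υ a‖ < R} := by
        refine Set.ext fun l => ?_
        change (ξ a = 0 → ‖Complex.exp (lin (a : CharLattice N) l) * υ a‖ < R) ↔
          Real.exp (lin (a : CharLattice N) l).re * ‖υ a‖ < R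
        rw [norm_mul, Complex.norm_exp, forall_prop_of_true h]
      rw [h₃]
      exact h₂
    · simp only [h, false_implies]
      exact convex_univ

/-- Start at a point `l` hitting the centres of all balls and move towards the relative interior of
the face: the basis characters stay fixed along `ν`, while those vanishing at `ξ` are scaled to
zero. -/
lemma nonempty_cell {s : Finset N}
    (hs : σ = PointedCone.hull ℝ ((fun n : N => 1 ⊗ₜ[ℤ] n) '' s)) (υ : Chart σ) (g : LieAlg N)
    (h₀ : B.J → ℂ) {ε R : ℝ} (hε : 0 < ε) (hR : 0 < R) (k : B.J → ℤ) :
    (B.cell A υ g h₀ ε R k).Nonempty := by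
  obtain ⟨n, hn⟩ := exists_face_vector hs ξ
  obtain ⟨ν, hν⟩ := exists_lin_eq_apply n
  obtain ⟨l, hl⟩ := B.ext fun j => h₀ j + k j * (2 * Real.pi * Complex.I) - lin (B.b j) g
  have hlim : ∀ a ∈ A, ∀ᶠ T : ℝ in Filter.atTop, ξ a = 0 →
      ‖Complex.exp (lin (a : CharLattice N) (l - (T : ℂ) • ν)) * υ a‖ < R := by
    intro a _
    by_cases ha : ξ a = 0
    · have hpos : (0 : ℝ) < (a : CharLattice N) n := by exact_mod_cast (hn a).2 ha
      have h₁ : Filter.Tendsto (fun T : ℝ => (lin (a : CharLattice N) l).re -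
          T * ((a : CharLattice N) n : ℝ)) Filter.atTop Filter.atBot := by
        have := Filter.tendsto_id.atTop_mul_const (r := ((a : CharLattice N) n : ℝ)) hpos
        simp only [sub_eq_add_neg]
        exact tendsto_const_nhds.add_atBot (Filter.tendsto_neg_atTop_atBot.comp this)
      have h₂ := (Real.tendsto_exp_atBot.comp h₁).mul_const ‖υ a‖
      rw [zero_mul] at h₂
      filter_upwards [h₂.eventually (gt_mem_nhds hR)] with T hT _
      rw [norm_mul, Complex.norm_exp, map_sub, map_smul, hν]
      simpa using hT
    · exact Filter.Eventually.of_forall fun T h => absurd h ha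
  obtain ⟨T, hT⟩ := ((Filter.eventually_all_finset A).2 hlim).exists
  refine ⟨l - (T : ℂ) • ν, fun j => ?_, hT⟩
  have h₁ : lin (B.b j) ν = 0 := by
    rw [B.hb, lin_sub_left, hν, hν, (hn _).1 (B.hp j), (hn _).1 (B.hr j), sub_self]
  rw [map_sub, map_smul, h₁, smul_zero, sub_zero, hl]
  exact Metric.mem_ball_self hε

variable {A} in
lemma cell_subset {υ : Chart σ} {g : LieAlg N} {h₀ h₁ : B.J → ℂ} {ε ε' R R' : ℝ} (k : B.J → ℤ)
    (hε : ∀ j, ‖h₁ j - h₀ j‖ + ε' ≤ ε) (hR : R' ≤ R) :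
    B.cell A υ g h₁ ε' R' k ⊆ B.cell A υ g h₀ ε R k := by
  rintro l ⟨hl, hl'⟩
  refine ⟨fun j => Metric.ball_subset ?_ (hl j), fun a ha h => (hl' a ha h).trans_le hR⟩
  rw [dist_eq_norm]
  have : h₁ j + k j * (2 * Real.pi * Complex.I) - lin (B.b j) g -
      (h₀ j + k j * (2 * Real.pi * Complex.I) - lin (B.b j) g) = h₁ j - h₀ j := by ring
  rw [this]
  linarith [hε j]

variable {A} in
-- For radius one, the centres of the balls in some coordinate are at least `2π` apart, more than
-- the sum of the radii.
lemma disjoint_cell {υ : Chart σ} {g : LieAlg N} {h₀ : B.J → ℂ} {R : ℝ} {k k' : B.J → ℤ}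
    (hk : k ≠ k') : Disjoint (B.cell A υ g h₀ 1 R k) (B.cell A υ g h₀ 1 R k') := by
  rw [Set.disjoint_left]
  rintro l ⟨hl, -⟩ ⟨hl', -⟩
  obtain ⟨j, hj⟩ := Function.ne_iff.1 hk
  have h₁ := hl j
  have h₂ := hl' j
  rw [Metric.mem_ball, dist_comm] at h₁
  rw [Metric.mem_ball] at h₂
  have h₃ := dist_triangle (h₀ j + k j * (2 * Real.pi * Complex.I) - lin (B.b j) g)
    (lin (B.b j) l) (h₀ j + k' j * (2 * Real.pi * Complex.I) - lin (B.b j) g)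
  rw [dist_eq_norm (h₀ j + k j * (2 * Real.pi * Complex.I) - lin (B.b j) g)
    (h₀ j + k' j * (2 * Real.pi * Complex.I) - lin (B.b j) g)] at h₃
  have h₄ : h₀ j + k j * (2 * Real.pi * Complex.I) - lin (B.b j) g -
      (h₀ j + k' j * (2 * Real.pi * Complex.I) - lin (B.b j) g) =
      ((k j - k' j : ℤ) : ℂ) * (2 * Real.pi * Complex.I) := by push_cast; ring
  rw [h₄, norm_mul, Complex.norm_intCast] at h₃
  have h₅ : ‖(2 * Real.pi * Complex.I : ℂ)‖ = 2 * Real.pi := by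
    simp [abs_of_pos Real.pi_pos]
  have h₆ : (1 : ℝ) ≤ |((k j - k' j : ℤ) : ℝ)| := by
    exact_mod_cast Int.one_le_abs (sub_ne_zero.2 hj)
  rw [h₅] at h₃
  have := Real.pi_gt_three
  nlinarith

end FaceBasis

end Face

end

end Toric

namespace Toric

noncomputable section

/-! ### Neighbourhood bases at the points of an orbit -/

section Neighbourhoods

variable {N : Type} [AddCommGroup N] [Module.Free ℤ N] [Module.Finite ℤ N]
  {σ : PointedCone ℝ (ℝ ⊗[ℤ] N)} {ξ : Chart σ} {A : Finset (dualMonoid σ)}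

lemma ne_zero_of_generators (hA : AddSubmonoid.closure (A : Set (dualMonoid σ)) = ⊤)
    {y : Chart σ} (h : ∀ a ∈ A, ξ a ≠ 0 → y a ≠ 0) (m : dualMonoid σ) : ξ m ≠ 0 → y m ≠ 0 := by
  refine dualMonoid_induction hA (p := fun m => ξ m ≠ 0 → y m ≠ 0) (fun _ => ?_) h
    (fun a b ha hb hab => ?_) m
  · rw [Chart.map_zero]
    exact one_ne_zero
  · rw [Chart.map_add] at hab ⊢
    exact mul_ne_zero (ha (left_ne_zero_of_mul hab)) (hb (right_ne_zero_of_mul hab))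

lemma Chart.exists_forall_norm_lt (hA : AddSubmonoid.closure (A : Set (dualMonoid σ)) = ⊤)
    {ζ : Chart σ} {V : Set (Chart σ)} (hV : IsOpen V) (hζ : ζ ∈ V) :
    ∃ δ > 0, ∀ y : Chart σ, (∀ a ∈ A, ‖y a - ζ a‖ < δ) → y ∈ V := by
  have h := hV.mem_nhds hζ
  rw [(Chart.isInducing_generators hA).nhds_eq_comap, Filter.mem_comap] at h
  obtain ⟨T, hT, hTV⟩ := h
  obtain ⟨δ, hδ, hb⟩ := Metric.mem_nhds_iff.1 hT
  refine ⟨δ, hδ, fun y hy => hTV (hb ?_)⟩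
  rw [Metric.mem_ball, dist_pi_lt_iff hδ]
  intro a
  rw [dist_eq_norm]
  exact hy a a.2

namespace FaceBasis

variable (B : FaceBasis ξ)

lemma self_mem_nbhd {h₀ : B.J → ℂ} {ε R : ℝ} (hε : 0 < ε) (hR : 0 < R) {ζ : Chart σ}
    (hζ : ∀ m, ζ m = 0 ↔ ξ m = 0) (hh : ∀ j, B.ratio j ζ = Complex.exp (h₀ j)) :
    ζ ∈ B.nbhd A h₀ ε R := by
  have hne : ∀ m, ξ m ≠ 0 → ζ m ≠ 0 := fun m hm h => hm ((hζ m).1 h)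
  refine ⟨fun a _ => hne a, fun j => ⟨⟨hne _ (B.hp j), hne _ (B.hr j)⟩,
    h₀ j, Metric.mem_ball_self hε, (hh j).symm⟩, fun a _ h => ?_⟩
  rw [(hζ a).2 h, norm_zero]
  exact hR

lemma ratio_self (j : B.J) : B.ratio j ξ = Complex.exp 0 := by
  rw [ratio, Complex.exp_zero, mul_comm, div_self (mul_ne_zero (B.hr j) (B.hp j))]

/-- The basic neighbourhoods of a point of the orbit of `ξ` form a neighbourhood basis. -/
lemma exists_nbhd_subset (hA : AddSubmonoid.closure (A : Set (dualMonoid σ)) = ⊤)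
    {ζ : Chart σ} (hζ : ∀ m, ζ m = 0 ↔ ξ m = 0) (hζ' : ζ ∈ B.nbhd A 0 1 1)
    {V : Set (Chart σ)} (hV : IsOpen V) (hζV : ζ ∈ V) :
    ∃ (h₀ : B.J → ℂ) (ε R : ℝ), 0 < ε ∧ 0 < R ∧ R ≤ 1 ∧ (∀ j, ‖h₀ j - 0‖ + ε ≤ 1) ∧
      ζ ∈ B.nbhd A h₀ ε R ∧ B.nbhd A h₀ ε R ⊆ V := by
  obtain ⟨δ, hδ, hδV⟩ := Chart.exists_forall_norm_lt hA hV hζV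
  -- Logarithms of the ratios at `ζ`, in the open unit balls because `ζ` lies in the large
  -- neighbourhood. They become the centre of the small one.
  choose h₀ hh₀ hr₀ using fun j => (hζ'.2.1 j).2
  have hne : ∀ m, ξ m ≠ 0 → ζ m ≠ 0 := fun m hm h => hm ((hζ m).1 h)
  have hnorm : ‖h₀‖ < 1 := by
    rw [pi_norm_lt_iff one_pos]
    intro j
    have := hh₀ j
    rwa [Pi.zero_apply, mem_ball_zero_iff] at this
  choose! c hc using B.span
  have hev : ∀ᶠ h in 𝓝 h₀, ∀ a ∈ A, ξ a ≠ 0 →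
      ‖Complex.exp (∑ j, (c a j : ℂ) * h j) * ξ a - ζ a‖ < δ := by
    rw [Filter.eventually_all_finset]
    intro a _
    by_cases ha : ξ a = 0
    · exact Filter.Eventually.of_forall fun h h' => absurd ha h'
    have hcont : Continuous fun h : B.J → ℂ =>
        ‖Complex.exp (∑ j, (c a j : ℂ) * h j) * ξ a - ζ a‖ := by fun_prop
    have h0 : ‖Complex.exp (∑ j, (c a j : ℂ) * h₀ j) * ξ a - ζ a‖ < δ := by
      rw [B.eq_exp_of_ratio hne (fun j => (hr₀ j).symm) ha (hc a ha), sub_self, norm_zero]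
      exact hδ
    filter_upwards [hcont.continuousAt.eventually (gt_mem_nhds h0)] with h hh _ using hh
  obtain ⟨ε₁, hε₁, hball⟩ := Metric.eventually_nhds_iff.1 hev
  -- `ε₁` controls the characters that do not vanish at `ξ`, and `1 - ‖h₀‖` keeps the small balls
  -- inside the unit balls; the remaining characters are controlled by the other radius, `min 1 δ`.
  have hε : 0 < min ε₁ (1 - ‖h₀‖) := lt_min hε₁ (by linarith)
  have hR : 0 < min 1 δ := lt_min one_pos hδ
  refine ⟨h₀, min ε₁ (1 - ‖h₀‖), min 1 δ, hε, hR, min_le_left _ _, fun j => ?_,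
    B.self_mem_nbhd hε hR hζ fun j => (hr₀ j).symm, fun y hy => hδV y fun a ha => ?_⟩
  · have h₁ := norm_le_pi_norm h₀ j
    have h₂ := min_le_right ε₁ (1 - ‖h₀‖)
    rw [sub_zero]
    linarith
  · by_cases ha' : ξ a = 0
    · rw [(hζ a).2 ha', sub_zero]
      exact (hy.2.2 a ha ha').trans_le (min_le_right _ _)
    · choose h hh hr using fun j => (hy.2.1 j).2
      rw [B.eq_exp_of_ratio (ne_zero_of_generators hA hy.1) (fun j => (hr j).symm) ha' (hc a ha')]
      refine hball ?_ a ha ha'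
      rw [dist_pi_lt_iff hε₁]
      exact fun j => (hh j).trans_le (min_le_left _ _)

end FaceBasis

end Neighbourhoods

/-! ### The orbit maps cover toric varieties by sheets -/

section OrbitMap

variable {N : Type} [AddCommGroup N] [Module.Free ℤ N] [Module.Finite ℤ N] (Δ : Fan N)

lemma Fan.exists_chart_eq (x : Δ.X) : ∃ (σ : Δ.cones) (ξ : Chart σ.1), Δ.chart σ ξ = x := by
  obtain ⟨⟨σ, ξ⟩, rfl⟩ := Quotient.exists_rep x
  exact ⟨σ, ξ, rfl⟩

lemma Fan.continuous_expT_smul (x : Δ.X) : Continuous fun l : LieAlg N => expT l • x := by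
  obtain ⟨σ, ξ, rfl⟩ := Δ.exists_chart_eq x
  refine (Δ.isOpenEmbedding_chart σ).continuous.comp (Chart.continuous_iff.2 fun m => ?_)
  exact (Complex.continuous_exp.comp (continuous_lin m.1)).mul continuous_const

variable {κ : Type}

/-- The orbit maps of a family of points, composed with the exponential map of the torus. -/
def Fan.orbitMap (f : κ → Δ.X) : Sheets κ (LieAlg N) ⟶ TopCat.of Δ.X :=
  TopCat.ofHom ⟨fun z => expT z.2 • f z.1,
    continuous_sigma fun u => Δ.continuous_expT_smul (f u)⟩

lemma Fan.orbitMap_apply (f : κ → Δ.X) (u : κ) (l : LieAlg N) :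
    Δ.orbitMap f ⟨u, l⟩ = expT l • f u := rfl

variable {Δ} {σ : Δ.cones} {ξ : Chart σ.1} {A : Finset (dualMonoid σ.1)}

/-- A basic neighbourhood, as an open subset of the toric variety. -/
def FaceBasis.nbhdOpen (B : FaceBasis ξ) (A : Finset (dualMonoid σ.1)) (h₀ : B.J → ℂ) (ε R : ℝ) :
    Opens (TopCat.of Δ.X) :=
  ⟨Δ.chart σ '' B.nbhd A h₀ ε R, (Δ.isOpenEmbedding_chart σ).isOpenMap _ (B.isOpen_nbhd A h₀ ε R)⟩

/-- The inverse image of each basic neighbourhood is the union of cells numbered by a sheet and a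
vector of integers. The numbering is the same for all radii and centres, and all these cells are
nonempty, so the small cells match the large ones. -/
lemma FaceBasis.goodPair (B : FaceBasis ξ)
    (hA : AddSubmonoid.closure (A : Set (dualMonoid σ.1)) = ⊤) (f : κ → Δ.X)
    {h₀ : B.J → ℂ} {ε R : ℝ} (hε : 0 < ε) (hR : 0 < R) (hR' : R ≤ 1)
    (hh : ∀ j, ‖h₀ j - 0‖ + ε ≤ 1) :
    GoodPair ((Opens.map (Δ.orbitMap f)).obj (B.nbhdOpen A h₀ ε R))
      ((Opens.map (Δ.orbitMap f)).obj (B.nbhdOpen A 0 1 1)) := by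
  obtain ⟨s, hs⟩ := Δ.rational σ.1 σ.2
  -- These are the sheets that meet the neighbourhood: `f u` lies in the chart and no character
  -- vanishes there unless it vanishes at `ξ`.
  let P : κ → Prop := fun u => ∃ υ : Chart σ.1, Δ.chart σ υ = f u ∧ ∀ m, ξ m ≠ 0 → υ m ≠ 0
  choose υ hυ hne using fun u : Subtype P => u.2
  choose g hg using fun u : Subtype P => B.exists_eq_exp_lin (hne u)
  let C : (B.J → ℂ) → ℝ → ℝ → Subtype P × (B.J → ℤ) → Opens (Sheets κ (LieAlg N)) :=
    fun h₀ ε R k => sheetOpen k.1.1 (B.cell A (υ k.1) (g k.1) h₀ ε R k.2)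
      (B.isOpen_cell A _ _ _ _ _ _)
  have hC : ∀ h₀ ε R, (Opens.map (Δ.orbitMap f)).obj (B.nbhdOpen A h₀ ε R) = ⨆ k, C h₀ ε R k := by
    intro h₀ ε R
    ext ⟨u, l⟩
    rw [SetLike.mem_coe, SetLike.mem_coe, Opens.mem_iSup]
    constructor
    · rintro ⟨y, hy, he⟩
      have he : Δ.chart σ y = expT l • f u := he
      have hu : Δ.chart σ (Chart.smul (expT l)⁻¹ y) = f u := by
        rw [← Δ.smul_chart, he, inv_smul_smul]
      have hP : P u := ⟨_, hu, fun m hm => by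
        rw [Chart.smul_apply]
        exact mul_ne_zero (Torus.ne_zero _ _) (ne_zero_of_generators hA hy.1 m hm)⟩
      have hy' : Chart.smul (expT l) (υ ⟨u, hP⟩) = y := by
        refine (Δ.isOpenEmbedding_chart σ).injective ?_
        rw [← Δ.smul_chart, hυ, he]
      rw [← hy', B.smul_mem_nbhd_iff (hg ⟨u, hP⟩)] at hy
      obtain ⟨k, hk⟩ := hy
      exact ⟨(⟨u, hP⟩, k), l, hk, rfl⟩
    · rintro ⟨⟨u', k⟩, hk⟩
      obtain rfl := eq_of_mem_sheetOpen hk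
      have hk := mem_sheetOpen.1 hk
      refine ⟨_, (B.smul_mem_nbhd_iff (hg u') h₀ ε R l).2 ⟨k, hk⟩, ?_⟩
      rw [← Δ.smul_chart, hυ]
      rfl
  refine ⟨Subtype P × (B.J → ℤ), C 0 1 1, C h₀ ε R, fun k => ?_, fun k => ?_, fun k => ?_,
    fun k k' hk => ?_, hC _ _ _, hC _ _ _⟩
  · exact ⟨_, _, _, B.convex_cell A _ _ _ _ _ _, B.nonempty_cell A hs _ _ _ one_pos one_pos _, rfl⟩
  · exact ⟨_, _, _, B.convex_cell A _ _ _ _ _ _, B.nonempty_cell A hs _ _ _ hε hR _, rfl⟩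
  · exact Set.image_mono (B.cell_subset k.2 hh hR')
  · obtain ⟨u, k⟩ := k
    obtain ⟨u', k'⟩ := k'
    rw [Set.disjoint_left]
    rintro ⟨v, l⟩ h h'
    have e := Subtype.ext ((eq_of_mem_sheetOpen h).symm.trans (eq_of_mem_sheetOpen h'))
    subst e
    obtain rfl := eq_of_mem_sheetOpen h
    have hkk : k ≠ k' := fun e => hk (by rw [e])
    exact Set.disjoint_left.1 (B.disjoint_cell hkk) (mem_sheetOpen.1 h) (mem_sheetOpen.1 h')

variable (Δ) in
/-- The toric variety is locally conical along its orbits. -/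
lemma Fan.niceAlong (f : κ → Δ.X) (x₀ : Δ.X) : NiceAlong (Δ.orbitMap f) (Δ.orbitIncl x₀) := by
  rintro ⟨x, hx⟩
  obtain ⟨σ, ξ, rfl⟩ := Δ.exists_chart_eq x
  obtain ⟨s, hs⟩ := Δ.rational σ.1 σ.2
  obtain ⟨A, hA⟩ := exists_finset_closure_eq_top hs
  obtain ⟨B⟩ := nonempty_faceBasis ξ
  have hW : Δ.chart σ ξ ∈ B.nbhdOpen A 0 1 1 :=
    ⟨ξ, B.self_mem_nbhd one_pos one_pos (fun _ => Iff.rfl) B.ratio_self, rfl⟩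
  refine ⟨B.nbhdOpen A 0 1 1, hW, ?_⟩
  rintro ⟨y, hy⟩ hyW V hyV
  obtain ⟨ζ, hζW, rfl⟩ : ∃ ζ ∈ B.nbhd A 0 1 1, Δ.chart σ ζ = y := hyW
  -- The torus acts by nonzero scalars on characters, so the vanishing of a character is constant
  -- along the orbit.
  have hζ : ∀ m, ζ m = 0 ↔ ξ m = 0 := by
    rw [← MulAction.orbit_eq_iff.2 hx] at hy
    obtain ⟨t, ht⟩ := hy
    have ht : Chart.smul t ξ = ζ := (Δ.isOpenEmbedding_chart σ).injective ht
    intro m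
    rw [← ht, Chart.smul_apply, mul_eq_zero, or_iff_right (Torus.ne_zero t m)]
  obtain ⟨h₀, ε, R, hε, hR, hR', hh, hmem, hsub⟩ := B.exists_nbhd_subset hA hζ hζW
    (V.2.preimage (Δ.isOpenEmbedding_chart σ).continuous) hyV
  have hg := B.goodPair hA f hε hR hR' hh
  refine ⟨B.nbhdOpen A h₀ ε R, ⟨ζ, hmem, rfl⟩, ?_, ?_, hg⟩
  · refine Set.image_mono ?_
    rintro z ⟨h₁, h₂, h₃⟩
    refine ⟨h₁, fun j => ⟨(h₂ j).1, Set.image_mono (Metric.ball_subset ?_) (h₂ j).2⟩,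
      fun a ha h => (h₃ a ha h).trans_le hR'⟩
    rw [dist_eq_norm, Pi.zero_apply]
    linarith [hh j]
  · rintro _ ⟨z, hz, rfl⟩
    exact hsub hz

variable (Δ) in
-- One sheet for every point, which spares a choice of representatives of the orbits.
lemma Fan.orbitCover : OrbitCover Δ.orbitIncl (Δ.orbitMap id) where
  surjective x := ⟨⟨x, 0⟩, by rw [orbitMap_apply, expT_zero, one_smul]; rfl⟩
  factor x := ⟨x, fun l => ⟨expT l • x, expT l, rfl⟩,
    (Δ.continuous_expT_smul x).subtype_mk _, fun _ => rfl⟩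
  nice x := Δ.niceAlong _ x

variable (Y : SubMulAction (Torus N) Δ.X)

/-- The orbit maps of the points of `Y`. -/
def orbitMapSub : Sheets Y (LieAlg N) ⟶ TopCat.of Y :=
  TopCat.ofHom ⟨fun z => ⟨expT z.2 • (z.1 : Δ.X), Y.smul_mem _ z.1.2⟩,
    (Δ.orbitMap (Subtype.val : Y → Δ.X)).hom.continuous.subtype_mk _⟩

lemma isEmbedding_subIncl : Topology.IsEmbedding (subIncl Y) := Topology.IsEmbedding.subtypeVal

lemma orbitCoverSub : OrbitCover (orbitInclSub Y) (orbitMapSub Y) where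
  surjective y := ⟨⟨y, 0⟩, Subtype.ext (by
    change expT (0 : LieAlg N) • (y : Δ.X) = y
    rw [expT_zero, one_smul])⟩
  factor y := ⟨y, fun l => ⟨expT l • (y : Δ.X), expT l, rfl⟩,
    (Δ.continuous_expT_smul y).subtype_mk _, fun _ => rfl⟩
  nice y := NiceAlong.of_comp (isEmbedding_subIncl Y).isInducing (Δ.niceAlong _ (y : Δ.X))

end OrbitMap

/-! ### Invariance of closures -/

section Invariance

variable {N : Type} [AddCommGroup N] (Δ : Fan N)

lemma Fan.continuous_smul (t : Torus N) : Continuous fun x : Δ.X => t • x := by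
  refine continuous_quot_lift _ (continuous_sigma fun σ => ?_)
  have h : Continuous (Chart.smul t : Chart σ.1 → Chart σ.1) :=
    Chart.continuous_iff.2 fun m => continuous_const.mul (Chart.continuous_eval m)
  exact (Δ.isOpenEmbedding_chart σ).continuous.comp h

variable {Δ} (Y : SubMulAction (Torus N) Δ.X)

lemma smul_mem_closure_iff (t : Torus N) (x : Δ.X) :
    t • x ∈ closure (Y : Set Δ.X) ↔ x ∈ closure (Y : Set Δ.X) := by
  have h : ∀ (t : Torus N) (x : Δ.X), x ∈ closure (Y : Set Δ.X) →
      t • x ∈ closure (Y : Set Δ.X) := fun t x hx =>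
    map_mem_closure (Δ.continuous_smul t) hx fun y hy => Y.smul_mem t hy
  exact ⟨fun hx => by simpa using h t⁻¹ _ hx, h t x⟩

variable [Module.Free ℤ N] [Module.Finite ℤ N] {κ : Type} (f : κ → Δ.X)

lemma sheetInvariant_closureCompl :
    SheetInvariant (Δ.orbitMap f) (closureCompl (Y := TopCat.of Δ.X) (Y : Set Δ.X)) := by
  intro u x y h
  change ¬ expT y • f u ∈ closure (Y : Set Δ.X)
  have h : ¬ expT x • f u ∈ closure (Y : Set Δ.X) := h
  rwa [smul_mem_closure_iff] at h ⊢

lemma sheetInvariant_closedIn (hY : IsLocallyClosed (Y : Set Δ.X)) :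
    SheetInvariant (Δ.orbitMap f) (closedIn (Y := TopCat.of Δ.X) hY) := by
  intro u x y h
  change ¬ (expT y • f u ∈ closure (Y : Set Δ.X) ∧ expT y • f u ∉ Y)
  have h : ¬ (expT x • f u ∈ closure (Y : Set Δ.X) ∧ expT x • f u ∉ Y) := h
  have hmem : ∀ t : Torus N, t • f u ∈ Y ↔ f u ∈ Y := fun t =>
    ⟨fun h => by simpa using Y.smul_mem t⁻¹ h, Y.smul_mem t⟩
  rwa [smul_mem_closure_iff, hmem] at h ⊢

end Invariance

/-! ### Embedding charts in Euclidean space -/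

section Embeddable

/-- Missing coordinates are padded with zero functions, so that one dimension serves all charts. -/
lemma Embeddable.of_fintype {Y : TopCat.{0}} {W : Opens Y} {d : ℕ} {κ : Type} [Fintype κ]
    (hd : Fintype.card κ ≤ d) [T2Space W] [WeaklyLocallyCompactSpace W] [SigmaCompactSpace W]
    (φ : κ → Y → ℝ) (hφ : ∀ k, ContinuousOn (φ k) W)
    (hi : ∀ x ∈ W, ∀ y ∈ W, (∀ k, φ k x = φ k y) → x = y) : Embeddable d W := by
  let e := Fintype.equivFin κ
  refine ⟨‹_›, ‹_›, ‹_›,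
    fun i => if h : (i : ℕ) < Fintype.card κ then φ (e.symm ⟨i, h⟩) else 0, fun i => ?_, ?_⟩
  · dsimp only
    split_ifs with h
    · exact hφ _
    · exact continuousOn_const
  · intro x hx y hy h
    refine hi x hx y hy fun k => ?_
    have := h (Fin.castLE hd (e k))
    simpa using this

variable {N : Type} [AddCommGroup N] [Module.Free ℤ N] [Module.Finite ℤ N] {Δ : Fan N}

/-- Real and imaginary parts of the generating characters are coordinates on the chart. Local
closedness of `Y` makes `W` locally compact, and second countability makes it σ-compact. -/
lemma embeddable_of_chart {Y : TopCat.{0}} (j : Y ⟶ TopCat.of Δ.X) (hj : Topology.IsEmbedding j)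
    (hr : IsLocallyClosed (Set.range j)) {σ : Δ.cones} {A : Finset (dualMonoid σ.1)}
    (hA : AddSubmonoid.closure (A : Set (dualMonoid σ.1)) = ⊤) {d : ℕ} (hd : 2 * A.card ≤ d)
    (W : Opens Y) (hW : ∀ y ∈ W, j y ∈ Set.range (Δ.chart σ)) : Embeddable d W := by
  choose e he using fun y : W => hW y y.2
  have hemb : Topology.IsEmbedding (Δ.chart σ ∘ e) := by
    have : Δ.chart σ ∘ e = j ∘ (Subtype.val : W → Y) := funext he
    rw [this]
    exact hj.comp Topology.IsEmbedding.subtypeVal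
  have hind : Topology.IsInducing e :=
    (Δ.isOpenEmbedding_chart σ).isInducing.of_comp_iff.1 hemb.isInducing
  have hinj : Function.Injective e := hemb.injective.of_comp
  have hcl : IsLocallyClosed (Set.range e) := by
    obtain ⟨O, hO, hOW⟩ := hj.isInducing.isOpen_iff.1 W.2
    have h₁ : Set.range e = Δ.chart σ ⁻¹' (Set.range j ∩ O) := by
      ext x
      constructor
      · rintro ⟨y, rfl⟩
        rw [Set.mem_preimage, he]
        refine ⟨⟨y, rfl⟩, ?_⟩
        have : (y : Y) ∈ j ⁻¹' O := by rw [hOW]; exact y.2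
        exact this
      · rintro ⟨⟨y, hy⟩, hO⟩
        have hyW : y ∈ W.carrier := by
          rw [← hOW, Set.mem_preimage, hy]
          exact hO
        exact ⟨⟨y, hyW⟩, (Δ.isOpenEmbedding_chart σ).injective ((he _).trans hy)⟩
    rw [h₁]
    exact (hr.inter hO.isLocallyClosed).preimage (Δ.isOpenEmbedding_chart σ).continuous
  have := Chart.locallyCompactSpace hA
  have := Chart.secondCountableTopology hA
  have : T2Space W := T2Space.of_injective_continuous hinj hind.continuous
  have : LocallyCompactSpace W := hind.locallyCompactSpace hcl
  have : SecondCountableTopology W := hind.secondCountableTopology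
  classical
  let ψ : A → Y → ℂ := fun a y => if h : y ∈ W then e ⟨y, h⟩ a else 0
  have hψ : ∀ a (y : W), ψ a y = e y a := fun a y => dif_pos y.2
  have hψc : ∀ a, ContinuousOn (ψ a) W := by
    intro a
    rw [continuousOn_iff_continuous_domRestrict]
    have : (W : Set Y).domRestrict (ψ a) = fun y => e y a := funext fun y => hψ a y
    rw [this]
    exact (Chart.continuous_eval _).comp hind.continuous
  refine Embeddable.of_fintype (κ := A ⊕ A) (by simpa [two_mul] using hd)
    (Sum.elim (fun a y => (ψ a y).re) fun a y => (ψ a y).im) ?_ ?_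
  · rintro (a | a)
    · exact Complex.continuous_re.comp_continuousOn (hψc a)
    · exact Complex.continuous_im.comp_continuousOn (hψc a)
  · intro x hx y hy h
    refine congrArg Subtype.val (hinj (a₁ := ⟨x, hx⟩) (a₂ := ⟨y, hy⟩) ?_)
    refine Chart.eq_of_generators hA fun a ha => ?_
    rw [← hψ ⟨a, ha⟩ ⟨x, hx⟩, ← hψ ⟨a, ha⟩ ⟨y, hy⟩]
    exact Complex.ext (h (.inl ⟨a, ha⟩)) (h (.inr ⟨a, ha⟩))

variable (Δ) in
lemma Fan.exists_embeddable : ∃ d : ℕ, ∀ (z : TopCat.of Δ.X) (V : Opens (TopCat.of Δ.X)), z ∈ V →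
    ∃ W : Opens (TopCat.of Δ.X), z ∈ W ∧ W ≤ V ∧ ∀ (Y : TopCat.{0}) (j : Y ⟶ TopCat.of Δ.X),
      Topology.IsEmbedding j → IsLocallyClosed (Set.range j) → ∀ P : Opens Y,
        P ≤ (Opens.map j).obj W → Embeddable d P := by
  have hA : ∀ σ : Δ.cones, ∃ A : Finset (dualMonoid σ.1),
      AddSubmonoid.closure (A : Set (dualMonoid σ.1)) = ⊤ := fun σ => by
    obtain ⟨s, hs⟩ := Δ.rational σ.1 σ.2
    exact exists_finset_closure_eq_top hs
  choose A hA using hA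
  have := Δ.finite.to_subtype
  obtain ⟨d, hd⟩ := Finite.exists_le fun σ => 2 * (A σ).card
  refine ⟨d, fun z V hz => ?_⟩
  obtain ⟨σ, ξ, rfl⟩ := Δ.exists_chart_eq z
  let R : Opens (TopCat.of Δ.X) := ⟨Set.range (Δ.chart σ), (Δ.isOpenEmbedding_chart σ).isOpen_range⟩
  exact ⟨V ⊓ R, ⟨hz, ξ, rfl⟩, inf_le_left, fun Y j hj hr P hP =>
    embeddable_of_chart j hj hr (hA σ) (hd σ) P fun y hy => (hP hy).2⟩

end Embeddable

end

end Toric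

/-! ### The main theorem -/

set_option maxHeartbeats 1000000 in
theorem mainTheorem7 {N : Type} [AddCommGroup N] [Module.Free ℤ N] [Module.Finite ℤ N]
    (Δ : Toric.Fan N) [HasDerivedCategory.{w} Δ.LC]
    [HasDerivedCategory.{w} (Toric.Sh (TopCat.of Δ.X))] :
    Δ.toDbLC.IsEquivalence ∧
    ∀ (Y : SubMulAction (Toric.Torus N) Δ.X) (hY : IsLocallyClosed (Y : Set Δ.X))
      [HasDerivedCategory.{w} (Toric.LCSub Y)]
      [HasDerivedCategory.{w} (Toric.Sh (TopCat.of Y))],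
      (Toric.toDbLCSub Y).IsEquivalence ∧
      ∃ (_ : EnoughInjectives Δ.LC) (_ : EnoughInjectives (Toric.LCSub Y))
        (hj : ∀ F, Toric.lcSub Y F → Δ.lc ((Toric.push (Toric.subIncl Y)).obj F))
        (hΓ : ∀ F, Δ.lc F → Δ.lc ((Toric.gammaSub Y hY).obj F))
        (h₁ : Toric.RightDerivedMapsTo (Toric.pushLC Y hj) Toric.bounded_le_plus
          DerivedCategory.TStructure.t.bounded)
        (h₂ : Toric.RightDerivedMapsTo (Toric.push (Toric.subIncl Y))
          (Toric.boundedWith_le_plus (Toric.lcSub Y)) (Toric.boundedWith Δ.lc))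
        (h₃ : Toric.RightDerivedMapsTo (Toric.gammaLC Y hY hΓ) Toric.bounded_le_plus
          DerivedCategory.TStructure.t.bounded)
        (h₄ : Toric.RightDerivedMapsTo (Toric.gammaSub Y hY)
          (Toric.boundedWith_le_plus Δ.lc) (Toric.boundedWith Δ.lc)),
        Nonempty (Toric.rightDerivedOn _ _ h₁ ⋙ Δ.toDbLC ≅
          Toric.toDbLCSub Y ⋙ Toric.rightDerivedOn _ _ h₂) ∧
        Nonempty ((Toric.rightDerivedOn _ _ h₃ ⋙ Toric.mapBounded (Toric.pullLC Y)) ⋙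
            Toric.toDbLCSub Y ≅
          Δ.toDbLC ⋙ (Toric.rightDerivedOn _ _ h₄ ⋙
            Toric.mapBoundedWith (Toric.pull (Toric.subIncl Y)) Δ.lc (Toric.lcSub Y)
              (Toric.lcSub_pull Y))) := by
  have hX := Δ.orbitCover
  obtain ⟨d, hd⟩ := Δ.exists_embeddable
  refine ⟨hX.isEquivalence, fun Y hY _ _ => ?_⟩
  have hq := Toric.orbitCoverSub Y
  -- Followed by `j`, the sheets of `Y` are the orbit maps in X of the points of `Y`, to which the
  -- local structure of X applies.
  have hnice : ∀ x, Toric.NiceAlong (Toric.orbitMapSub Y ≫ Toric.subIncl Y) (Δ.orbitIncl x) :=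
    fun x => Δ.niceAlong Subtype.val x
  have h₁ := Toric.sheetInvariant_closedIn Y id hY
  have h₂ := Toric.sheetInvariant_closureCompl Y id
  have hj := hq.locConstOn_push_comp (i' := Δ.orbitIncl) (Toric.subIncl Y) hnice
  have hΓ := hX.locConstOn_sectionsWithSupport hY h₁ h₂
  have enoughX := hX.enoughInjectives
  have enoughY := hq.enoughInjectives
  have hrange : IsLocallyClosed (Set.range (Toric.subIncl Y)) := by
    have : Set.range (Toric.subIncl Y) = (Y : Set Δ.X) := Subtype.range_val
    rw [this]
    exact hY
  obtain ⟨m₁, m₂, ⟨e⟩⟩ := hq.exists_push_iso (Toric.subIncl Y) hnice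
    (fun z => ⟨z, ⟨z, MulAction.mem_orbit_self z⟩, rfl⟩) d (fun z V hz => by
      obtain ⟨W, hzW, hWV, hW⟩ := hd z V hz
      exact ⟨W, hzW, hWV, hW _ _ (Toric.isEmbedding_subIncl Y) hrange _ le_rfl⟩) hj
  obtain ⟨m₃, m₄, ⟨e'⟩⟩ := hX.exists_sectionsWithSupport_iso hY h₁ h₂ d (fun z V hz => by
      obtain ⟨W, hzW, hWV, hW⟩ := hd z V hz
      -- The intersection of `P` with `W` is an open subset of `W`, so the identity of X serves as
      -- the embedding.
      refine ⟨W, hzW, hWV, fun P => hW _ (𝟙 _) Topology.IsEmbedding.id ?_ _ fun y hy =>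
        (Toric.mem_interOpen.1 hy).1⟩
      have : Set.range (𝟙 (TopCat.of Δ.X) : TopCat.of Δ.X ⟶ TopCat.of Δ.X) = Set.univ :=
        Set.range_id
      rw [this]
      exact isOpen_univ.isLocallyClosed) hΓ
  refine ⟨hq.isEquivalence, enoughX, enoughY, hj, hΓ, m₁, m₂, m₃, m₄, ⟨e⟩, ⟨?_⟩⟩
  -- Paste the comparison for sections with support with the square for the exact functor `j^*`.
  exact Functor.associator _ _ _ ≪≫
    Functor.isoWhiskerLeft _ (Toric.naturalFunctorSquare Δ.orbitIncl (Toric.orbitInclSub Y)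
      (Toric.pull (Toric.subIncl Y)) (Toric.lcSub_pull Y)) ≪≫
    (Functor.associator _ _ _).symm ≪≫ Functor.isoWhiskerRight e' _ ≪≫ Functor.associator _ _ _
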